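/- Let $A$ be a finite-dimensional $\mathbb C^*$-Hopf algebra: a Hopf algebra over $\mathbb C$ with a $*$-structure satisfying $\Delta(x^*)=\Delta(x)^*$ and a faithful finite-dimensional $*$-representation. Let $d_A=\dim A$, let $A^*$ be the dual algebra with product $(f g)(x)=\sum f(x_{(1)})g(x_{(2)})$ and unit $\epsilon$, and let $\mathbf c=\sum_x x\otimes\delta_x\in A\otimes A^*$ be the canonical element ($x$ runs over a basis of $A$, $\delta_x$ over the dual basis). (1) There is a positive integer $n$ with $\mathbf c^{n}=1\otimes\epsilon$. The least such $n$, the exponent $\eta$ of $A$, is also the least positive integer with $\sum z_{(1)}z_{(2)}\cdots z_{(\eta)}=\epsilon(z)1$ for all $z\in A$. Let $\rho$ be a $*$-representation of $A$ of dimension $d_\rho$, and $v=(v_{ij})$ a unitary corepresentation of dimension $d_v$, that is, $\Delta(v_{ij})=\sum_k v_{ik}\otimes v_{kj}$, $\epsilon(v_{ij})=\delta_{ij}$, $S(v_{ij})=v_{ji}^*$. Let $\hat U:\mathcal H_\rho\otimes\mathcal H_v\to\mathcal H_v\otimes\mathcal H_\rho$ be the gate $\langle i,a|\hat U|b,j\rangle=\rho_{ab}(v_{ij})$.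 On a ring of $L\ge 1$ unit cells (sites $\tfrac12,1,\tfrac32,\dots,L$, with $\mathcal H_\rho$ at the sites $j-\tfrac12$ and $\mathcal H_v$ at the sites $j$ at integer times) let $\mathbf U=\mathbf U_e\mathbf U_o=\prod_j\hat U_{j,j+1/2}\prod_j\hat U_{j-1/2,j}$ with periodic boundary conditions. For integer $t$ put $\mathbf U(t)=\mathbf U^t$; at half-integer time $t+\tfrac12$ the evolution operator is $\mathbf U_o\mathbf U^t$. (2) $\mathbf U^{\eta L}=1$. Hence the revival time $t_{\mathrm{rev}}$, the least positive integer $t$ with $\mathbf U^t=1$, exists and divides $\eta L$; if $\eta$ is even it divides $\eta L/2$. If $\mathcal H_\rho=\mathcal H_v$, then $\mathbf U(t+\eta L)=\mathbf U(t)$ for all $t\in\tfrac12\mathbb Z_{\ge0}$; the least positive $t\in\tfrac12\mathbb Z$ with $\mathbf U(t)=1$ exists, it equals the least positive $t\in\tfrac12\mathbb Z$ with $\mathbf U(t_0+t)=\mathbf U(t_0)$ for some $t_0>0$ in $\tfrac12\mathbb Z$, and $\eta L$ (for even $\eta$ also $\eta L/2$) is an integer multiple of it. (3) Entanglement revives with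 period $L/2$: let $\psi$ be a normalized matrix product state of bond dimension $\chi$ on the ring, with arbitrary site-dependent tensors. For every integer $k\ge 0$, at the times $t=kL/2$ and $t=t_k=(kL+1)/2$, the reduced density matrix of the evolved state on any contiguous block of sites has rank at most $C=d_\rho d_v\,(d_A^4\chi)^2$, and its von Neumann entropy and its Rényi entropies $\frac{1}{1-\alpha}\ln\operatorname{Tr}\hat\rho^{\,\alpha}$, for integers $\alpha\ge2$, are at most $\ln C$. The constant $C$ depends neither on $L$ nor on $k$. -/

import Mathlib

open scoped TensorProduct

noncomputable section

/-! ### Finite dimensional C*-Hopf algebras, representations and corepresentations -/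

/-- A `*`-algebra with a Hopf algebra structure over `ℂ` is a C*-Hopf algebra if the comultiplication
is compatible with the `*`-structure, `Δ(x*) = Δ(x)*`, and if there is a faithful finite dimensional
`*`-representation. (Used for finite dimensional `A`.) -/
class IsCStarHopfAlgebra (A : Type*) [Ring A] [StarRing A] [HopfAlgebra ℂ A] [StarModule ℂ A] :
    Prop where
  comul_star : ∀ x : A,
    Coalgebra.comul (R := ℂ) (star x) = star (Coalgebra.comul (R := ℂ) x : A ⊗[ℂ] A)
  exists_faithful : ∃ (n : ℕ) (φ : A →⋆ₐ[ℂ] Matrix (Fin n) (Fin n) ℂ), Function.Injective φ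

/-- `v = (v i j)` is a unitary corepresentation of `A`:
`Δ(v i j) = ∑ k, v i k ⊗ v k j`, `ε(v i j) = δ i j` and `S(v i j) = (v j i)*`. -/
structure IsUnitaryCorep {A κ : Type*} [Ring A] [StarRing A] [HopfAlgebra ℂ A]
    [Fintype κ] [DecidableEq κ] (v : κ → κ → A) : Prop where
  comul_apply : ∀ i j,
    (Coalgebra.comul (R := ℂ) (v i j) : A ⊗[ℂ] A) = ∑ k, v i k ⊗ₜ[ℂ] v k j
  counit_apply : ∀ i j, Coalgebra.counit (R := ℂ) (v i j) = if i = j then (1 : ℂ) else 0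
  antipode_apply : ∀ i j, HopfAlgebra.antipode ℂ (v i j) = star (v j i)

/-! ### The canonical element and the Sweedler powers -/

/-- The dual algebra `A*`: linear functionals on `A` with the product
`(f * g)(x) = ∑ f(x₍₁₎) g(x₍₂₎)` and the unit `ε`. -/
abbrev HopfDual (A : Type*) [Ring A] [HopfAlgebra ℂ A] : Type _ := WithConv (A →ₗ[ℂ] ℂ)

/-- The counit `ε` as an element of `A*`. -/
def counitDual (A : Type*) [Ring A] [HopfAlgebra ℂ A] : HopfDual A :=
  WithConv.toConv (Coalgebra.counit (R := ℂ) (A := A))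

/-- The canonical element `∑ x, x ⊗ δ_x` of `A ⊗ A*`, where `x` runs over a basis of `A` and `δ_x` is
the dual basis. -/
def canonicalElement {A B : Type*} [Ring A] [HopfAlgebra ℂ A] [Fintype B]
    (b : Module.Basis B ℂ A) : A ⊗[ℂ] HopfDual A :=
  ∑ x, b x ⊗ₜ[ℂ] (WithConv.toConv (b.coord x) : HopfDual A)

/-- The linear map `z ↦ ∑ z₍₁₎ z₍₂₎ ⋯ z₍ₙ₎` (for `n = 0` it is `z ↦ ε(z) 1`). -/
def sweedlerPower (A : Type*) [Ring A] [HopfAlgebra ℂ A] : ℕ → (A →ₗ[ℂ] A)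
  | 0 => Algebra.linearMap ℂ A ∘ₗ Coalgebra.counit
  | n + 1 => LinearMap.mul' ℂ A ∘ₗ (sweedlerPower A n).rTensor A ∘ₗ Coalgebra.comul

/-! ### The brickwork circuit on a ring of `L` unit cells (`2L` qudits) -/

/-- Basis states of the ring: for each unit cell `x : Fin L` (read cyclically), one index in `α` at
the left site and one index in `β` at the right site. The sites in cyclic order are
left `0`, right `0`, left `1`, right `1`, …, right `L - 1`. -/
abbrev RingConfig (L : ℕ) (α β : Type*) : Type _ := (Fin L → α) × (Fin L → β)

section Circuit

variable {A ι κ : Type*} [Ring A] [StarRing A] [HopfAlgebra ℂ A]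
  [Fintype ι] [DecidableEq ι] [Fintype κ] [DecidableEq κ]

/-- The gate `H_ρ ⊗ H_v → H_v ⊗ H_ρ` with `⟨i, a| U |b, j⟩ = ρ(v i j) a b`. -/
def circuitGate (ρ : A →⋆ₐ[ℂ] Matrix ι ι ℂ) (v : κ → κ → A) : Matrix (κ × ι) (ι × κ) ℂ :=
  Matrix.of fun out inp => ρ (v out.1 inp.2) out.2 inp.1

/-- The first layer: gates on the bonds (left `x`, right `x`). It turns a chain with `ρ`-legs on the
left sites and `v`-legs on the right sites into one with these roles exchanged. -/
def oddLayer (L : ℕ) (ρ : A →⋆ₐ[ℂ] Matrix ι ι ℂ) (v : κ → κ → A) :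
    Matrix (RingConfig L κ ι) (RingConfig L ι κ) ℂ :=
  Matrix.of fun out inp => ∏ x, circuitGate ρ v (out.1 x, out.2 x) (inp.1 x, inp.2 x)

/-- The second layer: gates on the bonds (right `x`, left `x + 1`), with periodic boundary
conditions. -/
def evenLayer (L : ℕ) [NeZero L] (ρ : A →⋆ₐ[ℂ] Matrix ι ι ℂ) (v : κ → κ → A) :
    Matrix (RingConfig L ι κ) (RingConfig L κ ι) ℂ :=
  Matrix.of fun out inp =>
    ∏ x, circuitGate ρ v (out.2 x, out.1 (x + 1)) (inp.2 x, inp.1 (x + 1))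

/-- The evolution operator of one period (unit time); `U(t) = U ^ t` for integer `t`. -/
def floquet (L : ℕ) [NeZero L] (ρ : A →⋆ₐ[ℂ] Matrix ι ι ℂ) (v : κ → κ → A) :
    Matrix (RingConfig L ι κ) (RingConfig L ι κ) ℂ :=
  evenLayer L ρ v * oddLayer L ρ v

/-- For `H_ρ = H_v`: the evolution operator `U(n/2)` at time `n/2`, i.e. the product of the first `n`
layers. -/
def halfStepEvolution (L : ℕ) [NeZero L] (ρ : A →⋆ₐ[ℂ] Matrix ι ι ℂ) (v : ι → ι → A) :
    ℕ → Matrix (RingConfig L ι ι) (RingConfig L ι ι) ℂ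
  | 0 => 1
  | n + 1 => (if Even n then oddLayer L ρ v else evenLayer L ρ v) * halfStepEvolution L ρ v n

end Circuit

/-! ### Matrix product states and entanglement -/

/-- `ψ` is a matrix product state of bond dimension `χ` on the ring (site dependent tensors). -/
def IsMPS {L : ℕ} {α β : Type*} (χ : ℕ) (ψ : RingConfig L α β → ℂ) : Prop :=
  ∃ (M : Fin L → α → Matrix (Fin χ) (Fin χ) ℂ) (N : Fin L → β → Matrix (Fin χ) (Fin χ) ℂ),
    ∀ σ, ψ σ = (List.ofFn fun x => M x (σ.1 x) * N x (σ.2 x)).prod.trace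

/-- The contiguous block of the sites `s, s + 1, …, s + m - 1` modulo `2L`, where left `x` is the site
`2x` and right `x` is the site `2x + 1`; given as its left sites and its right sites. -/
def siteBlock (L s m : ℕ) : Finset (Fin L) × Finset (Fin L) :=
  (Finset.univ.filter fun x => ∃ r < m, (s + r) % (2 * L) = 2 * (x : ℕ),
   Finset.univ.filter fun x => ∃ r < m, (s + r) % (2 * L) = 2 * (x : ℕ) + 1)

/-- Basis states of a subsystem `R`. -/
abbrev InnerConfig {L : ℕ} (R : Finset (Fin L) × Finset (Fin L)) (α β : Type*) : Type _ :=
  ({x // x ∈ R.1} → α) × ({x // x ∈ R.2} → β)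

/-- Basis states of the complement of a subsystem `R`. -/
abbrev OuterConfig {L : ℕ} (R : Finset (Fin L) × Finset (Fin L)) (α β : Type*) : Type _ :=
  ({x // x ∉ R.1} → α) × ({x // x ∉ R.2} → β)

/-- The basis state of the ring that is `a` on `R` and `c` on the complement of `R`. -/
def glueConfig {L : ℕ} {α β : Type*} (R : Finset (Fin L) × Finset (Fin L))
    (a : InnerConfig R α β) (c : OuterConfig R α β) : RingConfig L α β :=
  (fun x => if h : x ∈ R.1 then a.1 ⟨x, h⟩ else c.1 ⟨x, h⟩,
   fun x => if h : x ∈ R.2 then a.2 ⟨x, h⟩ else c.2 ⟨x, h⟩)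

/-- The reduced density matrix on `R` of the pure state `ψ`. -/
def reducedDensity {L : ℕ} {α β : Type*} [Fintype α] [Fintype β]
    (R : Finset (Fin L) × Finset (Fin L)) (ψ : RingConfig L α β → ℂ) :
    Matrix (InnerConfig R α β) (InnerConfig R α β) ℂ :=
  Matrix.of fun a a' =>
    ∑ c : OuterConfig R α β, ψ (glueConfig R a c) * star (ψ (glueConfig R a' c))

/-- The Rényi entropy `ln (Tr σ^α) / (1 - α)` of index `α` (used for integers `α ≥ 2`). -/
def renyiEntropy {n : Type*} [Fintype n] [DecidableEq n] (α : ℕ) (σ : Matrix n n ℂ) : ℝ :=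
  Real.log (σ ^ α).trace.re / (1 - α)

/-- The von Neumann entropy `- ∑ p ln p`, the sum over the eigenvalues of `σ` with multiplicity. -/
def vonNeumannEntropy {n : Type*} [Fintype n] [DecidableEq n] (σ : Matrix n n ℂ) : ℝ :=
  (σ.charpoly.roots.map fun p => Real.negMulLog p.re).sum

/-- Across the two ends of any contiguous block, the state `ψ` has Schmidt rank at most `C`, and von
Neumann and Rényi entanglement entropies at most `ln C`. -/
def EntanglementBound {L : ℕ} {α β : Type*} [Fintype α] [Fintype β] [DecidableEq α]
    [DecidableEq β] (C : ℕ) (ψ : RingConfig L α β → ℂ) : Prop :=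
  ∀ s m : ℕ,
    (reducedDensity (siteBlock L s m) ψ).rank ≤ C ∧
    vonNeumannEntropy (reducedDensity (siteBlock L s m) ψ) ≤ Real.log C ∧
    ∀ α : ℕ, 2 ≤ α → renyiEntropy α (reducedDensity (siteBlock L s m) ψ) ≤ Real.log C

end

/-! Two facts carry everything: the identity map of A has finite order for the convolution product,
and L layers of the circuit are conjugate to one evaluation of the canonical element.

Finite exponent. The normalized trace h of the regular representation is a faithful positive trace.
Since a ⊗ b ↦ Δ(a)(1 ⊗ b) intertwines x ⊗ 1 with Δ(x), h is idempotent for convolution; positivity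
upgrades this to invariance (`rt_haar`), and an invariant trace forces S² = 1 (`antipode_antipode`).
For a faithful *-representation φ on ℂ^m, the map T : x ⊗ b ↦ b₍₁₎x ⊗ b₍₂₎ is the canonical twist of
a free Yetter-Drinfeld module ℂ^m ⊗ A and commutes with its action and coaction. Each eigenspace of
T is therefore a Yetter-Drinfeld module with scalar twist. On such a module a comparison of
determinants, using S² = 1 and the fact that tensoring with the regular corepresentation trivializes
any corepresentation (`det_fuse_pow`), makes the scalar a root of unity
(`yetterDrinfeld_twist_pow`). As T preserves the Haar inner product it is diagonalizable, so T^N =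
1. Finally T is inverse to the image of id under a faithful anti-homomorphism of the convolution
algebra, so the N-th convolution power of id is trivial.

Periodicity. In a frame moving with both kinds of sites, layer k couples the ρ-site i to the v-site
i + k, so L layers couple every pair exactly once. Gates sharing no site commute. Let U be the
ordered product over pairs i ≤ j and D the one over j < i. Then L layers make up DU
(`layers_eq_gateProd`), while UD is an ordered product over a full square, which collapses to a
single operator: the convolution product of all ρ's applied to the product of all v's
(`gateProd_all`). Its k-th power inserts the k-th Sweedler power (`fuse_pow`), so (DU)^η = 1.

Entanglement. From (DU)^k = D(UD)^k D⁻¹, and since ρ-sites and v-sites interact in each collapsed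
rectangle only through one pairing of A* with A, each of the three factors has operator Schmidt rank
at most d_A² across the ends of a block, for all L and k. The initial state contributes χ². After kL
layers the block looks the same to both kinds of sites; one layer later it differs from a block of
whole cells by at most one site of each kind, which costs d_ρ d_v. Entropies are bounded by the
logarithm of the rank. -/

open scoped TensorProduct

noncomputable section

namespace CStarHopf

open Coalgebra WithConv

/-! ### Corepresentation matrices -/

section Corep

variable {A : Type*} [Ring A] [HopfAlgebra ℂ A]

/-- A matrix over `A` that is a corepresentation. -/
structure IsCorep {n : Type*} [Fintype n] [DecidableEq n] (v : Matrix n n A) : Prop where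
  comul_apply : ∀ i j, (comul (R := ℂ) (v i j) : A ⊗[ℂ] A) = ∑ k, v i k ⊗ₜ[ℂ] v k j
  counit_apply : ∀ i j, counit (R := ℂ) (v i j) = if i = j then (1 : ℂ) else 0

lemma _root_.IsUnitaryCorep.isCorep [StarRing A] {n : Type*} [Fintype n] [DecidableEq n]
    {v : n → n → A} (hv : IsUnitaryCorep v) : IsCorep (Matrix.of v) :=
  ⟨hv.comul_apply, hv.counit_apply⟩

section

variable {n : Type*} [Fintype n] [DecidableEq n] {v : Matrix n n A}

lemma IsCorep.conv_apply {M : Type*} [Ring M] [Algebra ℂ M] (hv : IsCorep v)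
    (f g : WithConv (A →ₗ[ℂ] M)) (i j : n) :
    (f * g) (v i j) = ∑ k, f (v i k) * g (v k j) := by
  simp [LinearMap.convMul_apply, hv.comul_apply]

lemma IsCorep.antipode_mul (hv : IsCorep v) : v.map (HopfAlgebra.antipode ℂ) * v = 1 := by
  ext i j
  have h := HopfAlgebra.mul_antipode_rTensor_comul_apply (R := ℂ) (v i j)
  rw [hv.comul_apply, hv.counit_apply] at h
  simp only [map_sum, LinearMap.rTensor_tmul, LinearMap.mul'_apply] at h
  rw [Matrix.mul_apply, Matrix.one_apply]
  simp only [Matrix.map_apply, h]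
  split_ifs <;> simp

lemma IsCorep.mul_antipode (hv : IsCorep v) : v * v.map (HopfAlgebra.antipode ℂ) = 1 := by
  ext i j
  have h := HopfAlgebra.mul_antipode_lTensor_comul_apply (R := ℂ) (v i j)
  rw [hv.comul_apply, hv.counit_apply] at h
  simp only [map_sum, LinearMap.lTensor_tmul, LinearMap.mul'_apply] at h
  rw [Matrix.mul_apply, Matrix.one_apply]
  simp only [Matrix.map_apply, h]
  split_ifs <;> simp

lemma IsCorep.sum_antipode_mul (hv : IsCorep v) (i j : n) :
    ∑ k, HopfAlgebra.antipode ℂ (v i k) * v k j = if i = j then 1 else 0 := by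
  have := congrFun (congrFun hv.antipode_mul i) j
  simpa [Matrix.mul_apply, Matrix.one_apply] using this

lemma IsCorep.sum_mul_antipode (hv : IsCorep v) (i j : n) :
    ∑ k, v i k * HopfAlgebra.antipode ℂ (v k j) = if i = j then 1 else 0 := by
  have := congrFun (congrFun hv.mul_antipode i) j
  simpa [Matrix.mul_apply, Matrix.one_apply] using this

/-- Entrywise Δ of S(v) is a left inverse of Δ(v) and the displayed matrix is a right inverse, so
the two coincide. -/
lemma IsCorep.comul_antipode (hv : IsCorep v) (i j : n) :
    (comul (R := ℂ) (HopfAlgebra.antipode ℂ (v i j)) : A ⊗[ℂ] A) =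
      ∑ k, HopfAlgebra.antipode ℂ (v k j) ⊗ₜ[ℂ] HopfAlgebra.antipode ℂ (v i k) := by
  let X : Matrix n n (A ⊗[ℂ] A) := v.map (Bialgebra.comulAlgHom ℂ A)
  let Y : Matrix n n (A ⊗[ℂ] A) :=
    (v.map (HopfAlgebra.antipode ℂ)).map (Bialgebra.comulAlgHom ℂ A)
  let Z : Matrix n n (A ⊗[ℂ] A) := Matrix.of fun i j =>
    ∑ k, HopfAlgebra.antipode ℂ (v k j) ⊗ₜ[ℂ] HopfAlgebra.antipode ℂ (v i k)
  have hYX : Y * X = 1 := by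
    simp only [X, Y]
    rw [← Matrix.map_mul, hv.antipode_mul, Matrix.map_one _ (map_zero _) (map_one _)]
  have hXZ : X * Z = 1 := by
    have hX : X = v.map (Algebra.TensorProduct.includeLeft (R := ℂ) (S := ℂ) (A := A) (B := A)) *
        v.map (Algebra.TensorProduct.includeRight (R := ℂ) (A := A) (B := A)) := by
      ext i j
      simp [X, hv.comul_apply, Matrix.mul_apply]
    have hZ : Z = (v.map (HopfAlgebra.antipode ℂ)).map
          (Algebra.TensorProduct.includeRight (R := ℂ) (A := A) (B := A)) *
        (v.map (HopfAlgebra.antipode ℂ)).map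
          (Algebra.TensorProduct.includeLeft (R := ℂ) (S := ℂ) (A := A) (B := A)) := by
      ext i j
      simp [Z, Matrix.mul_apply]
    rw [hX, hZ, Matrix.mul_assoc, ← Matrix.mul_assoc (v.map _) ((v.map _).map _), ← Matrix.map_mul,
      hv.mul_antipode, Matrix.map_one _ (map_zero _) (map_one _), Matrix.one_mul, ← Matrix.map_mul,
      hv.mul_antipode, Matrix.map_one _ (map_zero _) (map_one _)]
  have : Y = Z := left_inv_eq_right_inv hYX hXZ
  exact congrFun (congrFun this i) j

end

/-! ### Slices of tensors -/


lemma tmul_slice_left {V W B : Type*} [AddCommGroup V] [Module ℂ V] [AddCommGroup W] [Module ℂ W]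
    [Fintype B] (b : Module.Basis B ℂ V) (z : V ⊗[ℂ] W) :
    z = ∑ i, b i ⊗ₜ[ℂ] TensorProduct.lid ℂ W ((b.coord i).rTensor W z) := by
  induction z with
  | zero => simp
  | tmul x y =>
    simp only [LinearMap.rTensor_tmul, TensorProduct.lid_tmul, Module.Basis.coord_apply,
      TensorProduct.tmul_smul]
    simp_rw [TensorProduct.smul_tmul', ← TensorProduct.sum_tmul, b.sum_repr]
  | add x y hx hy =>
    simp only [map_add, TensorProduct.tmul_add, Finset.sum_add_distrib]
    rw [← hx, ← hy]

lemma tmul_slice_right {V W B : Type*} [AddCommGroup V] [Module ℂ V] [AddCommGroup W] [Module ℂ W]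
    [Fintype B] (b : Module.Basis B ℂ W) (z : V ⊗[ℂ] W) :
    z = ∑ i, TensorProduct.rid ℂ V ((b.coord i).lTensor V z) ⊗ₜ[ℂ] b i := by
  induction z with
  | zero => simp
  | tmul x y =>
    simp only [LinearMap.lTensor_tmul, TensorProduct.rid_tmul, Module.Basis.coord_apply]
    simp_rw [TensorProduct.smul_tmul, ← TensorProduct.tmul_sum, b.sum_repr]
  | add x y hx hy =>
    simp only [map_add, TensorProduct.add_tmul, Finset.sum_add_distrib]
    rw [← hx, ← hy]

lemma sum_basis_tmul_injective {V W B : Type*} [AddCommGroup V] [Module ℂ V] [AddCommGroup W]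
    [Module ℂ W] [Fintype B] [DecidableEq B] (b : Module.Basis B ℂ V) {x y : B → W}
    (h : ∑ i, b i ⊗ₜ[ℂ] x i = ∑ i, b i ⊗ₜ[ℂ] y i) : x = y := by
  funext j
  have := congrArg (fun z => TensorProduct.lid ℂ W ((b.coord j).rTensor W z)) h
  simpa [Finsupp.single_apply] using this

/-- `b ↦ f(b₍₁₎) b₍₂₎`. -/
def lt (f : A →ₗ[ℂ] ℂ) : A →ₗ[ℂ] A :=
  (TensorProduct.lid ℂ A).toLinearMap ∘ₗ f.rTensor A ∘ₗ comul

/-- `b ↦ b₍₁₎ f(b₍₂₎)`. -/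
def rt (f : A →ₗ[ℂ] ℂ) : A →ₗ[ℂ] A :=
  (TensorProduct.rid ℂ A).toLinearMap ∘ₗ f.lTensor A ∘ₗ comul

lemma lt_of_comul (f : A →ₗ[ℂ] ℂ) {ι : Type*} {s : Finset ι} {a : A} {x y : ι → A}
    (h : comul a = ∑ i ∈ s, x i ⊗ₜ[ℂ] y i) : lt f a = ∑ i ∈ s, f (x i) • y i := by
  simp [lt, h]

lemma rt_of_comul (f : A →ₗ[ℂ] ℂ) {ι : Type*} {s : Finset ι} {a : A} {x y : ι → A}
    (h : comul a = ∑ i ∈ s, x i ⊗ₜ[ℂ] y i) : rt f a = ∑ i ∈ s, f (y i) • x i := by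
  simp [rt, h]

/-! ### The regular corepresentation, whose coefficients span A -/

section Regular

variable {B : Type*} [Fintype B] [DecidableEq B] (b : Module.Basis B ℂ A)

/-- The matrix coefficients of the regular corepresentation: `Δ(b j) = ∑ i, b i ⊗ u i j`. -/
def regCorep : Matrix B B A := Matrix.of fun i j => lt (b.coord i) (b j)

omit [DecidableEq B] in
lemma comul_basis (j : B) : comul (R := ℂ) (b j) = ∑ i, b i ⊗ₜ[ℂ] regCorep b i j :=
  tmul_slice_left b _

lemma regCorep_isCorep : IsCorep (regCorep b) where
  comul_apply i j := by
    have h := Coalgebra.coassoc_apply (R := ℂ) (b j)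
    rw [comul_basis] at h
    simp only [map_sum, LinearMap.rTensor_tmul, LinearMap.lTensor_tmul, comul_basis,
      TensorProduct.sum_tmul, TensorProduct.assoc_tmul] at h
    rw [Finset.sum_comm] at h
    simp only [← TensorProduct.tmul_sum] at h
    exact (congrFun (sum_basis_tmul_injective b h) i).symm
  counit_apply i j := by
    have h := Coalgebra.lTensor_counit_comul (R := ℂ) (b j)
    rw [comul_basis] at h
    simp only [map_sum, LinearMap.lTensor_tmul] at h
    have h2 : (b j ⊗ₜ[ℂ] (1 : ℂ) : A ⊗[ℂ] ℂ) = ∑ i, b i ⊗ₜ[ℂ] (if i = j then (1 : ℂ) else 0) := by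
      rw [Finset.sum_eq_single j] <;> simp +contextual
    rw [h2] at h
    exact congrFun (sum_basis_tmul_injective b h) i

lemma basis_eq_sum_regCorep (j : B) : b j = ∑ i, counit (R := ℂ) (b i) • regCorep b i j := by
  have h := Coalgebra.rTensor_counit_comul (R := ℂ) (b j)
  rw [comul_basis] at h
  have h2 := congrArg (TensorProduct.lid ℂ A) h
  simpa using h2.symm

lemma ext_regCorep {M : Type*} [AddCommGroup M] [Module ℂ M] {f g : A →ₗ[ℂ] M}
    (h : ∀ i j, f (regCorep b i j) = g (regCorep b i j)) : f = g := by
  refine b.ext fun j => ?_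
  rw [basis_eq_sum_regCorep b j]
  simp [h]

end Regular

/-- Identities in Sweedler notation can be checked on corepresentation coefficients, where Δ is an
explicit finite sum. -/
lemma conv_ext [FiniteDimensional ℂ A] {M : Type*} [AddCommGroup M] [Module ℂ M]
    {f g : A →ₗ[ℂ] M} (h : ∀ (n : ℕ) (v : Matrix (Fin n) (Fin n) A), IsCorep v → ∀ i j,
      f (v i j) = g (v i j)) : f = g :=
  ext_regCorep (Module.finBasis ℂ A) (h _ _ (regCorep_isCorep _))

lemma sweedlerPower_eq (n : ℕ) :
    sweedlerPower A n = ((toConv (LinearMap.id : A →ₗ[ℂ] A)) ^ n).ofConv := by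
  induction n with
  | zero => rfl
  | succ n ih =>
    rw [pow_succ, LinearMap.convMul_def, sweedlerPower, ih]
    simp [LinearMap.rTensor]

lemma eq_of_forall_functional {V : Type*} [AddCommGroup V] [Module ℂ V] {x y : V}
    (h : ∀ f : V →ₗ[ℂ] ℂ, f x = f y) : x = y := by
  rw [← sub_eq_zero]
  exact (Module.forall_dual_apply_eq_zero_iff ℂ _).1 fun f => by
    rw [map_sub, h, sub_self]

end Corep

/-! ### The Haar functional -/

/-- Stated for a `Core` so that different inner products can be used on `A` without fixing a norm on
it. -/
lemma exists_orthonormal_basis {V : Type*} [AddCommGroup V] [Module ℂ V] [FiniteDimensional ℂ V]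
    (c : InnerProductSpace.Core ℂ V) :
    ∃ e : Module.Basis (Fin (Module.finrank ℂ V)) ℂ V,
      ∀ i j, c.inner (e i) (e j) = if i = j then 1 else 0 := by
  let _ : NormedAddCommGroup V := c.toNormedAddCommGroup
  let _ : InnerProductSpace ℂ V := InnerProductSpace.ofCore c.toCore
  refine ⟨(stdOrthonormalBasis ℂ V).toBasis, fun i j => ?_⟩
  have := orthonormal_iff_ite.1 (stdOrthonormalBasis ℂ V).orthonormal i j
  simp only [OrthonormalBasis.coe_toBasis]
  exact this

lemma core_sum_right {V ι : Type*} [AddCommGroup V] [Module ℂ V]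
    (c : InnerProductSpace.Core ℂ V) (x : V) (s : Finset ι) (y : ι → V) (r : ι → ℂ) :
    c.inner x (∑ i ∈ s, r i • y i) = ∑ i ∈ s, r i * c.inner x (y i) := by
  let _ : NormedAddCommGroup V := c.toNormedAddCommGroup
  let _ : InnerProductSpace ℂ V := InnerProductSpace.ofCore c.toCore
  have : inner ℂ x (∑ i ∈ s, r i • y i) = ∑ i ∈ s, r i * inner ℂ x (y i) := by
    rw [inner_sum]
    simp_rw [inner_smul_right]
  exact this

lemma coord_eq_core_inner {V ι : Type*} [Fintype ι] [DecidableEq ι] [AddCommGroup V] [Module ℂ V]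
    (c : InnerProductSpace.Core ℂ V) (e : Module.Basis ι ℂ V)
    (he : ∀ i j, c.inner (e i) (e j) = if i = j then 1 else 0) (i : ι) (x : V) :
    e.repr x i = c.inner (e i) x := by
  conv_rhs => rw [← e.sum_repr x]
  rw [core_sum_right]
  simp [he]

lemma core_eq_zero_of_sum {V ι : Type*} [Fintype ι] [AddCommGroup V] [Module ℂ V]
    (c : InnerProductSpace.Core ℂ V) (w : ι → V) (h : ∑ i, c.inner (w i) (w i) = 0) (i : ι) :
    w i = 0 := by
  have h1 : ∑ i, (c.inner (w i) (w i)).re = 0 := by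
    rw [← Complex.re_sum, h]; rfl
  have h2 : ∀ i ∈ Finset.univ, 0 ≤ (c.inner (w i) (w i)).re := fun i _ => c.re_inner_nonneg _
  rw [Finset.sum_eq_zero_iff_of_nonneg h2] at h1
  refine c.definite _ (Complex.ext (h1 i (Finset.mem_univ _)) ?_)
  have := congrArg Complex.im (c.conj_inner_symm (w i) (w i))
  simp only [Complex.conj_im] at this
  simp only [Complex.zero_im]
  linarith

/-- The trace of the left regular representation of an algebra. -/
def regTrace (A : Type*) [Ring A] [Algebra ℂ A] : A →ₗ[ℂ] ℂ :=
  LinearMap.trace ℂ A ∘ₗ (Algebra.lmul ℂ A).toLinearMap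

lemma regTrace_apply {A : Type*} [Ring A] [Algebra ℂ A] (x : A) :
    regTrace A x = LinearMap.trace ℂ A (Algebra.lmul ℂ A x) := rfl

lemma regTrace_one {A : Type*} [Ring A] [Algebra ℂ A] [FiniteDimensional ℂ A] :
    regTrace A 1 = Module.finrank ℂ A := by
  rw [regTrace_apply, map_one, LinearMap.trace_one]

section Haar

variable {A : Type*} [Ring A] [StarRing A] [HopfAlgebra ℂ A] [StarModule ℂ A]

/-- The inner product `tr (φ(x)* φ(y))` defined by a faithful `*`-representation. -/
@[reducible] def traceCore {n : ℕ} (φ : A →⋆ₐ[ℂ] Matrix (Fin n) (Fin n) ℂ) (hφ : Function.Injective φ) :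
    InnerProductSpace.Core ℂ A where
  inner x y := (φ (star x * y)).trace
  conj_inner_symm x y := by
    have : star (φ (star y * x)) = φ (star x * y) := by rw [← map_star, star_mul, star_star]
    rw [← this, Matrix.star_eq_conjTranspose, Matrix.trace_conjTranspose]
    rfl
  re_inner_nonneg x := by
    rw [map_mul, map_star, Matrix.star_eq_conjTranspose]
    open scoped ComplexOrder in
    have := (Matrix.posSemidef_conjTranspose_mul_self (φ x)).trace_nonneg
    exact (Complex.le_def.1 this).1
  add_left x y z := by simp [add_mul]
  smul_left x y r := by simp
  definite x h := by
    rw [map_mul, map_star, Matrix.star_eq_conjTranspose] at h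
    open scoped ComplexOrder in
    rw [Matrix.trace_conjTranspose_mul_self_eq_zero_iff] at h
    exact hφ (by rw [h, map_zero])

variable [FiniteDimensional ℂ A]

omit [StarRing A] [StarModule ℂ A] [FiniteDimensional ℂ A] in
lemma trace_eq_sum_core (c : InnerProductSpace.Core ℂ A) {ι : Type*} [Fintype ι] [DecidableEq ι]
    (e : Module.Basis ι ℂ A) (he : ∀ i j, c.inner (e i) (e j) = if i = j then 1 else 0) (x : A) :
    regTrace A x = ∑ i, c.inner (e i) (x * e i) := by
  rw [regTrace_apply, LinearMap.trace_eq_matrix_trace ℂ e, Matrix.trace]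
  refine Finset.sum_congr rfl fun i _ => ?_
  rw [Matrix.diag_apply, LinearMap.toMatrix_apply, coord_eq_core_inner c e he]
  rfl

variable [IsCStarHopfAlgebra A]

/-- For the trace inner product of a faithful *-representation, left multiplication by x* is the
adjoint of left multiplication by x. -/
lemma regTrace_star (x : A) : regTrace A (star x) = star (regTrace A x) := by
  obtain ⟨n, φ, hφ⟩ := IsCStarHopfAlgebra.exists_faithful (A := A)
  obtain ⟨e, he⟩ := exists_orthonormal_basis (traceCore φ hφ)
  rw [trace_eq_sum_core _ e he, trace_eq_sum_core _ e he, star_sum]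
  refine Finset.sum_congr rfl fun i _ => ?_
  have := (traceCore φ hφ).conj_inner_symm (star x * e i) (e i)
  have h2 : (traceCore φ hφ).inner (star x * e i) (e i) =
      (traceCore φ hφ).inner (e i) (x * e i) := by
    change (φ _).trace = (φ _).trace
    simp only [star_mul, star_star, mul_assoc]
  rw [h2.symm]
  have h3 := (traceCore φ hφ).conj_inner_symm (e i) (star x * e i)
  exact h3.symm

/-- In an orthonormal basis e the trace is ∑ ‖x e_i‖²; if it vanishes, x kills a basis and hence the
unit. -/
lemma regTrace_star_mul_self (x : A) :
    0 ≤ (regTrace A (star x * x)).re ∧ (regTrace A (star x * x) = 0 → x = 0) := by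
  obtain ⟨n, φ, hφ⟩ := IsCStarHopfAlgebra.exists_faithful (A := A)
  set c := traceCore φ hφ
  obtain ⟨e, he⟩ := exists_orthonormal_basis c
  have key : regTrace A (star x * x) = ∑ i, c.inner (x * e i) (x * e i) := by
    rw [trace_eq_sum_core _ e he]
    refine Finset.sum_congr rfl fun i _ => ?_
    change (φ _).trace = (φ _).trace
    simp only [star_mul, mul_assoc]
  rw [key]
  refine ⟨?_, fun h => ?_⟩
  · rw [Complex.re_sum]
    exact Finset.sum_nonneg fun i _ => c.re_inner_nonneg _
  · have h0 : ∀ i, x * e i = 0 := core_eq_zero_of_sum c _ h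
    have h2 : LinearMap.mulLeft ℂ x = 0 := e.ext fun i => by simpa using h0 i
    simpa using LinearMap.congr_fun h2 1

omit [StarRing A] [StarModule ℂ A] [IsCStarHopfAlgebra A] in
lemma finrank_ne_zero : (Module.finrank ℂ A : ℂ) ≠ 0 := by
  have : Nontrivial A := by
    refine ⟨0, 1, fun h => ?_⟩
    have := congrArg (counit (R := ℂ)) h
    simp at this
  exact_mod_cast Module.finrank_pos.ne'

/-- The Haar functional: the normalized trace of the regular representation. -/
def haar (A : Type*) [Ring A] [HopfAlgebra ℂ A] : A →ₗ[ℂ] ℂ :=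
  (Module.finrank ℂ A : ℂ)⁻¹ • regTrace A

omit [StarRing A] [StarModule ℂ A] [IsCStarHopfAlgebra A] in
lemma haar_one : haar A 1 = 1 := by
  rw [haar, LinearMap.smul_apply, regTrace_one, smul_eq_mul, inv_mul_cancel₀ finrank_ne_zero]

omit [StarRing A] [StarModule ℂ A] [FiniteDimensional ℂ A] [IsCStarHopfAlgebra A] in
lemma haar_mul_comm (x y : A) : haar A (x * y) = haar A (y * x) := by
  have : regTrace A (x * y) = regTrace A (y * x) := by
    rw [regTrace_apply, regTrace_apply, map_mul (Algebra.lmul ℂ A), map_mul (Algebra.lmul ℂ A)]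
    exact LinearMap.trace_mul_comm ℂ _ _
  simp [haar, this]

lemma haar_star (x : A) : haar A (star x) = star (haar A x) := by
  simp [haar, regTrace_star]

/-- The inner product `h(x* y)`. -/
@[reducible] def haarCore (A : Type*) [Ring A] [StarRing A] [HopfAlgebra ℂ A] [StarModule ℂ A]
    [FiniteDimensional ℂ A] [IsCStarHopfAlgebra A] : InnerProductSpace.Core ℂ A where
  inner x y := haar A (star x * y)
  conj_inner_symm x y := by
    change star _ = _
    rw [← haar_star, star_mul, star_star]
  re_inner_nonneg x := by
    have := (regTrace_star_mul_self x).1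
    change 0 ≤ ((Module.finrank ℂ A : ℂ)⁻¹ * _).re
    rw [← Complex.ofReal_natCast, ← Complex.ofReal_inv, Complex.re_ofReal_mul]
    positivity
  add_left x y z := by simp [add_mul]
  smul_left x y r := by simp
  definite x h := by
    refine (regTrace_star_mul_self x).2 ?_
    have h' : (Module.finrank ℂ A : ℂ)⁻¹ * regTrace A (star x * x) = 0 := h
    exact (mul_eq_zero.1 h').resolve_left (inv_ne_zero finrank_ne_zero)

/-- `(h ⊗ h)` as a functional on `A ⊗ A`. -/
def haarTensor (A : Type*) [Ring A] [HopfAlgebra ℂ A] : A ⊗[ℂ] A →ₗ[ℂ] ℂ :=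
  (TensorProduct.lid ℂ ℂ).toLinearMap ∘ₗ TensorProduct.map (haar A) (haar A)

omit [StarRing A] [StarModule ℂ A] [FiniteDimensional ℂ A] [IsCStarHopfAlgebra A] in
@[simp] lemma haarTensor_tmul (x y : A) : haarTensor A (x ⊗ₜ y) = haar A x * haar A y := by
  simp [haarTensor]

/-- Expanding z in an orthonormal basis of the first factor turns the value into a sum of squared
norms, so h ⊗ h is again faithful. -/
lemma haarTensor_star_mul_self {z : A ⊗[ℂ] A} (hz : haarTensor A (star z * z) = 0) : z = 0 := by
  obtain ⟨e, he⟩ := exists_orthonormal_basis (haarCore A)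
  have hz' := tmul_slice_left e z
  set w := fun i => TensorProduct.lid ℂ A ((e.coord i).rTensor A z) with hw
  have key : haarTensor A (star z * z) = ∑ i, (haarCore A).inner (w i) (w i) := by
    rw [hz', star_sum, Finset.sum_mul_sum, map_sum]
    refine Finset.sum_congr rfl fun i _ => ?_
    rw [map_sum, Finset.sum_eq_single i]
    · rw [TensorProduct.star_tmul, Algebra.TensorProduct.tmul_mul_tmul, haarTensor_tmul]
      have := he i i
      simp only [if_true] at this
      change haar A (star (e i) * e i) = 1 at this
      rw [this, one_mul]; rfl
    · intro j _ hj
      rw [TensorProduct.star_tmul, Algebra.TensorProduct.tmul_mul_tmul, haarTensor_tmul]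
      have := he i j
      rw [if_neg hj.symm] at this
      change haar A (star (e i) * e j) = 0 at this
      rw [this, zero_mul]
    · simp
  have h0 : ∀ i, w i = 0 := core_eq_zero_of_sum (haarCore A) w (by rw [← key, hz])
  rw [hz']
  exact Finset.sum_eq_zero fun i _ => by
    have := h0 i
    simp only [hw] at this
    rw [this, TensorProduct.tmul_zero]

omit [StarRing A] [StarModule ℂ A] [IsCStarHopfAlgebra A] in
-- The bijection a ⊗ b ↦ Δ(a)(1 ⊗ b) intertwines multiplication by x ⊗ 1 with multiplication by
-- Δ(x), so both have the same trace on A ⊗ A. After normalization this says that h is a convolution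
-- idempotent.
lemma regTrace_conv_regTrace (x : A) :
    TensorProduct.lid ℂ ℂ (TensorProduct.map (regTrace A) (regTrace A) (comul x)) =
      Module.finrank ℂ A * regTrace A x := by
  have htr : ∀ z : A ⊗[ℂ] A, regTrace (A ⊗[ℂ] A) z =
      TensorProduct.lid ℂ ℂ (TensorProduct.map (regTrace A) (regTrace A) z) := by
    intro z
    induction z with
    | zero => simp
    | add x y hx hy => simp [hx, hy]
    | tmul x y =>
      simp only [TensorProduct.map_tmul, TensorProduct.lid_tmul, regTrace_apply]
      rw [smul_eq_mul, ← LinearMap.trace_tensorProduct']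
      congr 1
      ext a b
      simp
  let G : A ⊗[ℂ] A →ₗ[ℂ] A ⊗[ℂ] A :=
    LinearMap.mul' ℂ (A ⊗[ℂ] A) ∘ₗ
      TensorProduct.map comul
        (Algebra.TensorProduct.includeRight (R := ℂ) (A := A) (B := A)).toLinearMap
  have hG : ∀ a b, G (a ⊗ₜ b) = comul a * (1 ⊗ₜ b) := fun a b => by simp [G]
  have hsurj : Function.Surjective G := by
    rw [← LinearMap.range_eq_top, eq_top_iff, ← TensorProduct.span_tmul_eq_top, Submodule.span_le]
    rintro _ ⟨a, b, rfl⟩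
    -- A preimage of a ⊗ b is a₍₁₎ ⊗ S(a₍₂₎) b.
    have key : G ∘ₗ (LinearMap.lTensor A (LinearMap.mulRight ℂ b ∘ₗ HopfAlgebra.antipode ℂ)) ∘ₗ
        comul = (TensorProduct.mk ℂ A A).flip b := by
      refine conv_ext fun n v hv i j => ?_
      simp only [LinearMap.comp_apply, hv.comul_apply, map_sum, LinearMap.lTensor_tmul, hG,
        LinearMap.mulRight_apply, Finset.sum_mul, Algebra.TensorProduct.tmul_mul_tmul, mul_one,
        LinearMap.flip_apply, TensorProduct.mk_apply]
      rw [Finset.sum_comm]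
      simp_rw [← mul_assoc, ← TensorProduct.tmul_sum, ← Finset.sum_mul, hv.sum_mul_antipode]
      rw [Finset.sum_eq_single j] <;> simp +contextual
    exact ⟨_, LinearMap.congr_fun key a⟩
  have hinj : Function.Injective G := LinearMap.injective_iff_surjective.2 hsurj
  let E := LinearEquiv.ofBijective G ⟨hinj, hsurj⟩
  have hconj : Algebra.lmul ℂ (A ⊗[ℂ] A) (comul x) = E.conj (Algebra.lmul ℂ _ (x ⊗ₜ 1)) := by
    rw [LinearEquiv.conj_apply]
    refine LinearMap.ext fun z => ?_
    obtain ⟨y, rfl⟩ := E.surjective z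
    simp only [LinearMap.comp_apply, LinearEquiv.coe_coe, LinearEquiv.symm_apply_apply]
    change comul x * G y = G (x ⊗ₜ 1 * y)
    induction y with
    | zero => simp
    | add a b ha hb => simp [mul_add, ha, hb]
    | tmul a b => simp [hG, mul_assoc]
  rw [← htr, regTrace_apply, hconj, LinearMap.trace_conj', ← regTrace_apply, htr]
  simp [regTrace_one, mul_comm]

omit [StarRing A] [StarModule ℂ A] [IsCStarHopfAlgebra A] in
lemma haarTensor_comul (x : A) : haarTensor A (comul x) = haar A x := by
  have h := regTrace_conv_regTrace x
  have h2 : haarTensor A = ((Module.finrank ℂ A : ℂ)⁻¹ * (Module.finrank ℂ A : ℂ)⁻¹) •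
      ((TensorProduct.lid ℂ ℂ).toLinearMap ∘ₗ
        TensorProduct.map (regTrace A) (regTrace A)) := by
    ext a b
    simp [haar]; ring
  rw [h2]
  simp only [LinearMap.smul_apply, LinearMap.comp_apply, LinearEquiv.coe_coe, h, haar, smul_eq_mul]
  have := finrank_ne_zero (A := A)
  field_simp

omit [StarRing A] [StarModule ℂ A] [IsCStarHopfAlgebra A] in
lemma rt_haar_rt_haar (a : A) : rt (haar A) (rt (haar A) a) = rt (haar A) a := by
  have key : rt (haar A) ∘ₗ rt (haar A) = rt (haar A) := by
    refine conv_ext fun n v hv i j => ?_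
    simp only [LinearMap.comp_apply, rt_of_comul _ (hv.comul_apply _ _), map_sum, map_smul,
      Finset.smul_sum, smul_smul]
    rw [Finset.sum_comm]
    refine Finset.sum_congr rfl fun k _ => ?_
    rw [← Finset.sum_smul]
    congr 1
    rw [← haarTensor_comul (v k j), hv.comul_apply, map_sum]
    simp [mul_comm]
  exact LinearMap.congr_fun key a

lemma rt_haar_star (a : A) : rt (haar A) (star a) = star (rt (haar A) a) := by
  simp only [rt, LinearMap.comp_apply, IsCStarHopfAlgebra.comul_star]
  induction (comul a : A ⊗[ℂ] A) with
  | zero => simp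
  | add x y hx hy => simp only [star_add, map_add, hx, hy]
  | tmul x y => simp [TensorProduct.star_tmul, haar_star]

omit [StarRing A] [StarModule ℂ A] [FiniteDimensional ℂ A] [IsCStarHopfAlgebra A] in
lemma haarTensor_tmul_one_mul (c : A) (x : A) :
    haarTensor A ((c ⊗ₜ 1) * comul x) = haar A (c * rt (haar A) x) := by
  simp only [rt, LinearMap.comp_apply]
  induction (comul x : A ⊗[ℂ] A) with
  | zero => simp
  | add x y hx hy => simp only [mul_add, map_add, hx, hy]
  | tmul x y => simp [mul_comm]

omit [StarRing A] [StarModule ℂ A] [FiniteDimensional ℂ A] [IsCStarHopfAlgebra A] in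
lemma haarTensor_mul_tmul_one (c : A) (x : A) :
    haarTensor A (comul x * (c ⊗ₜ 1)) = haar A (rt (haar A) x * c) := by
  simp only [rt, LinearMap.comp_apply]
  induction (comul x : A ⊗[ℂ] A) with
  | zero => simp
  | add x y hx hy => simp only [add_mul, map_add, hx, hy]
  | tmul x y => simp [mul_comm]

/-- Invariance of the Haar functional. -/
lemma rt_haar (a : A) : rt (haar A) a = haar A a • (1 : A) := by
  set b := rt (haar A) a with hb
  have hbb : rt (haar A) b = b := rt_haar_rt_haar a
  -- Since b is fixed by `rt (haar A)`, the four terms of (h ⊗ h)((Δb − b ⊗ 1)*(Δb − b ⊗ 1)) are all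
  -- ±h(b*b) and cancel; faithfulness gives Δb = b ⊗ 1.
  have h0 : (comul b : A ⊗[ℂ] A) - b ⊗ₜ 1 = 0 := by
    apply haarTensor_star_mul_self
    rw [star_sub, ← IsCStarHopfAlgebra.comul_star, TensorProduct.star_tmul, star_one, sub_mul,
      mul_sub, mul_sub, ← Bialgebra.comul_mul, map_sub, map_sub, map_sub, haarTensor_comul,
      haarTensor_mul_tmul_one, haarTensor_tmul_one_mul, rt_haar_star, hbb,
      Algebra.TensorProduct.tmul_mul_tmul, haarTensor_tmul, mul_one, haar_one]
    ring
  have h1 : b = counit (R := ℂ) b • (1 : A) := by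
    have h2 := Coalgebra.rTensor_counit_comul (R := ℂ) b
    rw [sub_eq_zero.1 h0] at h2
    simpa using (congrArg (TensorProduct.lid ℂ A) h2).symm
  have h3 : haar A b = haar A a := by
    have := haarTensor_tmul_one_mul 1 a
    rw [← Algebra.TensorProduct.one_def, one_mul, one_mul, haarTensor_comul] at this
    exact this.symm
  rw [h1, map_smul, haar_one, smul_eq_mul, mul_one] at h3
  rw [h1, h3]

/-- The antipode of a finite dimensional C*-Hopf algebra is involutive. -/
lemma antipode_antipode (a : A) : HopfAlgebra.antipode ℂ (HopfAlgebra.antipode ℂ a) = a := by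
  -- F(a, b) = a₍₁₎ h(a₍₂₎ b). By invariance S(a₍₁₎) h(a₍₂₎ b) = S(a₍₁₎) a₍₂₎ b₍₁₎ h(a₍₃₎ b₍₂₎) =
  -- b₍₁₎ h(a b₍₂₎), which is F(b, a) because h is a trace. So S exchanges the arguments of F, S²
  -- fixes all its values, and these span A.
  let F : A → A → A := fun a b =>
    TensorProduct.rid ℂ A ((haar A).lTensor A (comul a * ((1 : A) ⊗ₜ[ℂ] b)))
  have hF : ∀ {ι : Type} {s : Finset ι} {a : A} {x y : ι → A},
      (comul a : A ⊗[ℂ] A) = ∑ i ∈ s, x i ⊗ₜ[ℂ] y i →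
      ∀ b, F a b = ∑ i ∈ s, haar A (y i * b) • x i := by
    intro ι s a x y h b
    simp [F, h, Finset.sum_mul]
  have hSF : ∀ a b, HopfAlgebra.antipode ℂ (F a b) = F b a := by
    intro a b
    let l : A →ₗ[ℂ] A := HopfAlgebra.antipode ℂ ∘ₗ (TensorProduct.rid ℂ A).toLinearMap ∘ₗ
      (haar A).lTensor A ∘ₗ LinearMap.mulRight ℂ ((1 : A) ⊗ₜ[ℂ] b) ∘ₗ comul
    let r : A →ₗ[ℂ] A := (TensorProduct.rid ℂ A).toLinearMap ∘ₗ
      (haar A).lTensor A ∘ₗ LinearMap.mulLeft ℂ (comul b) ∘ₗ TensorProduct.mk ℂ A A 1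
    suffices l = r from LinearMap.congr_fun this a
    refine conv_ext fun n v hv i j => ?_
    change HopfAlgebra.antipode ℂ (F (v i j) b) = F b (v i j)
    have hb := tmul_slice_right (Module.finBasis ℂ A) (comul b : A ⊗[ℂ] A)
    set y := Module.finBasis ℂ A
    set x := fun r => TensorProduct.rid ℂ A ((y.coord r).lTensor A (comul b)) with hx
    change (comul b : A ⊗[ℂ] A) = ∑ r, x r ⊗ₜ[ℂ] y r at hb
    rw [hF (hv.comul_apply i j), hF hb, map_sum]
    have hinv : ∀ p, haar A (v p j * b) • (1 : A) =
        ∑ q, ∑ r, haar A (v q j * y r) • (v p q * x r) := by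
      intro p
      have : (comul (v p j * b) : A ⊗[ℂ] A) = ∑ z ∈ Finset.univ ×ˢ Finset.univ,
          (v p z.1 * x z.2) ⊗ₜ[ℂ] (v z.1 j * y z.2) := by
        rw [Bialgebra.comul_mul, hv.comul_apply, hb, Finset.sum_mul_sum, Finset.sum_product]
        simp
      rw [← rt_haar, rt_of_comul _ this, Finset.sum_product]
    calc ∑ p, HopfAlgebra.antipode ℂ (haar A (v p j * b) • v i p)
        = ∑ p, HopfAlgebra.antipode ℂ (v i p) * (haar A (v p j * b) • (1 : A)) :=
          Finset.sum_congr rfl fun p _ => by simp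
      _ = ∑ p, ∑ q, ∑ r, haar A (v q j * y r) •
            (HopfAlgebra.antipode ℂ (v i p) * v p q * x r) := by
          simp_rw [hinv, Finset.mul_sum, mul_smul_comm, ← mul_assoc]
      _ = ∑ q, ∑ r, ∑ p, haar A (v q j * y r) •
            (HopfAlgebra.antipode ℂ (v i p) * v p q * x r) := by
          rw [Finset.sum_comm]
          exact Finset.sum_congr rfl fun q _ => Finset.sum_comm
      _ = ∑ q, ∑ r, if i = q then haar A (y r * v q j) • x r else 0 := by
          simp_rw [← Finset.smul_sum, ← Finset.sum_mul, hv.sum_antipode_mul]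
          refine Finset.sum_congr rfl fun q _ => Finset.sum_congr rfl fun r _ => ?_
          split_ifs <;> simp [haar_mul_comm]
      _ = ∑ r, haar A (y r * v i j) • x r := by
          rw [Finset.sum_comm]
          simp
  have key : HopfAlgebra.antipode ℂ ∘ₗ HopfAlgebra.antipode ℂ = (LinearMap.id : A →ₗ[ℂ] A) := by
    refine conv_ext fun n v hv i j => ?_
    have hx : v i j = ∑ k, F (v i k) (HopfAlgebra.antipode ℂ (v k j)) := by
      simp_rw [hF (hv.comul_apply i _)]
      rw [Finset.sum_comm]
      simp_rw [← Finset.sum_smul, ← map_sum, hv.sum_mul_antipode]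
      rw [Finset.sum_eq_single j] <;> simp +contextual [haar_one]
    rw [LinearMap.comp_apply, LinearMap.id_apply, hx]
    simp_rw [map_sum, hSF]
  exact LinearMap.congr_fun key a

end Haar

open scoped Kronecker

/-! ### Evaluating a matrix over `A` in a representation -/

section Fuse

variable {A : Type*} [Ring A] [HopfAlgebra ℂ A]
variable {I K : Type*} [Fintype I] [DecidableEq I] [Fintype K] [DecidableEq K]

/-- The operator on `ℂ^I ⊗ ℂ^K` obtained by applying `R : A → Mat_I(ℂ)` to the entries of a matrix
`v ∈ Mat_K(A)`. -/
def fuse {A : Type*} [Ring A] [Algebra ℂ A] {I K : Type*} (R : A →ₗ[ℂ] Matrix I I ℂ)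
    (v : Matrix K K A) : Matrix (I × K) (I × K) ℂ :=
  Matrix.of fun s t => R (v s.2 t.2) s.1 t.1

omit [Fintype I] [DecidableEq I] [Fintype K] [DecidableEq K] in
@[simp] lemma fuse_apply (R : A →ₗ[ℂ] Matrix I I ℂ) (v : Matrix K K A) (s t : I × K) :
    fuse R v s t = R (v s.2 t.2) s.1 t.1 := rfl

omit [DecidableEq K] in
lemma fuse_mul (R : A →ₐ[ℂ] Matrix I I ℂ) (v w : Matrix K K A) :
    fuse R.toLinearMap (v * w) = fuse R.toLinearMap v * fuse R.toLinearMap w := by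
  ext s t
  simp only [fuse_apply, Matrix.mul_apply, map_sum, AlgHom.toLinearMap_apply, map_mul,
    Matrix.sum_apply, Fintype.sum_prod_type]
  exact Finset.sum_comm

omit [Fintype K] in
lemma fuse_one (R : A →ₐ[ℂ] Matrix I I ℂ) : fuse R.toLinearMap (1 : Matrix K K A) = 1 := by
  ext s t
  rw [fuse_apply, Matrix.one_apply, Matrix.one_apply, AlgHom.toLinearMap_apply]
  by_cases h : s.2 = t.2
  · rw [if_pos h, map_one, Matrix.one_apply]
    simp [Prod.ext_iff, h]
  · simp [Prod.ext_iff, h]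

lemma fuse_conv {v : Matrix K K A} (hv : IsCorep v) (R R' : WithConv (A →ₗ[ℂ] Matrix I I ℂ)) :
    fuse (R * R').ofConv v = fuse R.ofConv v * fuse R'.ofConv v := by
  ext s t
  rw [fuse_apply, hv.conv_apply]
  simp only [Matrix.mul_apply, Matrix.sum_apply, Fintype.sum_prod_type, fuse_apply]
  exact Finset.sum_comm

lemma fuse_conv_one {v : Matrix K K A} (hv : IsCorep v) :
    fuse (1 : WithConv (A →ₗ[ℂ] Matrix I I ℂ)).ofConv v = 1 := by
  ext s t
  rw [fuse_apply]
  change (algebraMap ℂ (Matrix I I ℂ) (counit (v s.2 t.2))) s.1 t.1 = _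
  rw [hv.counit_apply, Matrix.algebraMap_matrix_apply, Matrix.one_apply]
  by_cases h : s.2 = t.2 <;> simp [Prod.ext_iff, h]

lemma det_fuse_ne_zero (ρ : A →ₐ[ℂ] Matrix I I ℂ) {v w : Matrix K K A} (h : v * w = 1) :
    (fuse ρ.toLinearMap v).det ≠ 0 := by
  have : fuse ρ.toLinearMap v * fuse ρ.toLinearMap w = 1 := by rw [← fuse_mul, h, fuse_one]
  intro h0
  have h1 := congrArg Matrix.det this
  rw [Matrix.det_mul, h0, zero_mul, Matrix.det_one] at h1
  exact zero_ne_one h1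

/-- The determinant of a corepresentation, evaluated in a representation, is a root of unity. -/
lemma det_fuse_pow [FiniteDimensional ℂ A] (ρ : A →ₐ[ℂ] Matrix I I ℂ) {v : Matrix K K A}
    (hv : IsCorep v) : (fuse ρ.toLinearMap v).det ^ Module.finrank ℂ A = 1 := by
  set b := Module.finBasis ℂ A
  set u := regCorep b with hu_def
  have hu : IsCorep u := regCorep_isCorep b
  -- Q is the scalar matrix of left multiplication by v on A. It intertwines v ⊗ u with 1 ⊗ u, u
  -- being the regular corepresentation; cancelling the nonzero determinants of Q and 1 ⊗ u leaves
  -- det(v)^d = 1.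
  let Q : Matrix (K × Fin (Module.finrank ℂ A)) (K × Fin (Module.finrank ℂ A)) A :=
    Matrix.of fun x y => algebraMap ℂ A (b.repr (v x.1 y.1 * b y.2) x.2)
  let Q' : Matrix (K × Fin (Module.finrank ℂ A)) (K × Fin (Module.finrank ℂ A)) A :=
    Matrix.of fun x y =>
      algebraMap ℂ A (b.repr (HopfAlgebra.antipode ℂ (v x.1 y.1) * b y.2) x.2)
  have hQQ' : Q * Q' = 1 := by
    ext x y
    simp only [Q, Q', Matrix.mul_apply, Matrix.of_apply, ← map_mul, ← map_sum,
      Fintype.sum_prod_type]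
    have h1 : ∀ k, ∑ l, b.repr (v x.1 k * b l) x.2 *
        b.repr (HopfAlgebra.antipode ℂ (v k y.1) * b y.2) l =
        b.repr (v x.1 k * (HopfAlgebra.antipode ℂ (v k y.1) * b y.2)) x.2 := by
      intro k
      have : v x.1 k * (HopfAlgebra.antipode ℂ (v k y.1) * b y.2) =
          ∑ l, b.repr (HopfAlgebra.antipode ℂ (v k y.1) * b y.2) l • (v x.1 k * b l) := by
        conv_lhs => rw [← b.sum_repr (HopfAlgebra.antipode ℂ (v k y.1) * b y.2)]
        simp only [Finset.mul_sum, mul_smul_comm]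
      rw [this]
      simp only [map_sum, map_smul, Finsupp.finsetSum_apply, Finsupp.smul_apply, smul_eq_mul,
        mul_comm]
    simp_rw [h1, ← mul_assoc, ← Finsupp.finsetSum_apply, ← map_sum, ← Finset.sum_mul,
      hv.sum_mul_antipode]
    rw [Matrix.one_apply]
    by_cases h : x.1 = y.1
    · simp only [h, if_true, one_mul, b.repr_self, Finsupp.single_apply, Prod.ext_iff, true_and]
      by_cases h2 : x.2 = y.2 <;> simp [h2, eq_comm]
    · simp [h, Prod.ext_iff]
  have hcomm : Q * ((v ⊗ₖ (1 : Matrix _ _ A)) * ((1 : Matrix _ _ A) ⊗ₖ u)) =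
      ((1 : Matrix _ _ A) ⊗ₖ u) * Q := by
    ext ⟨i, k⟩ ⟨j, l⟩
    have hcoef : ∀ (x y : A), ∑ m, b.repr (x * b m) k • (y * u m l) =
        TensorProduct.lid ℂ A ((b.coord k).rTensor A ((x ⊗ₜ y) * comul (b l))) := by
      intro x y
      rw [comul_basis, Finset.mul_sum, map_sum, map_sum]
      simp [hu_def]
    have h2 : ∀ x y : K × Fin (Module.finrank ℂ A),
        ((v ⊗ₖ (1 : Matrix _ _ A)) * ((1 : Matrix _ _ A) ⊗ₖ u) : Matrix _ _ A) x y =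
        v x.1 y.1 * u x.2 y.2 := by
      intro x y
      rw [Matrix.mul_apply, Fintype.sum_prod_type]
      simp [Matrix.one_apply]
    rw [Matrix.mul_apply, Matrix.mul_apply, Fintype.sum_prod_type, Fintype.sum_prod_type]
    simp only [h2]
    simp only [Q, Matrix.of_apply, Matrix.kroneckerMap_apply]
    have h3 : ∀ x y : A, ∀ r : ℂ, algebraMap ℂ A r * (x * y) = r • (x * y) :=
      fun x y r => (Algebra.smul_def _ _).symm
    simp only [h3, hcoef]
    rw [← map_sum, ← map_sum, ← Finset.sum_mul, ← hv.comul_apply, ← Bialgebra.comul_mul]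
    rw [Finset.sum_eq_single i (by intro x _ hx; simp [Matrix.one_apply_ne' hx]) (by simp)]
    conv_lhs => rw [← b.sum_repr (v i j * b l)]
    simp only [map_sum, map_smul, comul_basis, Matrix.one_apply_eq, one_mul]
    refine Finset.sum_congr rfl fun m _ => ?_
    rw [Finset.sum_eq_single k]
    · simp [Algebra.smul_def, Algebra.commutes, hu_def]
    · intro x _ hx
      simp [hx]
    · simp
  have hdet := congrArg (fun M => (fuse ρ.toLinearMap M).det) hcomm
  simp only [fuse_mul, Matrix.det_mul] at hdet
  have hv1 : (fuse ρ.toLinearMap (v ⊗ₖ (1 : Matrix (Fin (Module.finrank ℂ A)) _ A))).det =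
      (fuse ρ.toLinearMap v).det ^ Module.finrank ℂ A := by
    have : fuse ρ.toLinearMap (v ⊗ₖ (1 : Matrix (Fin (Module.finrank ℂ A)) _ A)) =
        ((fuse ρ.toLinearMap v) ⊗ₖ (1 : Matrix (Fin (Module.finrank ℂ A)) _ ℂ)).submatrix
          (Equiv.prodAssoc I K (Fin (Module.finrank ℂ A))).symm
          (Equiv.prodAssoc I K (Fin (Module.finrank ℂ A))).symm := by
      ext ⟨i, k, l⟩ ⟨i', k', l'⟩
      by_cases h : l = l' <;> simp [h]
    rw [this, Matrix.det_submatrix_equiv_self, Matrix.det_kronecker]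
    simp
  have hu0 : (fuse ρ.toLinearMap ((1 : Matrix K K A) ⊗ₖ u)).det ≠ 0 := by
    apply det_fuse_ne_zero ρ (w := (1 : Matrix K K A) ⊗ₖ u.map (HopfAlgebra.antipode ℂ))
    ext ⟨i, k⟩ ⟨j, l⟩
    rw [Matrix.mul_apply, Fintype.sum_prod_type, Finset.sum_eq_single i]
    · have := hu.sum_mul_antipode k l
      by_cases h : i = j
      · subst h; simp [this, Matrix.one_apply]
      · simp [h]
    · intro x _ hx
      simp [Matrix.one_apply_ne' hx]
    · simp
  have hQ0 := det_fuse_ne_zero ρ hQQ'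
  rw [hv1] at hdet
  have : (fuse ρ.toLinearMap Q).det * (fuse ρ.toLinearMap ((1 : Matrix K K A) ⊗ₖ u)).det *
      ((fuse ρ.toLinearMap v).det ^ Module.finrank ℂ A - 1) = 0 := by
    linear_combination hdet
  exact sub_eq_zero.1 ((mul_eq_zero.1 this).resolve_left (mul_ne_zero hQ0 hu0))

end Fuse

/-! ### Roots of unity from Yetter-Drinfeld modules -/

section Slices

variable {A : Type*} [Ring A] [HopfAlgebra ℂ A]
variable {I : Type*}

/-- The matrix coefficient `a ↦ ρ(a) i j`. -/
def coeff (ρ : A →ₗ[ℂ] Matrix I I ℂ) (i j : I) : A →ₗ[ℂ] ℂ :=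
  Matrix.entryLinearMap ℂ ℂ i j ∘ₗ ρ

@[simp] lemma coeff_apply (ρ : A →ₗ[ℂ] Matrix I I ℂ) (i j : I) (a : A) :
    coeff ρ i j a = ρ a i j := rfl

lemma lt_tmul_mul {n : Type*} [Fintype n] [DecidableEq n] {v : Matrix n n A} (hv : IsCorep v)
    [Fintype I] [DecidableEq I] (ρ : A →ₐ[ℂ] Matrix I I ℂ) (r s : I) (i j : n) (x : A) :
    lt (coeff ρ.toLinearMap r s) (v i j * x) =
      ∑ k, ∑ t, ρ (v i k) r t • (v k j * lt (coeff ρ.toLinearMap t s) x) := by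
  simp only [lt, LinearMap.comp_apply, Bialgebra.comul_mul, hv.comul_apply]
  induction (comul x : A ⊗[ℂ] A) with
  | zero => simp
  | add x y hx hy =>
    simp only [mul_add, map_add, hx, hy, smul_add, Finset.sum_add_distrib]
  | tmul x y =>
    simp [Finset.sum_mul, Matrix.mul_apply, Finset.sum_smul, smul_smul]

lemma lt_mul_tmul {ι : Type*} {S : Finset ι} {a : A} {p q : ι → A}
    (h : (comul a : A ⊗[ℂ] A) = ∑ k ∈ S, p k ⊗ₜ q k)
    [Fintype I] [DecidableEq I] (ρ : A →ₐ[ℂ] Matrix I I ℂ) (r s : I) (x : A) :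
    lt (coeff ρ.toLinearMap r s) (x * a) =
      ∑ k ∈ S, ∑ t, ρ (p k) t s • (lt (coeff ρ.toLinearMap r t) x * q k) := by
  simp only [lt, LinearMap.comp_apply, Bialgebra.comul_mul, h]
  induction (comul x : A ⊗[ℂ] A) with
  | zero => simp
  | add x y hx hy =>
    simp only [add_mul, map_add, hx, hy, smul_add, Finset.sum_add_distrib]
  | tmul x y =>
    simp [Finset.mul_sum, Matrix.mul_apply, Finset.sum_smul, smul_smul, mul_comm]

lemma rt_tmul_mul {n : Type*} [Fintype n] [DecidableEq n] {v : Matrix n n A} (hv : IsCorep v)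
    (f : A →ₗ[ℂ] ℂ) (i j : n) (x : A) :
    rt f (v i j * x) = ∑ k, v i k * rt (f ∘ₗ LinearMap.mulLeft ℂ (v k j)) x := by
  simp only [rt, LinearMap.comp_apply, Bialgebra.comul_mul, hv.comul_apply]
  induction (comul x : A ⊗[ℂ] A) with
  | zero => simp
  | add x y hx hy => simp only [mul_add, map_add, hx, hy, Finset.sum_add_distrib]
  | tmul x y => simp [Finset.sum_mul]

lemma rt_mul_tmul {ι : Type*} {S : Finset ι} {a : A} {p q : ι → A}
    (h : (comul a : A ⊗[ℂ] A) = ∑ k ∈ S, p k ⊗ₜ q k) (f : A →ₗ[ℂ] ℂ) (x : A) :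
    rt f (x * a) = ∑ k ∈ S, rt (f ∘ₗ LinearMap.mulRight ℂ (q k)) x * p k := by
  simp only [rt, LinearMap.comp_apply, Bialgebra.comul_mul, h]
  induction (comul x : A ⊗[ℂ] A) with
  | zero => simp
  | add x y hx hy => simp only [add_mul, map_add, hx, hy, Finset.sum_add_distrib]
  | tmul x y => simp [Finset.mul_sum]

lemma rt_add (f g : A →ₗ[ℂ] ℂ) : rt (f + g) = rt f + rt g := by
  ext x; simp [rt, LinearMap.lTensor_add]

lemma rt_smul (c : ℂ) (f : A →ₗ[ℂ] ℂ) : rt (c • f) = c • rt f := by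
  ext x; simp [rt, LinearMap.lTensor_smul]

variable [Fintype I]

/-- The operator `x ⊗ b ↦ b₍₁₎ x ⊗ b₍₂₎` on `ℂ^I ⊗ A`. -/
def leftTwist (ρ : A →ₗ[ℂ] Matrix I I ℂ) : Module.End ℂ (I → A) :=
  LinearMap.pi fun i => ∑ j, lt (coeff ρ i j) ∘ₗ LinearMap.proj j

/-- The operator `x ⊗ b ↦ b₍₂₎ x ⊗ b₍₁₎` on `ℂ^I ⊗ A`. -/
def rightTwist (ρ : A →ₗ[ℂ] Matrix I I ℂ) : Module.End ℂ (I → A) :=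
  LinearMap.pi fun i => ∑ j, rt (coeff ρ i j) ∘ₗ LinearMap.proj j

lemma leftTwist_apply (ρ : A →ₗ[ℂ] Matrix I I ℂ) (w : I → A) (i : I) :
    leftTwist ρ w i = ∑ j, lt (coeff ρ i j) (w j) := by simp [leftTwist]

lemma rightTwist_apply (ρ : A →ₗ[ℂ] Matrix I I ℂ) (w : I → A) (i : I) :
    rightTwist ρ w i = ∑ j, rt (coeff ρ i j) (w j) := by simp [rightTwist]

end Slices

/-! ### Determinants of the twists and of multiplication operators, using S² = 1 -/

section Involutive

variable {A : Type*} [Ring A] [StarRing A] [HopfAlgebra ℂ A] [StarModule ℂ A]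
  [FiniteDimensional ℂ A] [IsCStarHopfAlgebra A]
variable {n : Type*} [Fintype n] [DecidableEq n] {v : Matrix n n A}

/-- S reverses the products in the antipode identity, and S² = 1 restores the entries. -/
lemma IsCorep.sum_antipode_mul_flip (hv : IsCorep v) (i j : n) :
    ∑ k, HopfAlgebra.antipode ℂ (v k j) * v i k = if i = j then 1 else 0 := by
  have h := congrArg (HopfAlgebra.antipode ℂ) (hv.sum_antipode_mul i j)
  simp only [map_sum, HopfAlgebra.antipode_mul_antidistrib, antipode_antipode] at h
  rw [h]
  split_ifs <;> simp [HopfAlgebra.antipode_one]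

lemma IsCorep.sum_mul_antipode_flip (hv : IsCorep v) (i j : n) :
    ∑ k, v k j * HopfAlgebra.antipode ℂ (v i k) = if i = j then 1 else 0 := by
  have h := congrArg (HopfAlgebra.antipode ℂ) (hv.sum_mul_antipode i j)
  simp only [map_sum, HopfAlgebra.antipode_mul_antidistrib, antipode_antipode] at h
  rw [h]
  split_ifs <;> simp [HopfAlgebra.antipode_one]

omit [StarRing A] [StarModule ℂ A] [IsCStarHopfAlgebra A] in
-- In a product basis the right twist is `fuse` of ρ with the regular corepresentation.
lemma det_rightTwist_pow (ρ : A →ₐ[ℂ] Matrix n n ℂ) :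
    (LinearMap.det (rightTwist ρ.toLinearMap)) ^ Module.finrank ℂ A = 1 := by
  set b := Module.finBasis ℂ A
  rw [← det_fuse_pow ρ (regCorep_isCorep b)]
  congr 1
  let e := (Pi.basis fun _ : n => b).reindex (Equiv.sigmaEquivProd n _)
  rw [← LinearMap.det_toMatrix e]
  congr 1
  ext ⟨i, k⟩ ⟨j, l⟩
  have he : e (j, l) = Pi.single j (b l) := by simp [e]
  have hr : ∀ w, e.repr w (i, k) = b.repr (w i) k := by simp [e]
  rw [LinearMap.toMatrix_apply, he, hr, rightTwist_apply, Finset.sum_eq_single j]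
  · rw [Pi.single_eq_same, rt_of_comul _ (comul_basis b l)]
    simp [Finsupp.single_apply]
  · intro x _ hx
    simp [hx]
  · simp

/-- The operator `w ↦ v w` on `A^n`. -/
def matLeft {A : Type*} [Ring A] [Algebra ℂ A] {n : Type*} [Fintype n] (v : Matrix n n A) :
    Module.End ℂ (n → A) :=
  LinearMap.pi fun i => ∑ j, LinearMap.mulLeft ℂ (v i j) ∘ₗ LinearMap.proj j

/-- The operator `w ↦ (∑ j, w j * v i j) i` on `A^n`. -/
def matRight {A : Type*} [Ring A] [Algebra ℂ A] {n : Type*} [Fintype n] (v : Matrix n n A) :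
    Module.End ℂ (n → A) :=
  LinearMap.pi fun i => ∑ j, LinearMap.mulRight ℂ (v i j) ∘ₗ LinearMap.proj j

omit [StarRing A] [StarModule ℂ A] [FiniteDimensional ℂ A] [IsCStarHopfAlgebra A]
  [DecidableEq n] in
lemma matLeft_apply (w : n → A) (i : n) : matLeft v w i = ∑ j, v i j * w j := by simp [matLeft]

omit [StarRing A] [StarModule ℂ A] [FiniteDimensional ℂ A] [IsCStarHopfAlgebra A]
  [DecidableEq n] in
lemma matRight_apply (w : n → A) (i : n) : matRight v w i = ∑ j, w j * v i j := by
  simp [matRight]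

omit [StarRing A] [StarModule ℂ A] [IsCStarHopfAlgebra A] in
-- In a product basis `matLeft v` is `fuse` of the left regular representation with v.
lemma det_matLeft_pow (hv : IsCorep v) :
    (LinearMap.det (matLeft v)) ^ Module.finrank ℂ A = 1 := by
  set b := Module.finBasis ℂ A
  let L : A →ₐ[ℂ] Matrix _ _ ℂ := (LinearMap.toMatrixAlgEquiv b).toAlgHom.comp (Algebra.lmul ℂ A)
  rw [← det_fuse_pow L hv]
  congr 1
  let e := (Pi.basis fun _ : n => b).reindex
    ((Equiv.sigmaEquivProd n _).trans (Equiv.prodComm n _))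
  rw [← LinearMap.det_toMatrix e]
  congr 1
  ext ⟨k, i⟩ ⟨l, j⟩
  have he : e (l, j) = Pi.single j (b l) := by simp [e]
  have hr : ∀ w, e.repr w (k, i) = b.repr (w i) k := fun w => by
    rw [Module.Basis.repr_reindex_apply]
    simp
  rw [LinearMap.toMatrix_apply, he, hr, matLeft_apply, Finset.sum_eq_single j]
  · simp [L, LinearMap.toMatrixAlgEquiv_apply]
  · intro x _ hx
    simp [hx]
  · simp

/-- The antipode in each component. -/
def antipodePi (n A : Type*) [Ring A] [HopfAlgebra ℂ A] : Module.End ℂ (n → A) :=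
  (HopfAlgebra.antipode ℂ).compLeft n

omit [StarRing A] [StarModule ℂ A] [FiniteDimensional ℂ A] [IsCStarHopfAlgebra A]
  [Fintype n] [DecidableEq n] in
lemma antipodePi_apply (w : n → A) (i : n) :
    antipodePi n A w i = HopfAlgebra.antipode ℂ (w i) := rfl

omit [Fintype n] [DecidableEq n] in
lemma antipodePi_mul_self : antipodePi n A * antipodePi n A = 1 := by
  ext w i
  simp [antipodePi_apply, antipode_antipode]

omit [StarRing A] [StarModule ℂ A] [IsCStarHopfAlgebra A] in
lemma pi_ext_corep {M : Type*} [AddCommGroup M] [Module ℂ M] {f g : (n → A) →ₗ[ℂ] M}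
    (h : ∀ (m : ℕ) (u : Matrix (Fin m) (Fin m) A), IsCorep u → ∀ k l j,
      f (Pi.single j (u k l)) = g (Pi.single j (u k l))) : f = g := by
  refine LinearMap.pi_ext' fun j => conv_ext fun m u hu k l => ?_
  exact h m u hu k l j

/-- Conjugation by the involution S keeps determinants, so those of `matRight v` and `matLeft v` are
inverse to each other. `leftTwist_mul_conj` plays the same role for the two twists. -/
lemma matRight_mul_conj (hv : IsCorep v) :
    matRight v * (antipodePi n A * matLeft v * antipodePi n A) = 1 := by
  refine LinearMap.ext fun w => funext fun i => ?_
  simp only [Module.End.mul_apply, matRight_apply, antipodePi_apply, matLeft_apply, map_sum,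
    HopfAlgebra.antipode_mul_antidistrib, antipode_antipode, Module.End.one_apply,
    Finset.sum_mul, mul_assoc]
  rw [Finset.sum_comm]
  simp_rw [← Finset.mul_sum, hv.sum_antipode_mul_flip]
  simp

lemma leftTwist_mul_conj (ρ : A →ₐ[ℂ] Matrix n n ℂ) :
    leftTwist ρ.toLinearMap *
      (antipodePi n A * rightTwist ρ.toLinearMap * antipodePi n A) = 1 := by
  refine pi_ext_corep fun m u hu k l j => ?_
  funext r
  have h1 : antipodePi n A (Pi.single j (u k l)) =
      Pi.single j (HopfAlgebra.antipode ℂ (u k l)) := by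
    funext i
    by_cases h : i = j
    · subst h; simp [antipodePi_apply]
    · simp [antipodePi_apply, h]
  have h2 : rightTwist ρ.toLinearMap (Pi.single j (HopfAlgebra.antipode ℂ (u k l))) =
      fun i => ∑ p, ρ (HopfAlgebra.antipode ℂ (u k p)) i j • HopfAlgebra.antipode ℂ (u p l) := by
    funext i
    rw [rightTwist_apply, Finset.sum_eq_single j _ (by simp)]
    · rw [Pi.single_eq_same, rt_of_comul _ (hu.comul_antipode k l)]
      rfl
    · intro x _ hx
      simp [hx]
  rw [Module.End.mul_apply, Module.End.mul_apply, Module.End.mul_apply, h1, h2, leftTwist_apply]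
  simp only [antipodePi_apply, map_sum, map_smul, antipode_antipode, Module.End.one_apply]
  simp_rw [lt_of_comul _ (hu.comul_apply _ _), coeff_apply, Finset.smul_sum, smul_smul,
    AlgHom.toLinearMap_apply]
  have h3 : ∀ p q, ∑ i, (ρ (HopfAlgebra.antipode ℂ (u k p)) i j * ρ (u p q) r i) =
      ρ (u p q * HopfAlgebra.antipode ℂ (u k p)) r j := by
    intro p q
    rw [map_mul, Matrix.mul_apply]
    exact Finset.sum_congr rfl fun i _ => mul_comm _ _
  calc _ = ∑ p, ∑ q, ρ (u p q * HopfAlgebra.antipode ℂ (u k p)) r j • u q l := by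
        rw [Finset.sum_comm]
        refine Finset.sum_congr rfl fun p _ => ?_
        rw [Finset.sum_comm]
        refine Finset.sum_congr rfl fun q _ => ?_
        rw [← Finset.sum_smul, h3]
    _ = ∑ q, ρ (∑ p, u p q * HopfAlgebra.antipode ℂ (u k p)) r j • u q l := by
        rw [Finset.sum_comm]
        simp_rw [← Finset.sum_smul, map_sum, Matrix.sum_apply]
    _ = _ := by
        simp_rw [hu.sum_mul_antipode_flip]
        rw [Finset.sum_eq_single k _ (by simp)]
        · rw [if_pos rfl, map_one, Matrix.one_apply]
          by_cases h : r = j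
          · subst h; simp
          · simp [h]
        · intro q _ hq
          simp [hq.symm]

/-- If the canonical twist of a Yetter-Drinfeld module of dimension `n` is a scalar `lam`, then
`lam ^ (n d²) = 1` with `d = dim A`. -/
lemma yetterDrinfeld_twist_pow (ρ : A →ₐ[ℂ] Matrix n n ℂ) (hv : IsCorep v) (lam : ℂ)
    (hYD : ∀ (x : A) (i j : n), ∑ l, lt (coeff ρ.toLinearMap i l) x * v l j =
      ∑ k, v i k * rt (coeff ρ.toLinearMap k j) x)
    (htw : ∀ m l, ∑ k, ρ (v k l) m k = if m = l then lam else 0) :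
    lam ^ (Fintype.card n * Module.finrank ℂ A * Module.finrank ℂ A) = 1 := by
  -- Passing the twist through right multiplication by v produces the partial trace in `htw`, that
  -- is λ; the Yetter-Drinfeld condition then moves v to the left.
  have key : leftTwist ρ.toLinearMap * matRight v =
      lam • (matLeft v * rightTwist ρ.toLinearMap) := by
    refine LinearMap.pi_ext fun j x => ?_
    funext i
    have h1 : matRight v (Pi.single j x) = fun k => x * v k j := by
      funext k
      rw [matRight_apply, Finset.sum_eq_single j _ (by simp)]
      · simp
      · intro y _ hy; simp [hy]
    have h2 : rightTwist ρ.toLinearMap (Pi.single j x) =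
        fun k => rt (coeff ρ.toLinearMap k j) x := by
      funext k
      rw [rightTwist_apply, Finset.sum_eq_single j _ (by simp)]
      · simp
      · intro y _ hy; simp [hy]
    rw [LinearMap.smul_apply, Module.End.mul_apply, Module.End.mul_apply, h1, h2, leftTwist_apply,
      Pi.smul_apply, matLeft_apply, ← hYD]
    simp_rw [lt_mul_tmul (hv.comul_apply _ _)]
    calc _ = ∑ l, ∑ t, ∑ k, ρ (v k l) t k • (lt (coeff ρ.toLinearMap i t) x * v l j) := by
          rw [Finset.sum_comm]
          exact Finset.sum_congr rfl fun l _ => Finset.sum_comm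
      _ = _ := by
          simp_rw [← Finset.sum_smul, htw, Finset.smul_sum]
          simp
  have hdet := congrArg LinearMap.det key
  rw [map_mul, LinearMap.det_smul, map_mul, Module.finrank_pi_fintype, Finset.sum_const,
    Finset.card_univ, smul_eq_mul] at hdet
  have hs := congrArg LinearMap.det (antipodePi_mul_self (n := n) (A := A))
  have hr := congrArg LinearMap.det (matRight_mul_conj hv)
  have hl := congrArg LinearMap.det (leftTwist_mul_conj ρ)
  simp only [map_mul, map_one] at hs hr hl
  have hk := det_rightTwist_pow ρ
  have hm := det_matLeft_pow hv
  set s := LinearMap.det (antipodePi n A)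
  set a := LinearMap.det (matLeft v)
  set k := LinearMap.det (rightTwist ρ.toLinearMap)
  set a' := LinearMap.det (matRight v)
  set k' := LinearMap.det (leftTwist ρ.toLinearMap)
  have h1 : a' * a = 1 := by linear_combination hr - a' * a * hs
  have h2 : k' * k = 1 := by linear_combination hl - k' * k * hs
  -- With a' = a⁻¹ and k' = k⁻¹ the determinant of `key` reads (a k)⁻¹ = λ^(nd) a k; the d-th power
  -- removes a and k, whose own d-th powers are 1.
  have h3 : lam ^ (Fintype.card n * Module.finrank ℂ A) * (a * k) ^ 2 = 1 := by
    linear_combination (-(a * k)) * hdet + k' * k * h1 + h2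
  have h4 := congrArg (fun z => z ^ Module.finrank ℂ A) h3
  simp only [one_pow] at h4
  rw [mul_pow, ← pow_mul lam, pow_right_comm (a * k), mul_pow, hm, hk] at h4
  simpa using h4

end Involutive

/-! ### The free Yetter-Drinfeld module over a representation -/

section ConvHom

variable {A : Type*} [Ring A] [HopfAlgebra ℂ A] {M : Type*} [Ring M] [Algebra ℂ M]

/-- The convolution product of two commuting algebra homomorphisms. -/
def convAlgHom (R R' : A →ₐ[ℂ] M) (h : ∀ a b, Commute (R a) (R' b)) : A →ₐ[ℂ] M :=
  (Algebra.TensorProduct.lift R R' h).comp (Bialgebra.comulAlgHom ℂ A)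

lemma toConv_convAlgHom (R R' : A →ₐ[ℂ] M) (h : ∀ a b, Commute (R a) (R' b)) :
    toConv (convAlgHom R R' h).toLinearMap = toConv R.toLinearMap * toConv R'.toLinearMap := by
  refine WithConv.ext (LinearMap.ext fun a => ?_)
  simp only [convAlgHom, LinearMap.convMul_def, ofConv_toConv, AlgHom.toLinearMap_apply,
    AlgHom.comp_apply, LinearMap.comp_apply, Bialgebra.comulAlgHom_apply]
  induction (comul a : A ⊗[ℂ] A) with
  | zero => simp
  | add x y hx hy => simp only [map_add, hx, hy]
  | tmul x y => simp

/-- The map `a ↦ ε(a) X`. -/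
def constConv (A : Type*) [Ring A] [HopfAlgebra ℂ A] (X : M) : WithConv (A →ₗ[ℂ] M) :=
  toConv ((counit (R := ℂ) (A := A)).smulRight X)

section
variable {n : Type*} [Fintype n] [DecidableEq n] {v : Matrix n n A}

lemma constConv_mul_apply (hv : IsCorep v) (X : M) (F : WithConv (A →ₗ[ℂ] M)) (i j : n) :
    (constConv A X * F) (v i j) = X * F (v i j) := by
  rw [hv.conv_apply, Finset.sum_eq_single i]
  · simp [constConv, hv.counit_apply]
  · intro k _ hk
    simp [constConv, hv.counit_apply, hk.symm]
  · simp

lemma mul_constConv_apply (hv : IsCorep v) (X : M) (F : WithConv (A →ₗ[ℂ] M)) (i j : n) :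
    (F * constConv A X) (v i j) = F (v i j) * X := by
  rw [hv.conv_apply, Finset.sum_eq_single j]
  · simp [constConv, hv.counit_apply]
  · intro k _ hk
    simp [constConv, hv.counit_apply, hk]
  · simp

lemma convOne_corep_apply (hv : IsCorep v) (i j : n) :
    (1 : WithConv (A →ₗ[ℂ] M)) (v i j) = if i = j then 1 else 0 := by
  rw [LinearMap.convOne_apply, hv.counit_apply]
  split_ifs <;> simp

end

lemma withConv_ext [FiniteDimensional ℂ A] {F G : WithConv (A →ₗ[ℂ] M)}
    (h : ∀ (n : ℕ) (v : Matrix (Fin n) (Fin n) A), IsCorep v → ∀ i j, F (v i j) = G (v i j)) :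
    F = G :=
  WithConv.ext (conv_ext h)

end ConvHom

/-! ### Action, coaction and twist on the free Yetter-Drinfeld module -/

section Free

variable {A : Type*} [Ring A] [HopfAlgebra ℂ A] (I : Type*)

/-- Left multiplication on `A^I`. -/
def freeLeft (A : Type*) [Ring A] [HopfAlgebra ℂ A] (I : Type*) : A →ₐ[ℂ] Module.End ℂ (I → A) :=
  Algebra.lsmul ℂ ℂ (I → A)

lemma freeLeft_apply (a : A) (w : I → A) (i : I) : freeLeft A I a w i = a * w i := rfl

/-- `a` acts on `A^I` as right multiplication by `S(a)`. -/
def freeRight (A : Type*) [Ring A] [HopfAlgebra ℂ A] (I : Type*) :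
    A →ₐ[ℂ] Module.End ℂ (I → A) where
  toFun a := (LinearMap.mulRight ℂ (HopfAlgebra.antipode ℂ a)).compLeft I
  map_one' := by ext w i; simp [HopfAlgebra.antipode_one]
  map_mul' a b := by
    refine LinearMap.ext fun w => funext fun i => ?_
    simp [HopfAlgebra.antipode_mul_antidistrib, mul_assoc]
  map_zero' := by ext w i; simp
  map_add' a b := by
    refine LinearMap.ext fun w => funext fun i => ?_
    simp [mul_add]
  commutes' r := by
    refine LinearMap.ext fun w => funext fun i => ?_
    simp [Algebra.algebraMap_eq_smul_one, HopfAlgebra.antipode_one]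

lemma freeRight_apply (a : A) (w : I → A) (i : I) :
    freeRight A I a w i = w i * HopfAlgebra.antipode ℂ a := rfl

variable {I} [Fintype I] [DecidableEq I]

/-- The action of a representation on the first factor of `ℂ^I ⊗ A`. -/
def freeAct (φ : A →ₐ[ℂ] Matrix I I ℂ) : A →ₐ[ℂ] Module.End ℂ (I → A) where
  toFun a := LinearMap.pi fun i => ∑ j, φ a i j • LinearMap.proj j
  map_one' := by
    refine LinearMap.ext fun w => funext fun i => ?_
    simp [Matrix.one_apply]
  map_mul' a b := by
    refine LinearMap.ext fun w => funext fun i => ?_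
    simp only [map_mul, Matrix.mul_apply, LinearMap.pi_apply, LinearMap.sum_apply,
      LinearMap.smul_apply, LinearMap.proj_apply, Module.End.mul_apply, Finset.sum_smul,
      Finset.smul_sum, smul_smul]
    exact Finset.sum_comm
  map_zero' := by
    refine LinearMap.ext fun w => funext fun i => ?_
    simp
  map_add' a b := by
    refine LinearMap.ext fun w => funext fun i => ?_
    simp [add_smul, Finset.sum_add_distrib]
  commutes' r := by
    refine LinearMap.ext fun w => funext fun i => ?_
    simp [Matrix.algebraMap_matrix_apply]

lemma freeAct_apply (φ : A →ₐ[ℂ] Matrix I I ℂ) (a : A) (w : I → A) (i : I) :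
    freeAct φ a w i = ∑ j, φ a i j • w j := by
  simp [freeAct]

lemma commute_freeAct_freeLeft (φ : A →ₐ[ℂ] Matrix I I ℂ) (a b : A) :
    Commute (freeAct φ a) (freeLeft A I b) := by
  refine LinearMap.ext fun w => funext fun i => ?_
  simp [freeAct_apply, freeLeft_apply, Finset.mul_sum]

lemma commute_freeRight_freeAct (φ : A →ₐ[ℂ] Matrix I I ℂ) (a b : A) :
    Commute (freeRight A I a) (freeAct φ b) := by
  refine LinearMap.ext fun w => funext fun i => ?_
  simp [freeAct_apply, freeRight_apply, Finset.sum_mul]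

omit [Fintype I] [DecidableEq I] in
lemma commute_freeRight_freeLeft (a b : A) :
    Commute (freeRight A I a) (freeLeft A I b) := by
  refine LinearMap.ext fun w => funext fun i => ?_
  simp [freeLeft_apply, freeRight_apply, mul_assoc]

/-- The action `a ⊳ (x ⊗ b) = a₍₂₎ x ⊗ a₍₃₎ b S(a₍₁₎)` of `A` on `ℂ^I ⊗ A`. -/
def adjAct (φ : A →ₐ[ℂ] Matrix I I ℂ) : A →ₐ[ℂ] Module.End ℂ (I → A) :=
  convAlgHom (freeRight A I)
    (convAlgHom (freeAct φ) (freeLeft A I) (commute_freeAct_freeLeft φ)) fun a b => by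
      simp only [convAlgHom, AlgHom.comp_apply, Bialgebra.comulAlgHom_apply]
      induction (comul b : A ⊗[ℂ] A) with
      | zero => simp
      | add x y hx hy => rw [map_add]; exact hx.add_right hy
      | tmul x y =>
        rw [Algebra.TensorProduct.lift_tmul]
        exact (commute_freeRight_freeAct φ a x).mul_right (commute_freeRight_freeLeft a y)

lemma toConv_adjAct (φ : A →ₐ[ℂ] Matrix I I ℂ) :
    toConv (adjAct φ).toLinearMap = toConv (freeRight A I).toLinearMap *
      (toConv (freeAct φ).toLinearMap * toConv (freeLeft A I).toLinearMap) := by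
  rw [adjAct, toConv_convAlgHom, toConv_convAlgHom]

omit [Fintype I] [DecidableEq I] in
/-- The dual algebra acts on `A^I` through the coproduct. -/
def coact (A : Type*) [Ring A] [HopfAlgebra ℂ A] (I : Type*) :
    (A →ₗ[ℂ] ℂ) →ₗ[ℂ] Module.End ℂ (I → A) where
  toFun f := (rt f).compLeft I
  map_add' f g := by
    refine LinearMap.ext fun w => funext fun i => ?_
    simp [rt_add]
  map_smul' c f := by
    refine LinearMap.ext fun w => funext fun i => ?_
    simp [rt_smul]

omit [Fintype I] [DecidableEq I] in
lemma coact_apply (f : A →ₗ[ℂ] ℂ) (w : I → A) (i : I) : coact A I f w i = rt f (w i) := rfl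

/-- `a ↦ V(f(a ·))`. -/
def coactLeft (A : Type*) [Ring A] [HopfAlgebra ℂ A] (I : Type*) (f : A →ₗ[ℂ] ℂ) :
    A →ₗ[ℂ] Module.End ℂ (I → A) :=
  coact A I ∘ₗ (LinearMap.llcomp ℂ A A ℂ f) ∘ₗ LinearMap.mul ℂ A

/-- `a ↦ V(f(· a))`. -/
def coactRight (A : Type*) [Ring A] [HopfAlgebra ℂ A] (I : Type*) (f : A →ₗ[ℂ] ℂ) :
    A →ₗ[ℂ] Module.End ℂ (I → A) :=
  coact A I ∘ₗ (LinearMap.llcomp ℂ A A ℂ f) ∘ₗ (LinearMap.mul ℂ A).flip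

omit [Fintype I] [DecidableEq I] in
lemma coactLeft_apply (f : A →ₗ[ℂ] ℂ) (a : A) :
    coactLeft A I f a = coact A I (f ∘ₗ LinearMap.mulLeft ℂ a) := rfl

omit [Fintype I] [DecidableEq I] in
lemma coactRight_apply (f : A →ₗ[ℂ] ℂ) (a : A) :
    coactRight A I f a = coact A I (f ∘ₗ LinearMap.mulRight ℂ a) := rfl

variable [FiniteDimensional ℂ A]

omit [Fintype I] [DecidableEq I] in
lemma coact_mul (f g : HopfDual A) :
    coact A I (f * g).ofConv = coact A I f.ofConv * coact A I g.ofConv := by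
  have : rt (f * g).ofConv = rt f.ofConv ∘ₗ rt g.ofConv := by
    refine conv_ext fun n v hv i j => ?_
    rw [LinearMap.comp_apply, rt_of_comul _ (hv.comul_apply i j),
      rt_of_comul _ (hv.comul_apply i j), map_sum]
    simp_rw [map_smul, rt_of_comul _ (hv.comul_apply _ _), Finset.smul_sum, smul_smul]
    rw [Finset.sum_comm]
    refine Finset.sum_congr rfl fun k _ => ?_
    rw [← Finset.sum_smul]
    congr 1
    change (f * g) (v k j) = _
    rw [hv.conv_apply]
    exact Finset.sum_congr rfl fun l _ => mul_comm _ _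
  refine LinearMap.ext fun w => funext fun i => ?_
  rw [Module.End.mul_apply, coact_apply, coact_apply, coact_apply, this]
  rfl

omit [Fintype I] [DecidableEq I] [FiniteDimensional ℂ A] in
lemma coact_counit : coact A I counit = 1 := by
  refine LinearMap.ext fun w => funext fun i => ?_
  rw [coact_apply, rt, LinearMap.comp_apply, LinearMap.comp_apply,
    Coalgebra.lTensor_counit_comul]
  simp

/-- Multiplicativity of Δ: past the twist, a left factor a also acts through a₍₁₎ on ℂ^I. Convolving
with `constConv` is composing with a fixed operator, so such rules become identities between
convolution products. -/
lemma constConv_leftTwist_mul_freeLeft (φ : A →ₐ[ℂ] Matrix I I ℂ) :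
    constConv A (leftTwist φ.toLinearMap) * toConv (freeLeft A I).toLinearMap =
      toConv (freeAct φ).toLinearMap * toConv (freeLeft A I).toLinearMap *
        constConv A (leftTwist φ.toLinearMap) := by
  refine withConv_ext fun n v hv i j => ?_
  rw [constConv_mul_apply hv, mul_constConv_apply hv, hv.conv_apply]
  refine LinearMap.ext fun w => funext fun r => ?_
  simp only [AlgHom.toLinearMap_apply, Module.End.mul_apply, leftTwist_apply,
    freeLeft_apply, Finset.sum_mul, LinearMap.sum_apply, Finset.sum_apply, freeAct_apply,
    lt_tmul_mul hv, Finset.mul_sum, Finset.smul_sum]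
  rw [Finset.sum_comm]
  exact Finset.sum_congr rfl fun k _ => Finset.sum_comm

/-- Since S is anti-comultiplicative, the right factor S(a) contributes S(a₍₂₎) on ℂ^I and S(a₍₁₎)
on A. -/
lemma constConv_leftTwist_mul_freeRight (φ : A →ₐ[ℂ] Matrix I I ℂ) :
    constConv A (leftTwist φ.toLinearMap) * toConv (freeRight A I).toLinearMap =
      toConv (freeRight A I).toLinearMap * constConv A (leftTwist φ.toLinearMap) *
        toConv ((freeAct φ).toLinearMap ∘ₗ HopfAlgebra.antipode ℂ) := by
  refine withConv_ext fun n v hv i j => ?_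
  rw [constConv_mul_apply hv, hv.conv_apply]
  simp only [mul_constConv_apply hv]
  refine LinearMap.ext fun w => funext fun r => ?_
  simp only [AlgHom.toLinearMap_apply, Module.End.mul_apply, leftTwist_apply,
    freeRight_apply, LinearMap.sum_apply, Finset.sum_apply, freeAct_apply,
    lt_mul_tmul (hv.comul_antipode _ _), map_sum, map_smul, LinearMap.comp_apply, Finset.sum_mul,
    smul_mul_assoc]
  rw [Finset.sum_comm]
  exact Finset.sum_congr rfl fun k _ => Finset.sum_comm

/-- Moving the twist past `freeRight` creates the antipode of `freeAct`, which cancels the `freeAct`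
in the action; moving it past `freeLeft` creates `freeAct` again. -/
lemma leftTwist_commute_adjAct (φ : A →ₐ[ℂ] Matrix I I ℂ) (a : A) :
    Commute (leftTwist φ.toLinearMap) (adjAct φ a) := by
  set τ := constConv A (leftTwist φ.toLinearMap)
  set NS := toConv ((freeAct φ).toLinearMap ∘ₗ HopfAlgebra.antipode ℂ)
  set N := toConv (freeAct φ).toLinearMap
  have hNS : NS * N = 1 := by
    refine withConv_ext fun n v hv i j => ?_
    rw [hv.conv_apply, convOne_corep_apply hv]
    simp only [NS, N, LinearMap.comp_apply, AlgHom.toLinearMap_apply, ← map_mul,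
      ← map_sum, hv.sum_antipode_mul]
    split_ifs <;> simp
  have key : τ * toConv (adjAct φ).toLinearMap = toConv (adjAct φ).toLinearMap * τ := by
    rw [toConv_adjAct, ← mul_assoc, constConv_leftTwist_mul_freeRight, mul_assoc, mul_assoc,
      ← mul_assoc NS, hNS, one_mul, constConv_leftTwist_mul_freeLeft]
    simp only [mul_assoc]
    rfl
  have h2 : LinearMap.mulLeft ℂ (leftTwist φ.toLinearMap) ∘ₗ (adjAct φ).toLinearMap =
      LinearMap.mulRight ℂ (leftTwist φ.toLinearMap) ∘ₗ (adjAct φ).toLinearMap := by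
    refine conv_ext fun n v hv i j => ?_
    have := congrArg (fun F : WithConv (A →ₗ[ℂ] _) => F (v i j)) key
    simp only [τ] at this
    rw [constConv_mul_apply hv, mul_constConv_apply hv] at this
    exact this
  exact LinearMap.congr_fun h2 a

/-- Coassociativity: the twist consumes the left leg of Δ and the coaction the right leg. -/
lemma leftTwist_commute_coact (φ : A →ₐ[ℂ] Matrix I I ℂ) (f : A →ₗ[ℂ] ℂ) :
    Commute (leftTwist φ.toLinearMap) (coact A I f) := by
  have h : ∀ g : A →ₗ[ℂ] ℂ, lt g ∘ₗ rt f = rt f ∘ₗ lt g := by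
    intro g
    refine conv_ext fun n v hv i j => ?_
    rw [LinearMap.comp_apply, LinearMap.comp_apply, rt_of_comul _ (hv.comul_apply i j),
      lt_of_comul _ (hv.comul_apply i j), map_sum, map_sum]
    simp_rw [map_smul, rt_of_comul _ (hv.comul_apply _ _), lt_of_comul _ (hv.comul_apply _ _),
      Finset.smul_sum, smul_smul]
    rw [Finset.sum_comm]
    simp_rw [mul_comm]
  refine LinearMap.ext fun w => funext fun r => ?_
  simp only [Module.End.mul_apply, leftTwist_apply, coact_apply, map_sum]
  exact Finset.sum_congr rfl fun s _ => LinearMap.congr_fun (h _) _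

omit [Fintype I] [DecidableEq I] in
lemma coact_mul_freeLeft (f : A →ₗ[ℂ] ℂ) :
    constConv A (coact A I f) * toConv (freeLeft A I).toLinearMap =
      toConv (freeLeft A I).toLinearMap * toConv (coactLeft A I f) := by
  refine withConv_ext fun n v hv i j => ?_
  rw [constConv_mul_apply hv, hv.conv_apply]
  refine LinearMap.ext fun w => funext fun r => ?_
  simp only [AlgHom.toLinearMap_apply, Module.End.mul_apply, coact_apply,
    freeLeft_apply, LinearMap.sum_apply, Finset.sum_apply, coactLeft_apply, rt_tmul_mul hv]

end Free

section FreeInvolutive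

variable {A : Type*} [Ring A] [StarRing A] [HopfAlgebra ℂ A] [StarModule ℂ A]
  [FiniteDimensional ℂ A] [IsCStarHopfAlgebra A]
variable {I : Type*} [Fintype I] [DecidableEq I]

omit [Fintype I] [DecidableEq I] in
-- The cancellation behind this is S(a₍₂₎) a₍₁₎ = ε(a), which relies on S² = 1.
lemma coactRight_mul_freeRight (f : A →ₗ[ℂ] ℂ) :
    toConv (coactRight A I f) * toConv (freeRight A I).toLinearMap =
      toConv (freeRight A I).toLinearMap * constConv A (coact A I f) := by
  refine withConv_ext fun n v hv i j => ?_
  rw [mul_constConv_apply hv, hv.conv_apply]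
  refine LinearMap.ext fun w => funext fun r => ?_
  simp only [AlgHom.toLinearMap_apply, Module.End.mul_apply, coact_apply,
    freeRight_apply, LinearMap.sum_apply, Finset.sum_apply, coactRight_apply,
    rt_mul_tmul (hv.comul_antipode _ _)]
  have h1 : ∀ k l, rt ((f ∘ₗ LinearMap.mulRight ℂ (v i k)) ∘ₗ
      LinearMap.mulRight ℂ (HopfAlgebra.antipode ℂ (v k l))) (w r) =
      TensorProduct.rid ℂ A ((f.lTensor A) (comul (w r) *
        ((1 : A) ⊗ₜ[ℂ] (HopfAlgebra.antipode ℂ (v k l) * v i k)))) := by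
    intro k l
    rw [rt, LinearMap.comp_apply, LinearMap.comp_apply]
    induction (comul (w r) : A ⊗[ℂ] A) with
    | zero => simp
    | add x y hx hy => simp only [map_add, add_mul, hx, hy]
    | tmul x y => simp [mul_assoc]
  simp_rw [h1]
  rw [Finset.sum_comm]
  simp_rw [← Finset.sum_mul, ← map_sum, ← Finset.mul_sum, ← TensorProduct.tmul_sum,
    hv.sum_antipode_mul_flip]
  rw [Finset.sum_eq_single i]
  · rw [if_pos rfl, ← Algebra.TensorProduct.one_def, mul_one]
    rfl
  · intro l _ hl
    simp [hl.symm]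
  · simp

/-- The Yetter-Drinfeld relation on the free module. -/
lemma coactRight_mul_adjAct (φ : A →ₐ[ℂ] Matrix I I ℂ) (f : A →ₗ[ℂ] ℂ) :
    toConv (coactRight A I f) * toConv (adjAct φ).toLinearMap =
      toConv (adjAct φ).toLinearMap * toConv (coactLeft A I f) := by
  have hN : constConv A (coact A I f) * toConv (freeAct φ).toLinearMap =
      toConv (freeAct φ).toLinearMap * constConv A (coact A I f) := by
    refine withConv_ext fun n v hv i j => ?_
    rw [constConv_mul_apply hv, mul_constConv_apply hv]
    refine LinearMap.ext fun w => funext fun r => ?_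
    simp [coact_apply, freeAct_apply]
  rw [toConv_adjAct, ← mul_assoc, coactRight_mul_freeRight, mul_assoc, ← mul_assoc (constConv A _),
    hN, mul_assoc, coact_mul_freeLeft]
  simp only [mul_assoc]

omit [StarRing A] [StarModule ℂ A] [IsCStarHopfAlgebra A] in
/-- The canonical twist of the free Yetter-Drinfeld module. -/
lemma sum_adjAct_mul_coact {B : Type*} [Fintype B] (b : Module.Basis B ℂ A)
    (φ : A →ₐ[ℂ] Matrix I I ℂ) :
    ∑ p, adjAct φ (b p) * coact A I (b.coord p) = leftTwist φ.toLinearMap := by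
  classical
  refine pi_ext_corep fun m u hu k l s => ?_
  have hco : ∀ f : A →ₗ[ℂ] ℂ, coact A I f (Pi.single s (u k l)) =
      ∑ q, f (u q l) • Pi.single (M := fun _ => A) s (u k q) := by
    intro f
    funext i
    by_cases h : i = s
    · subst h
      simp [coact_apply, rt_of_comul _ (hu.comul_apply _ _)]
    · simp [coact_apply, h]
  simp only [LinearMap.sum_apply, Module.End.mul_apply, hco, map_sum, map_smul]
  rw [Finset.sum_comm]
  have h1 : ∀ q, ∑ p, b.coord p (u q l) • adjAct φ (b p) (Pi.single s (u k q)) =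
      adjAct φ (u q l) (Pi.single s (u k q)) := by
    intro q
    conv_rhs => rw [← b.sum_repr (u q l)]
    simp only [map_sum, map_smul, LinearMap.sum_apply, LinearMap.smul_apply,
      Module.Basis.coord_apply]
  simp_rw [h1]
  have h2 : ∀ q, adjAct φ (u q l) = ∑ p, freeRight A I (u q p) * ∑ t,
      freeAct φ (u p t) * freeLeft A I (u t l) := by
    intro q
    have := congrArg (fun F : WithConv (A →ₗ[ℂ] _) => F (u q l)) (toConv_adjAct φ)
    simp only [hu.conv_apply] at this
    exact this
  funext r
  -- In Sweedler notation the sum is b₍₃₎x ⊗ b₍₄₎ b₍₁₎ S(b₍₂₎), and b₍₁₎ S(b₍₂₎) collapses in `h4`.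
  have h3 : ∀ q, adjAct φ (u q l) (Pi.single s (u k q)) r =
      ∑ p, ∑ t, φ (u p t) r s • (u t l * (u k q * HopfAlgebra.antipode ℂ (u q p))) := by
    intro q
    rw [h2]
    simp only [LinearMap.sum_apply, Module.End.mul_apply, Finset.sum_apply, freeRight_apply,
      freeAct_apply, freeLeft_apply, Finset.sum_mul]
    refine Finset.sum_congr rfl fun p _ => Finset.sum_congr rfl fun t _ => ?_
    rw [Finset.sum_eq_single s]
    · simp [mul_assoc]
    · intro x _ hx; simp [hx]
    · simp
  rw [Finset.sum_apply]
  simp_rw [h3]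
  rw [Finset.sum_comm, leftTwist_apply, Finset.sum_eq_single s _ (by simp)]
  · rw [Pi.single_eq_same, lt_of_comul _ (hu.comul_apply _ _)]
    have h4 : ∀ p, ∑ q, ∑ t, φ (u p t) r s •
        (u t l * (u k q * HopfAlgebra.antipode ℂ (u q p))) =
        if k = p then ∑ t, φ (u p t) r s • u t l else 0 := by
      intro p
      rw [Finset.sum_comm]
      simp_rw [← Finset.smul_sum, ← Finset.mul_sum, hu.sum_mul_antipode]
      split_ifs <;> simp
    simp_rw [h4]
    simp
  · intro x _ hx
    simp [hx]

end FreeInvolutive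

/-! ### Finiteness of the exponent -/

section Isometry

variable {E : Type*} [NormedAddCommGroup E] [InnerProductSpace ℂ E]

/-- No Jordan blocks: if y = (T − μ)x ≠ 0 were an eigenvector for μ, then |μ| = 1, and the isometry
property gives ⟨y, Tx⟩ = μ⟨y, x⟩, that is ⟨y, y⟩ = 0. -/
lemma eigenspace_of_isometry {T : Module.End ℂ E} (hT : ∀ x y, inner ℂ (T x) (T y) = inner ℂ x y)
    (μ : ℂ) : T.maxGenEigenspace μ ≤ T.eigenspace μ := by
  have step : ∀ x, (T - μ • 1) ((T - μ • 1) x) = 0 → (T - μ • 1) x = 0 := by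
    intro x hx
    set y := (T - μ • 1) x with hy
    have hTy : T y = μ • y := by
      have : T y - μ • y = 0 := by simpa using hx
      exact sub_eq_zero.1 this
    have hyx : y = T x - μ • x := by simp [hy]
    by_contra hne
    have hyy : inner ℂ y y ≠ (0 : ℂ) := inner_self_ne_zero.2 hne
    have h1 : (starRingEnd ℂ μ) * μ = 1 := by
      have := hT y y
      rw [hTy, inner_smul_left, inner_smul_right, ← mul_assoc] at this
      exact mul_right_cancel₀ hyy (by rw [this, one_mul])
    have h2 : (starRingEnd ℂ μ) * inner ℂ y (T x) = inner ℂ y x := by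
      rw [← inner_smul_left, ← hTy, hT]
    have h3 : inner ℂ y y = inner ℂ y (T x) - μ * inner ℂ y x := by
      conv_lhs => rw [hyx, ← hyx]
      rw [← inner_smul_right, ← inner_sub_right, ← hyx]
    have h4 : (starRingEnd ℂ μ) * inner ℂ y y = 0 := by
      rw [h3]
      linear_combination h2 - h1 * inner ℂ y x
    have h5 : starRingEnd ℂ μ ≠ 0 := fun h0 => by rw [h0, zero_mul] at h1; exact zero_ne_one h1
    exact (mul_ne_zero h5 hyy) h4
  intro x hx
  rw [Module.End.mem_maxGenEigenspace] at hx
  obtain ⟨k, hk⟩ := hx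
  rw [Module.End.mem_eigenspace_iff]
  suffices (T - μ • 1) x = 0 by simpa [sub_eq_zero] using this
  induction k with
  | zero => rw [show x = 0 by simpa using hk, map_zero]
  | succ k ih =>
    cases k with
    | zero => simpa using hk
    | succ k =>
      refine ih ?_
      rw [pow_succ', Module.End.mul_apply] at hk ⊢
      rw [pow_succ', Module.End.mul_apply] at hk
      exact step _ hk

end Isometry

/-! ### The twist has finite order, hence so has the identity under convolution -/

section Exponent

variable {A : Type*} [Ring A] [StarRing A] [HopfAlgebra ℂ A] [StarModule ℂ A]
  [FiniteDimensional ℂ A] [IsCStarHopfAlgebra A]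

/-- The inner product `∑ i, h(x i * y i)` on `A^I`. -/
@[reducible] def haarPiCore (A : Type*) [Ring A] [StarRing A] [HopfAlgebra ℂ A] [StarModule ℂ A]
    [FiniteDimensional ℂ A] [IsCStarHopfAlgebra A] (I : Type*) [Fintype I] :
    InnerProductSpace.Core ℂ (I → A) where
  inner x y := ∑ i, (haarCore A).inner (x i) (y i)
  conj_inner_symm x y := by
    rw [map_sum]
    exact Finset.sum_congr rfl fun i _ => (haarCore A).conj_inner_symm _ _
  re_inner_nonneg x := by
    rw [map_sum]
    exact Finset.sum_nonneg fun i _ => (haarCore A).re_inner_nonneg _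
  add_left x y z := by
    rw [← Finset.sum_add_distrib]
    exact Finset.sum_congr rfl fun i _ => (haarCore A).add_left _ _ _
  smul_left x y r := by
    rw [Finset.mul_sum]
    exact Finset.sum_congr rfl fun i _ => (haarCore A).smul_left _ _ _
  definite x h := funext fun i => core_eq_zero_of_sum (haarCore A) x h i

variable {I : Type*} [Fintype I] [DecidableEq I]

/-- The sum over i assembles φ(x₍₁₎)*φ(y₍₁₎), so the left side is the (s, t) entry of φ((id ⊗
h)(Δ(x*y))), a scalar matrix by invariance of h. -/
lemma haar_lt_lt (φ : A →⋆ₐ[ℂ] Matrix I I ℂ) (s t : I) (x y : A) :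
    ∑ i, haar A (star (lt (coeff φ.toAlgHom.toLinearMap i s) x) *
      lt (coeff φ.toAlgHom.toLinearMap i t) y) = if s = t then haar A (star x * y) else 0 := by
  have key : ∀ z z' : A ⊗[ℂ] A, ∑ i, haar A
      (star (TensorProduct.lid ℂ A ((coeff φ.toAlgHom.toLinearMap i s).rTensor A z)) *
        TensorProduct.lid ℂ A ((coeff φ.toAlgHom.toLinearMap i t).rTensor A z')) =
      φ (TensorProduct.rid ℂ A ((haar A).lTensor A (star z * z'))) s t := by
    intro z z'
    induction z with
    | zero => simp
    | add z₁ z₂ h₁ h₂ =>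
      simp only [map_add, star_add, add_mul, Finset.sum_add_distrib, h₁, h₂, Matrix.add_apply]
    | tmul a b =>
      induction z' with
      | zero => simp
      | add z₁ z₂ h₁ h₂ =>
        simp only [map_add, mul_add, Finset.sum_add_distrib, h₁, h₂, Matrix.add_apply]
      | tmul a' b' =>
        simp only [LinearMap.rTensor_tmul, TensorProduct.lid_tmul, coeff_apply,
          TensorProduct.star_tmul, Algebra.TensorProduct.tmul_mul_tmul, LinearMap.lTensor_tmul,
          TensorProduct.rid_tmul, map_smul, map_mul, map_star, Matrix.smul_apply, Matrix.mul_apply,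
          Matrix.star_apply, star_smul, smul_mul_smul_comm, smul_eq_mul, Finset.mul_sum]
        exact Finset.sum_congr rfl fun i _ => mul_comm _ _
  have h := key (comul x) (comul y)
  rw [← IsCStarHopfAlgebra.comul_star, ← Bialgebra.comul_mul] at h
  have h2 := rt_haar (star x * y)
  simp only [rt, LinearMap.comp_apply] at h2
  erw [h2] at h
  simp only [lt, LinearMap.comp_apply]
  refine h.trans ?_
  rw [map_smul, map_one, Matrix.smul_apply, Matrix.one_apply]
  split_ifs <;> simp

lemma leftTwist_isometry (φ : A →⋆ₐ[ℂ] Matrix I I ℂ) (w w' : I → A) :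
    (haarPiCore A I).inner (leftTwist φ.toAlgHom.toLinearMap w)
      (leftTwist φ.toAlgHom.toLinearMap w') = (haarPiCore A I).inner w w' := by
  change ∑ i, haar A (star (leftTwist φ.toAlgHom.toLinearMap w i) *
    leftTwist φ.toAlgHom.toLinearMap w' i) = ∑ i, haar A (star (w i) * w' i)
  simp_rw [leftTwist_apply, star_sum, Finset.sum_mul_sum, map_sum]
  calc _ = ∑ s, ∑ t, ∑ i, haar A (star (lt (coeff φ.toAlgHom.toLinearMap i s) (w s)) *
      lt (coeff φ.toAlgHom.toLinearMap i t) (w' t)) := by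
        rw [Finset.sum_comm]
        exact Finset.sum_congr rfl fun s _ => Finset.sum_comm
    _ = _ := by simp [haar_lt_lt]

omit [StarRing A] [StarModule ℂ A] [IsCStarHopfAlgebra A] in
-- An entry V(f) i j is linear in f, hence evaluation of f at some element of A. Multiplicativity
-- and unitality of V translate into the formulas for Δ and ε.
lemma exists_corep_of_dual_rep {n : Type*} [Fintype n] [DecidableEq n]
    (V : (A →ₗ[ℂ] ℂ) →ₗ[ℂ] Matrix n n ℂ)
    (hmul : ∀ f g : HopfDual A, V (f * g).ofConv = V f.ofConv * V g.ofConv)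
    (hone : V counit = 1) :
    ∃ v : Matrix n n A, IsCorep v ∧ ∀ f i j, f (v i j) = V f i j := by
  set b := Module.finBasis ℂ A
  let v : Matrix n n A := Matrix.of fun i j => ∑ p, V (b.coord p) i j • b p
  have hv : ∀ f i j, f (v i j) = V f i j := by
    intro f i j
    have hf : f = ∑ p, f (b p) • b.coord p := by
      refine b.ext fun q => ?_
      simp
    have h1 : V f i j = ∑ p, f (b p) * V (b.coord p) i j := by
      conv_lhs => rw [hf]
      simp only [map_sum, map_smul, Matrix.sum_apply, Matrix.smul_apply, smul_eq_mul]
    rw [h1]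
    simp [v, mul_comm]
  refine ⟨v, ⟨fun i j => ?_, fun i j => ?_⟩, hv⟩
  · have hsep : ∀ z z' : A ⊗[ℂ] A, (∀ f g : A →ₗ[ℂ] ℂ,
        TensorProduct.lid ℂ ℂ (TensorProduct.map f g z) =
        TensorProduct.lid ℂ ℂ (TensorProduct.map f g z')) → z = z' := by
      intro z z' h
      rw [tmul_slice_left b z, tmul_slice_left b z']
      refine Finset.sum_congr rfl fun p _ => congrArg _ (eq_of_forall_functional fun g => ?_)
      have h1 : ∀ z : A ⊗[ℂ] A, g (TensorProduct.lid ℂ A ((b.coord p).rTensor A z)) =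
          TensorProduct.lid ℂ ℂ (TensorProduct.map (b.coord p) g z) := by
        intro z
        induction z with
        | zero => simp
        | add x y hx hy => simp only [map_add, hx, hy]
        | tmul x y => simp
      rw [h1, h1, h]
    refine hsep _ _ fun f g => ?_
    have h2 := hv (toConv f * toConv g).ofConv i j
    rw [hmul] at h2
    simp only [map_sum, TensorProduct.map_tmul, TensorProduct.lid_tmul, smul_eq_mul, hv]
    rw [Matrix.mul_apply] at h2
    rw [← h2]
    simp only [LinearMap.convMul_def, LinearMap.comp_apply]
    induction (comul (v i j) : A ⊗[ℂ] A) with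
    | zero => simp
    | add x y hx hy => simp only [map_add, hx, hy]
    | tmul x y => simp
  · rw [hv, hone, Matrix.one_apply]

omit [StarRing A] [StarModule ℂ A] [FiniteDimensional ℂ A] [IsCStarHopfAlgebra A] in
/-- Operators commuting with `T`, restricted to an eigenspace of `T` and written as matrices. -/
def eigenMatrix {W : Type*} [AddCommGroup W] [Module ℂ W] [FiniteDimensional ℂ W]
    (T : Module.End ℂ W) (lam : ℂ) : Subalgebra.centralizer ℂ {T} →ₐ[ℂ]
      Matrix (Fin (Module.finrank ℂ (T.eigenspace lam)))
        (Fin (Module.finrank ℂ (T.eigenspace lam))) ℂ :=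
  (LinearMap.toMatrixAlgEquiv (Module.finBasis ℂ (T.eigenspace lam))).toAlgHom.comp
    { toFun := fun X => X.1.restrict (p := T.eigenspace lam) (q := T.eigenspace lam)
        fun x hx => by
          rw [Module.End.mem_eigenspace_iff] at hx ⊢
          have := LinearMap.congr_fun (Subalgebra.mem_centralizer_iff ℂ |>.1 X.2 T rfl) x
          simp only [Module.End.mul_apply] at this
          rw [this, hx, map_smul]
      map_one' := rfl
      map_mul' := fun _ _ => rfl
      map_zero' := rfl
      map_add' := fun _ _ => rfl
      commutes' := fun _ => rfl }

lemma eigenMatrix_self {W : Type*} [AddCommGroup W] [Module ℂ W] [FiniteDimensional ℂ W]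
    (T : Module.End ℂ W) (lam : ℂ) (hT : T ∈ Subalgebra.centralizer ℂ {T}) :
    eigenMatrix T lam ⟨T, hT⟩ = lam • 1 := by
  rw [← map_one (LinearMap.toMatrixAlgEquiv (Module.finBasis ℂ (T.eigenspace lam))),
    ← map_smul]
  change (LinearMap.toMatrixAlgEquiv _) _ = (LinearMap.toMatrixAlgEquiv _) _
  congr 1
  refine LinearMap.ext fun x => Subtype.ext ?_
  exact Module.End.mem_eigenspace_iff.1 x.2

/-- Eigenvalues of the twist are roots of unity. -/
lemma eigenvalue_pow (φ : A →ₐ[ℂ] Matrix I I ℂ) (lam : ℂ) :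
    lam ^ (Module.finrank ℂ ((leftTwist φ.toLinearMap).eigenspace lam) * Module.finrank ℂ A *
      Module.finrank ℂ A) = 1 := by
  set T := leftTwist φ.toLinearMap with hTdef
  set C := Subalgebra.centralizer ℂ {T}
  have hR : ∀ a, adjAct φ a ∈ C := fun a => by
    rw [Subalgebra.mem_centralizer_iff]
    rintro _ rfl
    exact leftTwist_commute_adjAct φ a
  have hV : ∀ f, coact A I f ∈ C := fun f => by
    rw [Subalgebra.mem_centralizer_iff]
    rintro _ rfl
    exact leftTwist_commute_coact φ f
  -- Action and coaction commute with T, so they restrict to the eigenspace, which becomes a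
  -- Yetter-Drinfeld module with scalar twist `lam`.
  set E := eigenMatrix T lam
  let ρ := E.comp ((adjAct φ).codRestrict C hR)
  let V : (A →ₗ[ℂ] ℂ) →ₗ[ℂ] Matrix _ _ ℂ :=
    E.toLinearMap ∘ₗ (coact A I).codRestrict (Subalgebra.toSubmodule C) hV
  have hVE : ∀ f, V f = E ⟨coact A I f, hV f⟩ := fun f => rfl
  have hρE : ∀ a, ρ a = E ⟨adjAct φ a, hR a⟩ := fun a => rfl
  obtain ⟨v, hv, hvV⟩ := exists_corep_of_dual_rep V
    (fun f g => by
      rw [hVE, hVE, hVE, ← map_mul]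
      exact congrArg E (Subtype.ext (coact_mul f g)))
    (by rw [hVE, ← map_one E]; exact congrArg E (Subtype.ext coact_counit))
  have h := yetterDrinfeld_twist_pow ρ hv lam ?_ ?_
  · rwa [Fintype.card_fin] at h
  · intro x i j
    -- Paired with f, the Yetter-Drinfeld condition is a matrix entry of the restriction of
    -- `coactRight_mul_adjAct`.
    refine eq_of_forall_functional fun f => ?_
    let l : A →ₗ[ℂ] ℂ := ∑ k, f ∘ₗ LinearMap.mulRight ℂ (v k j) ∘ₗ lt (coeff ρ.toLinearMap i k)
    let r : A →ₗ[ℂ] ℂ := ∑ k, f ∘ₗ LinearMap.mulLeft ℂ (v i k) ∘ₗ rt (coeff ρ.toLinearMap k j)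
    suffices l = r by simpa [l, r] using LinearMap.congr_fun this x
    refine conv_ext fun m u hu p q => ?_
    have h1 : ∑ k, coact A I (f ∘ₗ LinearMap.mulRight ℂ (u p k)) * adjAct φ (u k q) =
        ∑ k, adjAct φ (u p k) * coact A I (f ∘ₗ LinearMap.mulLeft ℂ (u k q)) := by
      have := congrArg (fun F : WithConv (A →ₗ[ℂ] _) => F (u p q)) (coactRight_mul_adjAct φ f)
      simp only [hu.conv_apply] at this
      exact this
    have h2 : ∑ k, V (f ∘ₗ LinearMap.mulRight ℂ (u p k)) * ρ (u k q) =
        ∑ k, ρ (u p k) * V (f ∘ₗ LinearMap.mulLeft ℂ (u k q)) := by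
      simp_rw [hVE, hρE, ← map_mul, ← map_sum]
      refine congrArg E (Subtype.ext ?_)
      simpa using h1
    have h3 := congrFun (congrFun h2 i) j
    simp only [Matrix.sum_apply, Matrix.mul_apply, ← hvV, LinearMap.comp_apply,
      LinearMap.mulRight_apply, LinearMap.mulLeft_apply] at h3
    simp only [l, r, LinearMap.sum_apply, LinearMap.comp_apply, lt_of_comul _ (hu.comul_apply p q),
      rt_of_comul _ (hu.comul_apply p q), LinearMap.mulRight_apply, LinearMap.mulLeft_apply,
      map_sum, map_smul, coeff_apply, AlgHom.toLinearMap_apply, smul_eq_mul]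
    rw [Finset.sum_comm, ← h3, Finset.sum_comm]
    simp_rw [mul_comm]
  · intro m l
    set b := Module.finBasis ℂ A
    have h1 := sum_adjAct_mul_coact b φ
    have hT : T ∈ C := by
      rw [Subalgebra.mem_centralizer_iff]
      rintro _ rfl
      rfl
    have h2 : ∑ p, ρ (b p) * V (b.coord p) = lam • 1 := by
      rw [← eigenMatrix_self T lam hT]
      simp_rw [hVE, hρE, ← map_mul, ← map_sum]
      refine congrArg E (Subtype.ext ?_)
      simpa using h1
    have h3 := congrFun (congrFun h2 m) l
    simp only [Matrix.sum_apply, Matrix.mul_apply, ← hvV] at h3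
    rw [Matrix.smul_apply, Matrix.one_apply, Finset.sum_comm] at h3
    have h4 : ∀ k, ∑ p, ρ (b p) m k * b.coord p (v k l) = ρ (v k l) m k := by
      intro k
      conv_rhs => rw [← b.sum_repr (v k l)]
      simp only [map_sum, map_smul, Matrix.sum_apply, Matrix.smul_apply, smul_eq_mul,
        Module.Basis.coord_apply]
      exact Finset.sum_congr rfl fun _ _ => mul_comm _ _
    simp_rw [h4] at h3
    rw [h3]
    split_ifs <;> simp

lemma leftTwist_pow_eq_one (φ : A →⋆ₐ[ℂ] Matrix I I ℂ) :
    ∃ N : ℕ, 0 < N ∧ leftTwist φ.toAlgHom.toLinearMap ^ N = 1 := by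
  set T := leftTwist φ.toAlgHom.toLinearMap with hT
  set d := Module.finrank ℂ A with hd
  have hd0 : 0 < d := by
    have := finrank_ne_zero (A := A)
    exact Nat.pos_of_ne_zero fun h => this (by rw [← hd, h, Nat.cast_zero])
  -- An eigenvalue of multiplicity n satisfies μ^(n d²) = 1 with n ≤ dim A^I, and the factorial is
  -- divisible by every such positive n.
  refine ⟨(Module.finrank ℂ (I → A)).factorial * d * d,
    Nat.mul_pos (Nat.mul_pos (Nat.factorial_pos _) hd0) hd0, ?_⟩
  set N := (Module.finrank ℂ (I → A)).factorial * d * d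
  have hle : ∀ μ, T.maxGenEigenspace μ ≤ LinearMap.ker (T ^ N - 1) := by
    intro μ x hx
    have hx' : x ∈ T.eigenspace μ := by
      let _ : NormedAddCommGroup (I → A) := (haarPiCore A I).toNormedAddCommGroup
      let _ : InnerProductSpace ℂ (I → A) := InnerProductSpace.ofCore (haarPiCore A I).toCore
      exact eigenspace_of_isometry (leftTwist_isometry φ) μ hx
    by_cases hx0 : x = 0
    · rw [hx0]; exact Submodule.zero_mem _
    have hpos : 0 < Module.finrank ℂ (T.eigenspace μ) := by
      have : Nontrivial (T.eigenspace μ) := ⟨⟨⟨x, hx'⟩, 0, fun h => hx0 (congrArg Subtype.val h)⟩⟩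
      exact Module.finrank_pos
    have hdvd : Module.finrank ℂ (T.eigenspace μ) ∣ (Module.finrank ℂ (I → A)).factorial :=
      Nat.dvd_factorial hpos (Submodule.finrank_le _)
    have hμ : μ ^ N = 1 := by
      obtain ⟨c, hc⟩ := hdvd
      have h1 := eigenvalue_pow φ.toAlgHom μ
      have h2 : N = (Module.finrank ℂ (T.eigenspace μ) * d * d) * c := by
        simp only [N]; rw [hc]; ring
      rw [h2, pow_mul, h1, one_pow]
    have hpow : ∀ k : ℕ, (T ^ k) x = μ ^ k • x := by
      intro k
      induction k with
      | zero => simp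
      | succ k ih =>
        rw [pow_succ', Module.End.mul_apply, ih, map_smul, Module.End.mem_eigenspace_iff.1 hx',
          smul_smul, pow_succ]
    rw [LinearMap.mem_ker, LinearMap.sub_apply, hpow, hμ, one_smul, Module.End.one_apply, sub_self]
  have htop : LinearMap.ker (T ^ N - 1) = ⊤ := by
    rw [eq_top_iff, ← Module.End.iSup_maxGenEigenspace_eq_top T]
    exact iSup_le hle
  exact sub_eq_zero.1 (LinearMap.ker_eq_top.1 htop)

omit [FiniteDimensional ℂ A] in
omit [StarRing A] [StarModule ℂ A] [IsCStarHopfAlgebra A] in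
lemma leftTwist_single {m : ℕ} {u : Matrix (Fin m) (Fin m) A} (hu : IsCorep u)
    (ρ : A →ₗ[ℂ] Matrix I I ℂ) (k l : Fin m) (j : I) :
    leftTwist ρ (Pi.single j (u k l)) = fun r => ∑ p, ρ (u k p) r j • u p l := by
  funext r
  rw [leftTwist_apply, Finset.sum_eq_single j _ (by simp)]
  · rw [Pi.single_eq_same, lt_of_comul _ (hu.comul_apply _ _)]
    rfl
  · intro x _ hx; simp [hx]

omit [FiniteDimensional ℂ A] [DecidableEq I] in
omit [StarRing A] [StarModule ℂ A] [IsCStarHopfAlgebra A] in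
lemma leftTwist_sum_smul {m : ℕ} {u : Matrix (Fin m) (Fin m) A} (hu : IsCorep u)
    (ρ : A →ₗ[ℂ] Matrix I I ℂ) (c : Fin m → I → ℂ) (l : Fin m) :
    leftTwist ρ (fun s => ∑ p, c p s • u p l) =
      fun r => ∑ q, (∑ p, ∑ s, ρ (u p q) r s * c p s) • u q l := by
  funext r
  simp only [leftTwist_apply, map_sum, map_smul, lt_of_comul _ (hu.comul_apply _ _),
    coeff_apply, Finset.smul_sum, smul_smul, Finset.sum_smul]
  calc _ = ∑ p, ∑ q, ∑ s, (c p s * ρ (u p q) r s) • u q l := by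
        rw [Finset.sum_comm]
        exact Finset.sum_congr rfl fun p _ => Finset.sum_comm
    _ = _ := by
        rw [Finset.sum_comm]
        simp_rw [mul_comm]

/-- A finite dimensional C*-Hopf algebra has finite exponent. -/
theorem exists_sweedlerPower_eq (A : Type*) [Ring A] [StarRing A] [HopfAlgebra ℂ A]
    [StarModule ℂ A] [FiniteDimensional ℂ A] [IsCStarHopfAlgebra A] :
    ∃ N : ℕ, 0 < N ∧ (toConv (LinearMap.id : A →ₗ[ℂ] A)) ^ N = 1 := by
  obtain ⟨m, φ, hφ⟩ := IsCStarHopfAlgebra.exists_faithful (A := A)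
  obtain ⟨N, hN, hT⟩ := leftTwist_pow_eq_one φ
  refine ⟨N, hN, ?_⟩
  set T := leftTwist φ.toAlgHom.toLinearMap
  -- Q(P) is x ⊗ b ↦ S(P(b₍₁₎)) x ⊗ b₍₂₎. Because S reverses products, Q reverses convolution
  -- products, and Q(id) is the inverse of T.
  let Q : WithConv (A →ₗ[ℂ] A) → Module.End ℂ (Fin m → A) := fun P =>
    leftTwist (φ.toAlgHom.toLinearMap ∘ₗ HopfAlgebra.antipode ℂ ∘ₗ P.ofConv)
  have hQ : ∀ (P : WithConv (A →ₗ[ℂ] A)) {n : ℕ} {u : Matrix (Fin n) (Fin n) A}, IsCorep u →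
      ∀ k l j, Q P (Pi.single j (u k l)) =
        fun r => ∑ p, φ (HopfAlgebra.antipode ℂ (P (u k p))) r j • u p l :=
    fun P n u hu k l j => leftTwist_single hu _ k l j
  have hmul : ∀ P P', Q (P * P') = Q P' * Q P := by
    intro P P'
    refine pi_ext_corep fun n u hu k l j => ?_
    rw [Module.End.mul_apply, hQ _ hu, hQ _ hu, leftTwist_sum_smul hu]
    funext r
    refine Finset.sum_congr rfl fun q _ => congrArg (· • u q l) ?_
    simp only [hu.conv_apply, map_sum, HopfAlgebra.antipode_mul_antidistrib, map_mul,
      Matrix.sum_apply, Matrix.mul_apply]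
    rfl
  have hone : Q 1 = 1 := by
    refine pi_ext_corep fun n u hu k l j => ?_
    rw [hQ _ hu]
    funext r
    simp only [convOne_corep_apply hu]
    rw [Finset.sum_eq_single k _ (by simp)]
    · rw [if_pos rfl, HopfAlgebra.antipode_one, map_one, Matrix.one_apply]
      by_cases h : r = j
      · subst h; simp
      · simp [h]
    · intro p _ hp; simp [hp.symm]
  have hpow : ∀ k : ℕ, Q (toConv LinearMap.id ^ k) = Q (toConv LinearMap.id) ^ k := by
    intro k
    induction k with
    | zero => simpa using hone
    | succ k ih => rw [pow_succ, hmul, ih, pow_succ']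
  have hinv : Q (toConv LinearMap.id) * T = 1 := by
    refine pi_ext_corep fun n u hu k l j => ?_
    rw [Module.End.mul_apply, leftTwist_single hu, leftTwist_sum_smul hu]
    funext r
    have h1 : ∀ q, ∑ p, ∑ s, φ (HopfAlgebra.antipode ℂ (u p q)) r s * φ (u k p) s j =
        if k = q then (1 : Matrix _ _ ℂ) r j else 0 := by
      intro q
      have := congrArg (fun a => φ a r j) (hu.sum_antipode_mul_flip k q)
      simp only [map_sum, map_mul, Matrix.sum_apply, Matrix.mul_apply] at this
      rw [this]
      split_ifs <;> simp
    refine (Finset.sum_congr rfl fun q _ => congrArg (· • u q l) (h1 q)).trans ?_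
    rw [Finset.sum_eq_single k _ (by simp)]
    · rw [if_pos rfl, Matrix.one_apply, Module.End.one_apply]
      by_cases h : r = j
      · subst h; simp
      · simp [h]
    · intro q _ hq; simp [hq.symm]
  have hQN : Q (toConv LinearMap.id ^ N) = 1 := by
    have hcomm : Commute (Q (toConv LinearMap.id)) T := by
      rw [commute_iff_eq, hinv, mul_eq_one_comm.1 hinv]
    calc _ = Q (toConv LinearMap.id) ^ N * T ^ N := by rw [hpow, hT, mul_one]
      _ = 1 := by rw [← hcomm.mul_pow, hinv, one_pow]
  refine withConv_ext fun n u hu k l => ?_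
  have h1 : HopfAlgebra.antipode ℂ ((toConv LinearMap.id ^ N : WithConv (A →ₗ[ℂ] A)) (u k l)) =
      if k = l then 1 else 0 := by
    refine hφ (Matrix.ext fun r j => ?_)
    have h2 := congrFun (LinearMap.congr_fun hQN (Pi.single j (u k l))) r
    rw [hQ _ hu, Module.End.one_apply] at h2
    -- Applying ε to the factor A recovers φ ∘ S of the convolution power, and both φ and S are
    -- injective.
    have h3 := congrArg (counit (R := ℂ)) h2
    simp only [map_sum, map_smul, hu.counit_apply, smul_eq_mul, mul_ite, mul_one, mul_zero,
      Finset.sum_ite_eq', Finset.mem_univ, if_true] at h3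
    rw [h3]
    by_cases hrj : r = j
    · subst hrj
      rw [Pi.single_eq_same, hu.counit_apply]
      split_ifs <;> simp
    · rw [Pi.single_eq_of_ne hrj, map_zero]
      split_ifs <;> simp [hrj]
  have h2 := congrArg (HopfAlgebra.antipode ℂ) h1
  rw [antipode_antipode] at h2
  rw [h2, convOne_corep_apply hu]
  split_ifs <;> simp [HopfAlgebra.antipode_one]

end Exponent

/-! ### Powers of the canonical element as convolution powers of the identity -/

section CanonicalElement

variable {A : Type*} [Ring A] [HopfAlgebra ℂ A]

/-- The linear map `z ↦ f z • a` attached to `a ⊗ f`. -/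
def tensorDualToEnd (A : Type*) [Ring A] [HopfAlgebra ℂ A] :
    A ⊗[ℂ] HopfDual A →ₗ[ℂ] WithConv (A →ₗ[ℂ] A) :=
  TensorProduct.lift (LinearMap.mk₂ ℂ (fun a (f : HopfDual A) => toConv (f.ofConv.smulRight a))
    (fun a a' f => WithConv.ofConv_injective (LinearMap.ext fun z => smul_add (f z) a a'))
    (fun c a f => WithConv.ofConv_injective (LinearMap.ext fun z => smul_comm (f z) c a))
    (fun a f f' => WithConv.ofConv_injective (LinearMap.ext fun z => add_smul (f z) (f' z) a))
    (fun c a f => WithConv.ofConv_injective (LinearMap.ext fun z => mul_smul c (f z) a)))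

lemma tensorDualToEnd_tmul (a : A) (f : HopfDual A) (z : A) :
    tensorDualToEnd A (a ⊗ₜ f) z = f z • a := rfl

lemma tensorDualToEnd_injective [FiniteDimensional ℂ A] :
    Function.Injective (tensorDualToEnd A) := by
  set b := Module.finBasis ℂ A
  have h : ∀ z, ∑ p, tensorDualToEnd A z (b p) ⊗ₜ[ℂ] (toConv (b.coord p) : HopfDual A) = z := by
    intro z
    induction z with
    | zero => simp
    | add x y hx hy =>
      conv_rhs => rw [← hx, ← hy]
      rw [map_add, ← Finset.sum_add_distrib]
      exact Finset.sum_congr rfl fun p _ => TensorProduct.add_tmul _ _ _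
    | tmul a f =>
      simp_rw [tensorDualToEnd_tmul, TensorProduct.smul_tmul, ← TensorProduct.tmul_sum]
      congr 1
      apply WithConv.ofConv_injective
      refine b.ext fun q => ?_
      simp
  intro x y hxy
  rw [← h x, ← h y, hxy]

lemma tensorDualToEnd_mul [FiniteDimensional ℂ A] (x y : A ⊗[ℂ] HopfDual A) :
    tensorDualToEnd A (x * y) = tensorDualToEnd A x * tensorDualToEnd A y := by
  induction x with
  | zero =>
    refine (congrArg (tensorDualToEnd A) (MulZeroClass.zero_mul y)).trans ?_
    rw [map_zero, zero_mul]
  | add x x' hx hx' =>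
    refine (congrArg (tensorDualToEnd A) (NonUnitalNonAssocSemiring.right_distrib x x' y)).trans ?_
    rw [map_add, map_add, add_mul, hx, hx']
  | tmul a f =>
    induction y with
    | zero =>
      refine (congrArg (tensorDualToEnd A) (MulZeroClass.mul_zero (a ⊗ₜ[ℂ] f))).trans ?_
      rw [map_zero, mul_zero]
    | add y y' hy hy' =>
      refine (congrArg (tensorDualToEnd A)
        (NonUnitalNonAssocSemiring.left_distrib (a ⊗ₜ[ℂ] f) y y')).trans ?_
      rw [map_add, map_add, mul_add, hy, hy']
    | tmul a' f' =>
      refine withConv_ext fun n u hu i j => ?_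
      rw [Algebra.TensorProduct.tmul_mul_tmul, hu.conv_apply]
      simp only [tensorDualToEnd_tmul, hu.conv_apply, smul_mul_smul_comm, Finset.sum_smul]

lemma tensorDualToEnd_one [FiniteDimensional ℂ A] :
    tensorDualToEnd A ((1 : A) ⊗ₜ counitDual A) = 1 := by
  refine withConv_ext fun n u hu i j => ?_
  rw [tensorDualToEnd_tmul, convOne_corep_apply hu]
  have : counitDual A (u i j) = if i = j then 1 else 0 := hu.counit_apply i j
  rw [this]
  split_ifs <;> simp

lemma tensorDualToEnd_canonicalElement {B : Type*} [Fintype B] (b : Module.Basis B ℂ A) :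
    tensorDualToEnd A (canonicalElement b) = toConv LinearMap.id := by
  apply WithConv.ofConv_injective
  refine LinearMap.ext fun z => ?_
  change tensorDualToEnd A (canonicalElement b) z = z
  have : tensorDualToEnd A (canonicalElement b) z = ∑ p, b.repr z p • b p := by
    rw [canonicalElement, map_sum, WithConv.ofConv_sum, LinearMap.sum_apply]
    rfl
  rw [this, b.sum_repr]

/-- `tensorDualToEnd` is an injective algebra map from A ⊗ A* to End(A) with convolution, and it
sends the canonical element to the identity map. -/
lemma canonicalElement_pow_eq_iff [FiniteDimensional ℂ A] {B : Type*} [Fintype B]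
    (b : Module.Basis B ℂ A) (n : ℕ) :
    canonicalElement b ^ n = (1 : A) ⊗ₜ[ℂ] counitDual A ↔
      (toConv (LinearMap.id : A →ₗ[ℂ] A)) ^ n = 1 := by
  have h : tensorDualToEnd A (canonicalElement b ^ n) = (toConv LinearMap.id) ^ n := by
    induction n with
    | zero =>
      rw [pow_zero, pow_zero, Algebra.TensorProduct.one_def]
      exact tensorDualToEnd_one
    | succ n ih => rw [pow_succ, tensorDualToEnd_mul, ih, tensorDualToEnd_canonicalElement, pow_succ]
  rw [← tensorDualToEnd_injective.eq_iff, h, tensorDualToEnd_one]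

lemma sweedlerPower_eq_counit_iff (n : ℕ) :
    (∀ z : A, sweedlerPower A n z = counit (R := ℂ) z • (1 : A)) ↔
      (toConv (LinearMap.id : A →ₗ[ℂ] A)) ^ n = 1 := by
  rw [← WithConv.ofConv_injective.eq_iff, ← sweedlerPower_eq, LinearMap.ext_iff]
  refine forall_congr' fun z => ?_
  rw [← Algebra.algebraMap_eq_smul_one]
  rfl

end CanonicalElement

/-- The least positive `η` with `id ^ η = 1` for the convolution product is the exponent. -/
theorem exists_exponent (A : Type*) [Ring A] [StarRing A] [HopfAlgebra ℂ A]
    [StarModule ℂ A] [FiniteDimensional ℂ A] [IsCStarHopfAlgebra A] :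
    ∃ η : ℕ, IsLeast {n : ℕ | 0 < n ∧ (toConv (LinearMap.id : A →ₗ[ℂ] A)) ^ n = 1} η := by
  classical
  have h := exists_sweedlerPower_eq A
  exact ⟨Nat.find h, Nat.find_spec h, fun n hn => Nat.find_min' h hn⟩

/-! ### Matrices acting on one site of a product -/

section SiteMat

variable {X ι R : Type*} [DecidableEq X] [DecidableEq ι] [Fintype X] [Semiring R]

/-- The matrix `m` acting on the site `x` of `(ℂ^ι)^{⊗ X}`. -/
def siteMat (x : X) (m : Matrix ι ι R) : Matrix (X → ι) (X → ι) R :=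
  Matrix.of fun σ τ => if Function.update σ x (τ x) = τ then m (σ x) (τ x) else 0

lemma siteMat_apply (x : X) (m : Matrix ι ι R) (σ τ : X → ι) :
    siteMat x m σ τ = if Function.update σ x (τ x) = τ then m (σ x) (τ x) else 0 := rfl

lemma siteMat_map {R' : Type*} [Semiring R'] (f : R → R') (hf : f 0 = 0) (x : X)
    (m : Matrix ι ι R) : (siteMat x m).map f = siteMat x (m.map f) := by
  ext σ τ
  simp only [Matrix.map_apply, siteMat_apply]
  split_ifs <;> simp [hf]

lemma siteMat_one (x : X) : siteMat x (1 : Matrix ι ι R) = 1 := by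
  ext σ τ
  rw [siteMat_apply, Matrix.one_apply, Matrix.one_apply]
  by_cases h : σ = τ
  · subst h; simp
  · rw [if_neg h]
    by_cases h2 : σ x = τ x
    · rw [← h2, Function.update_eq_self, if_neg h]
    · rw [if_neg h2, ite_self]

variable [Fintype ι]

lemma sum_siteMat {M : Type*} [AddCommMonoid M] (x : X) (m : Matrix ι ι R) (σ : X → ι)
    (F : (X → ι) → R → M) (hF : ∀ μ, F μ 0 = 0) :
    ∑ μ, F μ (siteMat x m σ μ) = ∑ a, F (Function.update σ x a) (m (σ x) a) := by
  symm
  refine Finset.sum_of_injOn (Function.update σ x) (Function.update_injective σ x).injOn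
    (by simp) ?_ ?_
  · intro μ _ hμ
    rw [siteMat_apply, if_neg, hF]
    exact fun h => hμ ⟨μ x, by simp, h⟩
  · intro a _
    simp [siteMat_apply]

lemma siteMat_mul_apply (x : X) (m : Matrix ι ι R) {Y : Type*} (T : Matrix (X → ι) Y R)
    (σ : X → ι) (τ : Y) :
    (siteMat x m * T) σ τ = ∑ a, m (σ x) a * T (Function.update σ x a) τ := by
  rw [Matrix.mul_apply]
  exact sum_siteMat x m σ (fun μ r => r * T μ τ) (by simp)

lemma siteMat_mul (x : X) (m m' : Matrix ι ι R) :
    siteMat x (m * m') = siteMat x m * siteMat x m' := by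
  ext σ τ
  rw [siteMat_mul_apply, siteMat_apply, Matrix.mul_apply]
  simp only [siteMat_apply, Function.update_idem, Function.update_self]
  split_ifs <;> simp

/-- Entries may lie in a noncommutative ring, so different sites alone are not enough. The entries
do commute over ℂ, and also when they lie in different legs of A ⊗ A. -/
lemma siteMat_commute {x y : X} (hxy : x ≠ y) {m m' : Matrix ι ι R}
    (h : ∀ a b c d, Commute (m a b) (m' c d)) : Commute (siteMat x m) (siteMat y m') := by
  ext σ τ
  have key : ∀ (x y : X) (m m' : Matrix ι ι R), x ≠ y → (siteMat x m * siteMat y m') σ τ =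
      ∑ a, ∑ b, m (σ x) a * m' (σ y) b *
        (1 : Matrix (X → ι) (X → ι) R) (Function.update (Function.update σ x a) y b) τ := by
    intro x y m m' hxy
    rw [← mul_one (siteMat y m'), siteMat_mul_apply]
    refine Finset.sum_congr rfl fun a _ => ?_
    rw [siteMat_mul_apply, Finset.mul_sum, Function.update_of_ne hxy.symm]
    exact Finset.sum_congr rfl fun b _ => (mul_assoc _ _ _).symm
  rw [key x y m m' hxy, key y x m' m hxy.symm, Finset.sum_comm]
  refine Finset.sum_congr rfl fun a _ => Finset.sum_congr rfl fun b _ => ?_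
  rw [(h _ _ _ _).eq, Function.update_comm hxy]

lemma siteMat_listProd_apply (m : X → Matrix ι ι R) (l : List X) (hl : l.Nodup) (σ τ : X → ι) :
    (l.map fun x => siteMat x (m x)).prod σ τ =
      if ∀ x, x ∉ l → σ x = τ x then (l.map fun x => m x (σ x) (τ x)).prod else 0 := by
  induction l generalizing σ with
  | nil => simp [Matrix.one_apply, funext_iff]
  | cons x l ih =>
    rw [List.nodup_cons] at hl
    rw [List.map_cons, List.prod_cons, siteMat_mul_apply, Finset.sum_eq_single (τ x)]
    · have h1 : (l.map fun y => m y (Function.update σ x (τ x) y) (τ y)) =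
          l.map fun y => m y (σ y) (τ y) :=
        List.map_congr_left fun y hy => by
          rw [Function.update_of_ne fun h => hl.1 (by rwa [h] at hy)]
      rw [ih hl.2, h1, List.map_cons, List.prod_cons]
      have h2 : (∀ y, y ∉ l → Function.update σ x (τ x) y = τ y) ↔
          ∀ y, y ∉ x :: l → σ y = τ y := by
        refine forall_congr' fun y => ?_
        by_cases hy : y = x
        · subst hy; simp
        · simp [hy]
      by_cases h : ∀ y, y ∉ x :: l → σ y = τ y
      · rw [if_pos h, if_pos (h2.2 h)]
      · rw [if_neg h, if_neg (fun h' => h (h2.1 h')), mul_zero]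
    · intro a _ ha
      rw [ih hl.2, if_neg, mul_zero]
      exact fun h => ha (by simpa using h x hl.1)
    · simp

/-- `siteMat` as a homomorphism of algebras. -/
def siteHom {S : Type*} [CommSemiring S] (x : X) :
    Matrix ι ι S →ₐ[S] Matrix (X → ι) (X → ι) S :=
  AlgHom.ofLinearMap
    { toFun := siteMat x
      map_add' := fun m m' => by
        ext σ τ; simp only [Matrix.add_apply, siteMat_apply]; split_ifs <;> simp
      map_smul' := fun c m => by
        ext σ τ; simp only [Matrix.smul_apply, siteMat_apply]; split_ifs <;> simp }
    (siteMat_one x) (siteMat_mul x)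

end SiteMat

/-! ### Products of representations and of corepresentations over many sites -/

section Products

variable {A : Type*} [Ring A] [HopfAlgebra ℂ A]
  {X ι κ : Type*} [Fintype X] [DecidableEq X] [Fintype ι] [DecidableEq ι] [Fintype κ]
  [DecidableEq κ]

lemma IsCorep.siteMat {v : Matrix κ κ A} (hv : IsCorep v) (x : X) : IsCorep (siteMat x v) where
  comul_apply σ τ := by
    rw [sum_siteMat x v σ (fun μ r => r ⊗ₜ[ℂ] CStarHopf.siteMat x v μ τ)
      (fun μ => TensorProduct.zero_tmul _ _)]
    simp only [siteMat_apply, Function.update_idem, Function.update_self]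
    split_ifs
    · exact hv.comul_apply _ _
    · simp
  counit_apply σ τ := by
    have h : (CStarHopf.siteMat x v).map (counit (R := ℂ)) = 1 := by
      rw [siteMat_map _ (map_zero _), ← siteMat_one x]
      congr 1
      ext i j
      rw [Matrix.map_apply, hv.counit_apply, Matrix.one_apply]
    have h2 := congrFun (congrFun h σ) τ
    rwa [Matrix.map_apply, Matrix.one_apply] at h2

lemma isCorep_one : IsCorep (1 : Matrix κ κ A) where
  comul_apply i j := by
    rw [Finset.sum_eq_single i (fun k _ hk => by rw [Matrix.one_apply_ne hk.symm,
      TensorProduct.zero_tmul]) (by simp), Matrix.one_apply_eq, Matrix.one_apply]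
    split_ifs <;> simp [Algebra.TensorProduct.one_def]
  counit_apply i j := by
    rw [Matrix.one_apply]
    split_ifs <;> simp

/-- The entries of `v`, put in the first tensor factor. -/
def leg₁ (v : Matrix κ κ A) : Matrix κ κ (A ⊗[ℂ] A) :=
  v.map (Algebra.TensorProduct.includeLeft : A →ₐ[ℂ] A ⊗[ℂ] A)

/-- The entries of `v`, put in the second tensor factor. -/
def leg₂ (v : Matrix κ κ A) : Matrix κ κ (A ⊗[ℂ] A) :=
  v.map (Algebra.TensorProduct.includeRight : A →ₐ[ℂ] A ⊗[ℂ] A)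

lemma isCorep_iff (v : Matrix κ κ A) :
    IsCorep v ↔ v.map (Bialgebra.comulAlgHom ℂ A) = leg₁ v * leg₂ v ∧
      v.map (Bialgebra.counitAlgHom ℂ A) = 1 := by
  have h1 : ∀ i j, (leg₁ v * leg₂ v) i j = ∑ k, v i k ⊗ₜ[ℂ] v k j := by
    intro i j
    simp [leg₁, leg₂, Matrix.mul_apply]
  constructor
  · rintro ⟨ha, hb⟩
    refine ⟨Matrix.ext fun i j => ?_, Matrix.ext fun i j => ?_⟩
    · rw [h1]; exact ha i j
    · rw [Matrix.one_apply]; exact hb i j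
  · rintro ⟨ha, hb⟩
    refine ⟨fun i j => ?_, fun i j => ?_⟩
    · rw [← h1, ← ha]; rfl
    · have := congrFun (congrFun hb i) j
      rwa [Matrix.one_apply] at this

/-- In leg notation Δ(vw) = v₁v₂w₁w₂ has to become v₁w₁v₂w₂. Only v₂ and w₁ must be exchanged, which
is possible for corepresentations on different sites. -/
lemma IsCorep.mul {v w : Matrix κ κ A} (hv : IsCorep v) (hw : IsCorep w)
    (h : Commute (leg₂ v) (leg₁ w)) : IsCorep (v * w) := by
  rw [isCorep_iff] at hv hw ⊢
  constructor
  · have h1 : leg₁ (v * w) = leg₁ v * leg₁ w := Matrix.map_mul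
    have h2 : leg₂ (v * w) = leg₂ v * leg₂ w := Matrix.map_mul
    rw [Matrix.map_mul, hv.1, hw.1, h1, h2, mul_assoc, ← mul_assoc (leg₂ v), h.eq, mul_assoc,
      mul_assoc]
  · rw [Matrix.map_mul, hv.2, hw.2, mul_one]

lemma IsCorep.listProd_siteMat {v : Matrix κ κ A} (hv : IsCorep v) (l : List X) (hl : l.Nodup) :
    IsCorep (l.map fun x => CStarHopf.siteMat x v).prod := by
  have hleg : ∀ (x : X) (l : List X), x ∉ l → Commute (leg₂ (CStarHopf.siteMat x v))
      (leg₁ (l.map fun x => CStarHopf.siteMat x v).prod) := by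
    intro x l hx
    have h1 : leg₁ (l.map fun x => CStarHopf.siteMat x v).prod =
        (l.map fun x => leg₁ (CStarHopf.siteMat x v)).prod := by
      have := map_list_prod
        (AlgHom.mapMatrix (Algebra.TensorProduct.includeLeft : A →ₐ[ℂ] A ⊗[ℂ] A))
        (l.map fun x => CStarHopf.siteMat x v)
      rw [List.map_map] at this
      exact this
    rw [h1]
    refine Commute.list_prod_right _ _ fun T hT => ?_
    obtain ⟨y, hy, rfl⟩ := List.mem_map.1 hT
    rw [leg₁, leg₂, siteMat_map _ (map_zero _), siteMat_map _ (map_zero _)]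
    refine siteMat_commute (x := x) (y := y) (fun h => hx (h ▸ hy)) fun a b c d => ?_
    simp [Commute, SemiconjBy, Algebra.TensorProduct.tmul_mul_tmul]
  induction l with
  | nil => exact isCorep_one
  | cons x l ih =>
    rw [List.nodup_cons] at hl
    rw [List.map_cons, List.prod_cons]
    exact (hv.siteMat x).mul (ih hl.2) (hleg x l hl.1)

/-- A matrix over `A*` as a linear map from `A` to matrices. -/
def matToConv (F : Matrix ι ι (HopfDual A)) : WithConv (A →ₗ[ℂ] Matrix ι ι ℂ) :=
  toConv
    { toFun := fun a => Matrix.of fun i j => F i j a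
      map_add' := fun a b => by ext i j; exact map_add (F i j).ofConv a b
      map_smul' := fun c a => by ext i j; exact map_smul (F i j).ofConv c a }

omit [Fintype ι] [DecidableEq ι] in
lemma matToConv_apply (F : Matrix ι ι (HopfDual A)) (a : A) (i j : ι) :
    matToConv F a i j = F i j a := rfl

lemma withConv_sum_apply {M S : Type*} [AddCommGroup M] [Module ℂ M] (s : Finset S)
    (f : S → WithConv (A →ₗ[ℂ] M)) (a : A) : (∑ i ∈ s, f i) a = ∑ i ∈ s, f i a := by
  have : (∑ i ∈ s, f i).ofConv = ∑ i ∈ s, (f i).ofConv := WithConv.ofConv_sum ..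
  change (∑ i ∈ s, f i).ofConv a = _
  rw [this, LinearMap.sum_apply]

lemma matToConv_mul [FiniteDimensional ℂ A] (F G : Matrix ι ι (HopfDual A)) :
    matToConv (F * G) = matToConv F * matToConv G := by
  refine withConv_ext fun n u hu p q => ?_
  ext i j
  simp only [matToConv_apply, Matrix.mul_apply, hu.conv_apply, Matrix.sum_apply,
    withConv_sum_apply]
  exact Finset.sum_comm

lemma matToConv_one [FiniteDimensional ℂ A] :
    matToConv (1 : Matrix ι ι (HopfDual A)) = 1 := by
  refine withConv_ext fun n u hu p q => ?_
  ext i j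
  rw [matToConv_apply, convOne_corep_apply hu, Matrix.one_apply]
  by_cases h : i = j
  · subst h
    rw [if_pos rfl, convOne_corep_apply hu]
    split_ifs <;> simp
  · rw [if_neg h]
    change (0 : ℂ) = _
    split_ifs <;> simp [h]

/-- The matrix over `A*` of a representation. -/
def repMat (ρ : A →ₗ[ℂ] Matrix ι ι ℂ) : Matrix ι ι (HopfDual A) :=
  Matrix.of fun i j => toConv (coeff ρ i j)

/-- The representation `ρ` acting on the site `x`. -/
def siteRep (ρ : A →ₐ[ℂ] Matrix ι ι ℂ) (x : X) : A →ₐ[ℂ] Matrix (X → ι) (X → ι) ℂ :=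
  (siteHom x).comp ρ

lemma siteRep_apply (ρ : A →ₐ[ℂ] Matrix ι ι ℂ) (x : X) (a : A) :
    siteRep ρ x a = siteMat x (ρ a) := rfl

lemma matToConv_siteMat (ρ : A →ₐ[ℂ] Matrix ι ι ℂ) (x : X) :
    matToConv (siteMat x (repMat ρ.toLinearMap)) = toConv (siteRep ρ x).toLinearMap := by
  apply WithConv.ofConv_injective
  refine LinearMap.ext fun a => ?_
  ext σ τ
  change siteMat x (repMat ρ.toLinearMap) σ τ a = siteMat x (ρ a) σ τ
  rw [siteMat_apply, siteMat_apply]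
  split_ifs <;> rfl

/-- The convolution product of the representations at the sites in a list. -/
def listRep (ρ : A →ₐ[ℂ] Matrix ι ι ℂ) (l : List X) :
    WithConv (A →ₗ[ℂ] Matrix (X → ι) (X → ι) ℂ) :=
  (l.map fun x => toConv (siteRep ρ x).toLinearMap).prod

/-- The product of the corepresentations at the sites in a list. -/
def listCorep (v : Matrix κ κ A) (l : List X) : Matrix (X → κ) (X → κ) A :=
  (l.map fun x => siteMat x v).prod

lemma listRep_apply [FiniteDimensional ℂ A] (ρ : A →ₐ[ℂ] Matrix ι ι ℂ) (l : List X) (hl : l.Nodup)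
    (a : A) (σ τ : X → ι) :
    listRep ρ l a σ τ = if ∀ x, x ∉ l → σ x = τ x then
      (l.map fun x => repMat ρ.toLinearMap (σ x) (τ x)).prod a else 0 := by
  have h : ∀ l : List X, listRep ρ l =
      matToConv (l.map fun x => siteMat x (repMat ρ.toLinearMap)).prod := by
    intro l
    induction l with
    | nil => exact matToConv_one.symm
    | cons x l ih =>
      rw [listRep, List.map_cons, List.prod_cons, List.map_cons, List.prod_cons, matToConv_mul,
        ← ih, matToConv_siteMat, listRep]
  rw [h, matToConv_apply, siteMat_listProd_apply _ _ hl]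
  split_ifs <;> rfl

omit [HopfAlgebra ℂ A] in
lemma listCorep_apply (v : Matrix κ κ A) (l : List X) (hl : l.Nodup) (σ τ : X → κ) :
    listCorep v l σ τ = if ∀ x, x ∉ l → σ x = τ x then
      (l.map fun x => v (σ x) (τ x)).prod else 0 :=
  siteMat_listProd_apply _ _ hl σ τ

lemma listCorep_isCorep {v : Matrix κ κ A} (hv : IsCorep v) (l : List X) (hl : l.Nodup) :
    IsCorep (listCorep v l) := hv.listProd_siteMat l hl

lemma siteRep_commute (ρ : A →ₐ[ℂ] Matrix ι ι ℂ) {x y : X} (h : x ≠ y) (a b : A) :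
    Commute (siteRep ρ x a) (siteRep ρ y b) :=
  siteMat_commute h fun _ _ _ _ => Commute.all _ _

/-- A convolution product of algebra maps is an algebra map only if they commute. The second
conclusion carries this through the induction. -/
lemma exists_algHom_listRep (ρ : A →ₐ[ℂ] Matrix ι ι ℂ) (l : List X) (hl : l.Nodup) :
    ∃ Φ : A →ₐ[ℂ] Matrix (X → ι) (X → ι) ℂ, toConv Φ.toLinearMap = listRep ρ l ∧
      ∀ T, (∀ x ∈ l, ∀ a, Commute T (siteRep ρ x a)) → ∀ a, Commute T (Φ a) := by
  induction l with
  | nil =>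
    refine ⟨(Algebra.ofId ℂ _).comp (Bialgebra.counitAlgHom ℂ A), rfl, fun T _ a => ?_⟩
    exact (Algebra.commutes (counit (R := ℂ) a) T).symm
  | cons x l ih =>
    rw [List.nodup_cons] at hl
    obtain ⟨Φ, hΦ, hc⟩ := ih hl.2
    have h : ∀ a b, Commute (siteRep ρ x a) (Φ b) := fun a b =>
      hc _ (fun y hy a' => siteRep_commute ρ (x := x) (y := y) (fun e => hl.1 (e ▸ hy)) _ _) b
    refine ⟨convAlgHom (siteRep ρ x) Φ h, ?_, fun T hT a => ?_⟩
    · rw [toConv_convAlgHom, hΦ, listRep, listRep, List.map_cons, List.prod_cons]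
    · rw [convAlgHom, AlgHom.comp_apply, Bialgebra.comulAlgHom_apply]
      induction (comul a : A ⊗[ℂ] A) with
      | zero => simp
      | add y z hy hz => rw [map_add]; exact hy.add_right hz
      | tmul y z =>
        rw [Algebra.TensorProduct.lift_tmul]
        exact (hT x List.mem_cons_self y).mul_right
          (hc T (fun y hy => hT y (List.mem_cons_of_mem _ hy)) z)

end Products

/-! ### Ordered products of partially commuting elements -/

section OrderedProduct

/-- The head x of the first list can be pulled to the front of the second: each y standing before it
there is related to x both ways, hence commutes with it. -/
lemma listProd_eq_of_perm {P M : Type*} [Monoid M] (c : P → M) {r : P → P → Prop} {l₁ l₂ : List P}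
    (h : l₁.Perm l₂) (h₁ : l₁.Pairwise r) (h₂ : l₂.Pairwise r)
    (hc : ∀ x y, r x y → r y x → Commute (c x) (c y)) : (l₁.map c).prod = (l₂.map c).prod := by
  induction l₁ generalizing l₂ with
  | nil => rw [h.nil_eq]
  | cons x l₁ ih =>
    obtain ⟨u, w, rfl⟩ := List.append_of_mem (h.subset List.mem_cons_self)
    have hp : l₁.Perm (u ++ w) := (List.perm_cons x).1 (h.trans List.perm_middle)
    rw [List.pairwise_cons] at h₁
    have hsub : (u ++ w).Pairwise r := h₂.sublist (by simp)
    have hcomm : Commute ((u.map c).prod) (c x) := by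
      refine Commute.list_prod_left _ _ fun T hT => ?_
      obtain ⟨y, hy, rfl⟩ := List.mem_map.1 hT
      refine hc y x ?_ ?_
      · rw [List.pairwise_append] at h₂
        exact h₂.2.2 y hy x List.mem_cons_self
      · exact h₁.1 y (hp.symm.subset (List.mem_append_left _ hy))
    rw [List.map_cons, List.prod_cons, ih hp h₁.2 hsub, List.map_append, List.prod_append,
      List.map_append, List.prod_append, List.map_cons, List.prod_cons, ← mul_assoc, ← mul_assoc,
      hcomm.eq]

variable {L : ℕ}

/-- The order in which gates on overlapping pairs of sites are applied. -/
def gateOrder (x y : Fin L × Fin L) : Prop :=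
  (x.1 = y.1 → y.2 < x.2) ∧ (x.2 = y.2 → x.1 < y.1)

/-- All pairs in `I × J`, the second index running fastest to the left. -/
def pairList (lI lJ : List (Fin L)) : List (Fin L × Fin L) :=
  lJ.flatMap fun j => lI.map fun i => (i, j)

lemma mem_pairList {lI lJ : List (Fin L)} {x : Fin L × Fin L} :
    x ∈ pairList lI lJ ↔ x.1 ∈ lI ∧ x.2 ∈ lJ := by
  obtain ⟨i, j⟩ := x
  simp [pairList, and_comm]

lemma pairList_filter (lI lJ : List (Fin L)) (p q : Fin L → Prop) [DecidablePred p]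
    [DecidablePred q] :
    (pairList lI lJ).filter (fun x => p x.1 ∧ q x.2) =
      pairList (lI.filter (p ·)) (lJ.filter (q ·)) := by
  induction lJ with
  | nil => rfl
  | cons j lJ ih =>
    rw [pairList, List.flatMap_cons, List.filter_append]
    change _ ++ (pairList lI lJ).filter _ = _
    rw [ih, List.filter_map]
    by_cases hj : q j
    · rw [List.filter_cons_of_pos (by simpa using hj)]
      simp [pairList, Function.comp_def, hj]
    · rw [List.filter_cons_of_neg (by simpa using hj)]
      simp [pairList, Function.comp_def, hj]

lemma pairList_pairwise {lI lJ : List (Fin L)} (hI : lI.Pairwise (· < ·))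
    (hJ : lJ.Pairwise (· > ·)) : (pairList lI lJ).Pairwise gateOrder := by
  rw [pairList, List.pairwise_flatMap]
  refine ⟨fun j _ => ?_, hJ.imp fun {j j'} h x hx y hy => ?_⟩
  · rw [List.pairwise_map]
    exact hI.imp fun h => ⟨fun h' => absurd h' h.ne, fun _ => h⟩
  · obtain ⟨i, _, rfl⟩ := List.mem_map.1 hx
    obtain ⟨i', _, rfl⟩ := List.mem_map.1 hy
    exact ⟨fun _ => h, fun h' => absurd h' (ne_of_gt h)⟩

variable (L) in
/-- All pairs of sites in the gate order. -/
def allPairs : List (Fin L × Fin L) := pairList (List.finRange L) (List.finRange L).reverse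

lemma mem_allPairs (x : Fin L × Fin L) : x ∈ allPairs L := by
  simp [allPairs, mem_pairList]

lemma allPairs_pairwise : (allPairs L).Pairwise gateOrder :=
  pairList_pairwise (List.pairwise_lt_finRange L)
    (List.pairwise_reverse.2 (List.pairwise_lt_finRange L))

lemma gateOrder_ne {x y : Fin L × Fin L} (h : gateOrder x y) : x ≠ y := by
  rintro rfl
  exact lt_irrefl _ (h.1 rfl)

lemma allPairs_nodup : (allPairs L).Nodup := allPairs_pairwise.imp gateOrder_ne

variable {M : Type*} [Monoid M] (c : Fin L × Fin L → M)

/-- The product of the gates on the pairs satisfying `p`, in the gate order. -/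
def gateProd (p : Fin L × Fin L → Prop) : M := by
  classical exact (((allPairs L).filter (p ·)).map c).prod

lemma gateProd_eq (p : Fin L × Fin L → Prop) [DecidablePred p] :
    gateProd c p = (((allPairs L).filter (p ·)).map c).prod := by
  rw [gateProd]
  congr!

variable {c}

/-- `gateOrder` constrains only pairs sharing a site, so the q-part may be moved to the left
whenever no such constraint is violated. -/
lemma gateProd_split (hc : ∀ x y : Fin L × Fin L, x.1 ≠ y.1 → x.2 ≠ y.2 → Commute (c x) (c y))
    (p q : Fin L × Fin L → Prop)
    (h : ∀ x y, p x → q x → p y → ¬ q y → gateOrder x y) :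
    gateProd c p = gateProd c (fun x => p x ∧ q x) * gateProd c (fun x => p x ∧ ¬ q x) := by
  classical
  rw [gateProd, gateProd, gateProd, ← List.prod_append, ← List.map_append]
  refine listProd_eq_of_perm c (r := gateOrder) ?_ (allPairs_pairwise.filter _) ?_ ?_
  · refine (List.perm_ext_iff_of_nodup (allPairs_nodup.filter _) ?_).2 fun x => ?_
    · rw [List.nodup_append]
      refine ⟨allPairs_nodup.filter _, allPairs_nodup.filter _, fun x hx y hy => ?_⟩
      rintro rfl
      simp only [List.mem_filter, decide_eq_true_eq] at hx hy
      exact hy.2.2 hx.2.2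
    · simp only [List.mem_append, List.mem_filter, decide_eq_true_eq, mem_allPairs, true_and]
      tauto
  · rw [List.pairwise_append]
    refine ⟨allPairs_pairwise.filter _, allPairs_pairwise.filter _, fun x hx y hy => ?_⟩
    simp only [List.mem_filter, decide_eq_true_eq, mem_allPairs, true_and] at hx hy
    exact h x y hx.1 hx.2 hy.1 hy.2
  · intro x y hxy hyx
    exact hc x y (fun h => lt_asymm (hxy.1 h) (hyx.1 h.symm))
      (fun h => lt_asymm (hxy.2 h) (hyx.2 h.symm))

end OrderedProduct

/-! ### Gates -/

section Gate

variable {A : Type*} [Ring A] [HopfAlgebra ℂ A]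
  {I K : Type*} [Fintype I] [DecidableEq I] [Fintype K] [DecidableEq K]

lemma algHom_mul_comp_antipode [FiniteDimensional ℂ A] {M : Type*} [Ring M] [Algebra ℂ M]
    (Φ : A →ₐ[ℂ] M) : (toConv Φ.toLinearMap) *
      toConv (Φ.toLinearMap ∘ₗ HopfAlgebra.antipode ℂ) = 1 := by
  refine withConv_ext fun n u hu p q => ?_
  rw [hu.conv_apply, convOne_corep_apply hu]
  have := congrArg Φ (hu.sum_mul_antipode p q)
  simp only [map_sum, map_mul] at this
  refine this.trans ?_
  split_ifs <;> simp

lemma fuse_mul_fuse_antipode [FiniteDimensional ℂ A] (Φ : A →ₐ[ℂ] Matrix I I ℂ)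
    {V : Matrix K K A} (hV : IsCorep V) :
    fuse Φ.toLinearMap V * fuse (Φ.toLinearMap ∘ₗ HopfAlgebra.antipode ℂ) V = 1 := by
  have := fuse_conv hV (toConv Φ.toLinearMap) (toConv (Φ.toLinearMap ∘ₗ HopfAlgebra.antipode ℂ))
  rw [algHom_mul_comp_antipode, fuse_conv_one hV] at this
  exact this.symm

lemma toConv_comp_pow [FiniteDimensional ℂ A] {M : Type*} [Ring M] [Algebra ℂ M]
    (Φ : A →ₐ[ℂ] M) (k : ℕ) : (toConv Φ.toLinearMap) ^ k =
      toConv (Φ.toLinearMap ∘ₗ sweedlerPower A k) := by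
  rw [sweedlerPower_eq]
  induction k with
  | zero =>
    refine withConv_ext fun n u hu p q => ?_
    rw [pow_zero, pow_zero, convOne_corep_apply hu]
    change _ = Φ ((1 : WithConv (A →ₗ[ℂ] A)) (u p q))
    rw [convOne_corep_apply hu]
    split_ifs <;> simp
  | succ k ih =>
    refine withConv_ext fun n u hu p q => ?_
    rw [pow_succ, ih, hu.conv_apply]
    change _ = Φ (((toConv (LinearMap.id : A →ₗ[ℂ] A)) ^ (k + 1)) (u p q))
    rw [pow_succ, hu.conv_apply, map_sum]
    simp_rw [map_mul]
    rfl

/-- For a fixed corepresentation V, `fuse` turns convolution into operator products, and for an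
algebra map the convolution powers of Φ are Φ composed with Sweedler powers. -/
lemma fuse_pow [FiniteDimensional ℂ A] (Φ : A →ₐ[ℂ] Matrix I I ℂ) {V : Matrix K K A}
    (hV : IsCorep V) (k : ℕ) : fuse Φ.toLinearMap V ^ k =
      fuse (Φ.toLinearMap ∘ₗ sweedlerPower A k) V := by
  have h : fuse ((toConv Φ.toLinearMap) ^ k).ofConv V = fuse Φ.toLinearMap V ^ k := by
    induction k with
    | zero => rw [pow_zero, pow_zero, fuse_conv_one hV]
    | succ k ih => rw [pow_succ, fuse_conv hV, ih, pow_succ]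
  rw [← h, toConv_comp_pow]

variable {L : ℕ} {ι κ : Type*} [Fintype ι] [DecidableEq ι] [Fintype κ] [DecidableEq κ]

/-- The gate on the `ρ`-site `x.1` and the `v`-site `x.2`. -/
def gate (ρ : A →ₐ[ℂ] Matrix ι ι ℂ) (v : Matrix κ κ A) (x : Fin L × Fin L) :
    Matrix (RingConfig L ι κ) (RingConfig L ι κ) ℂ :=
  fuse (siteRep ρ x.1).toLinearMap (siteMat x.2 v)

variable (ρ : A →ₐ[ℂ] Matrix ι ι ℂ) (v : Matrix κ κ A)

omit [Fintype κ] in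
lemma gate_apply (x : Fin L × Fin L) (s t : RingConfig L ι κ) : gate ρ v x s t =
    if Function.update s.1 x.1 (t.1 x.1) = t.1 ∧ Function.update s.2 x.2 (t.2 x.2) = t.2 then
      ρ (v (s.2 x.2) (t.2 x.2)) (s.1 x.1) (t.1 x.1) else 0 := by
  rw [gate, fuse_apply, siteMat_apply, AlgHom.toLinearMap_apply, siteRep_apply]
  by_cases h : Function.update s.2 x.2 (t.2 x.2) = t.2
  · rw [if_pos h, siteMat_apply]
    simp only [h, and_true]
  · rw [if_neg h, map_zero, if_neg fun h' => h h'.2, siteMat_apply]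
    simp

lemma gate_mul_apply (x : Fin L × Fin L) {Y : Type*} (T : Matrix (RingConfig L ι κ) Y ℂ)
    (s : RingConfig L ι κ) (t : Y) : (gate ρ v x * T) s t =
      ∑ p : ι × κ, ρ (v (s.2 x.2) p.2) (s.1 x.1) p.1 *
        T (Function.update s.1 x.1 p.1, Function.update s.2 x.2 p.2) t := by
  rw [Matrix.mul_apply, Fintype.sum_prod_type, Finset.sum_comm, Fintype.sum_prod_type]
  have h1 : ∀ μ r, ∑ τ, siteRep ρ x.1 r s.1 τ * T (τ, μ) t =
      ∑ a, ρ r (s.1 x.1) a * T (Function.update s.1 x.1 a, μ) t := fun μ r =>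
    sum_siteMat x.1 (ρ r) s.1 (fun τ z => z * T (τ, μ) t) (by simp)
  have h2 := sum_siteMat x.2 v s.2
    (fun μ r => ∑ τ, siteRep ρ x.1 r s.1 τ * T (τ, μ) t) (by simp)
  refine h2.trans ?_
  simp only [h1]
  exact Finset.sum_comm

lemma gate_commute {x y : Fin L × Fin L} (h1 : x.1 ≠ y.1) (h2 : x.2 ≠ y.2) :
    Commute (gate ρ v x) (gate ρ v y) := by
  have key : ∀ x y : Fin L × Fin L, x.1 ≠ y.1 → x.2 ≠ y.2 → ∀ s t,
      (gate ρ v x * gate ρ v y) s t = ∑ p : ι × κ, ∑ q : ι × κ,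
        ρ (v (s.2 x.2) p.2) (s.1 x.1) p.1 * ρ (v (s.2 y.2) q.2) (s.1 y.1) q.1 *
          (1 : Matrix (RingConfig L ι κ) (RingConfig L ι κ) ℂ)
            (Function.update (Function.update s.1 x.1 p.1) y.1 q.1,
              Function.update (Function.update s.2 x.2 p.2) y.2 q.2) t := by
    intro x y h1 h2 s t
    rw [← mul_one (gate ρ v y), gate_mul_apply]
    simp only [gate_mul_apply, Finset.mul_sum, Function.update_of_ne h1.symm,
      Function.update_of_ne h2.symm, mul_assoc]
  ext s t
  rw [key x y h1 h2, key y x h1.symm h2.symm, Finset.sum_comm]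
  refine Finset.sum_congr rfl fun p _ => Finset.sum_congr rfl fun q _ => ?_
  rw [mul_comm (ρ _ _ _), Function.update_comm h1, Function.update_comm h2]

omit [Fintype ι] [DecidableEq ι] in
lemma forall_update_eq_iff (i : Fin L) (m : List (Fin L)) (σ τ : Fin L → ι) :
    (∀ k, k ∉ m → Function.update σ i (τ i) k = τ k) ↔ ∀ k, k ∉ i :: m → σ k = τ k := by
  refine forall_congr' fun k => ?_
  by_cases hk : k = i
  · subst hk; simp
  · simp [hk]

/-- The product of gates on disjoint pairs of sites, entry by entry. -/
lemma gate_listProd_apply (l : List (Fin L × Fin L)) (h1 : (l.map Prod.fst).Nodup)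
    (h2 : (l.map Prod.snd).Nodup) (s t : RingConfig L ι κ) : (l.map (gate ρ v)).prod s t =
      if (∀ i, i ∉ l.map Prod.fst → s.1 i = t.1 i) ∧ (∀ j, j ∉ l.map Prod.snd → s.2 j = t.2 j) then
        (l.map fun x => ρ (v (s.2 x.2) (t.2 x.2)) (s.1 x.1) (t.1 x.1)).prod else 0 := by
  induction l generalizing s with
  | nil => simp [Matrix.one_apply, Prod.ext_iff, funext_iff]
  | cons x l ih =>
    simp only [List.map_cons, List.nodup_cons] at h1 h2
    have hupd := forall_update_eq_iff x.1 (l.map Prod.fst) s.1 t.1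
    have hupd2 := forall_update_eq_iff x.2 (l.map Prod.snd) s.2 t.2
    have h3 : (l.map fun y => ρ (v (Function.update s.2 x.2 (t.2 x.2) y.2) (t.2 y.2))
        (Function.update s.1 x.1 (t.1 x.1) y.1) (t.1 y.1)) =
        l.map fun y => ρ (v (s.2 y.2) (t.2 y.2)) (s.1 y.1) (t.1 y.1) :=
      List.map_congr_left fun y hy => by
        rw [Function.update_of_ne (fun h : y.2 = x.2 => h2.1 (h ▸ List.mem_map_of_mem hy)),
          Function.update_of_ne (fun h : y.1 = x.1 => h1.1 (h ▸ List.mem_map_of_mem hy))]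
    rw [List.map_cons, List.prod_cons, gate_mul_apply,
      Finset.sum_eq_single (t.1 x.1, t.2 x.2)]
    · rw [ih h1.2 h2.2, h3]
      simp only [hupd, hupd2, List.map_cons, List.prod_cons]
      rw [mul_ite, mul_zero]
    · intro p _ hp
      rw [ih h1.2 h2.2, if_neg, mul_zero]
      refine fun h => hp (Prod.ext ?_ ?_)
      · simpa using h.1 x.1 h1.1
      · simpa using h.2 x.2 h2.1
    · simp

variable {v}

/-- For fixed j the gates multiply by convolving the representations (`fuse_conv`). The result is
again an algebra map, so different j multiply as matrices over A (`fuse_mul`). -/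
lemma pairList_gate_prod [FiniteDimensional ℂ A] (hv : IsCorep v) (lI lJ : List (Fin L))
    (hI : lI.Nodup) : ((pairList lI lJ).map (gate ρ v)).prod =
      fuse (listRep ρ lI).ofConv (listCorep v lJ) := by
  obtain ⟨Φ, hΦ, -⟩ := exists_algHom_listRep ρ lI hI
  have hΦ' : (listRep ρ lI).ofConv = Φ.toLinearMap := by rw [← hΦ]
  induction lJ with
  | nil =>
    rw [hΦ']
    exact (fuse_one Φ).symm
  | cons j lJ ih =>
    have h1 : ∀ lI : List (Fin L), ((lI.map fun i => (i, j)).map (gate ρ v)).prod =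
        fuse (listRep ρ lI).ofConv (siteMat j v) := by
      intro lI
      induction lI with
      | nil => exact (fuse_conv_one (hv.siteMat j)).symm
      | cons i lI ih =>
        have h2 : listRep ρ (i :: lI) = toConv (siteRep ρ i).toLinearMap * listRep ρ lI := by
          rw [listRep, List.map_cons, List.prod_cons, listRep]
        rw [List.map_cons, List.map_cons, List.prod_cons, ih, h2, fuse_conv (hv.siteMat j)]
        rfl
    rw [pairList, List.flatMap_cons, List.map_append, List.prod_append, h1]
    change _ * ((pairList lI lJ).map (gate ρ v)).prod = _
    rw [ih, hΦ', ← fuse_mul, listCorep, listCorep, List.map_cons, List.prod_cons]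

lemma gateProd_rect [FiniteDimensional ℂ A] (hv : IsCorep v) (p q : Fin L → Prop)
    [DecidablePred p] [DecidablePred q] : gateProd (gate ρ v) (fun x => p x.1 ∧ q x.2) =
      fuse (listRep ρ ((List.finRange L).filter (p ·))).ofConv
        (listCorep v ((List.finRange L).reverse.filter (q ·))) := by
  classical
  rw [← pairList_gate_prod ρ hv _ _ ((List.nodup_finRange L).filter _), ← pairList_filter, gateProd_eq]
  congr!

end Gate

/-! ### Layers of the circuit -/

section Layer

variable {A : Type*} [Ring A] [HopfAlgebra ℂ A] {L : ℕ} [NeZero L]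
  {ι κ : Type*} [Fintype ι] [DecidableEq ι] [Fintype κ] [DecidableEq κ]

/-- The layer of gates on the pairs `(i, i + k)`. -/
def layer (ρ : A →ₐ[ℂ] Matrix ι ι ℂ) (v : Matrix κ κ A) (k : Fin L) :
    Matrix (RingConfig L ι κ) (RingConfig L ι κ) ℂ :=
  ((List.finRange L).map fun i => gate ρ v (i, i + k)).prod

/-- The product of the first `n` layers. -/
def layers (L : ℕ) [NeZero L] (ρ : A →ₐ[ℂ] Matrix ι ι ℂ) (v : Matrix κ κ A) :
    ℕ → Matrix (RingConfig L ι κ) (RingConfig L ι κ) ℂ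
  | 0 => 1
  | n + 1 => layer ρ v (Fin.ofNat L n) * layers L ρ v n

variable (ρ : A →ₐ[ℂ] Matrix ι ι ℂ) (v : Matrix κ κ A)

lemma layer_apply (k : Fin L) (s t : RingConfig L ι κ) : layer ρ v k s t =
    ∏ i, ρ (v (s.2 (i + k)) (t.2 (i + k))) (s.1 i) (t.1 i) := by
  have h1 : (((List.finRange L).map fun i => (i, i + k)).map Prod.fst).Nodup := by
    simpa [Function.comp_def] using List.nodup_finRange L
  have h2 : (((List.finRange L).map fun i => (i, i + k)).map Prod.snd).Nodup := by
    rw [List.map_map]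
    exact (List.nodup_finRange L).map (add_left_injective k)
  have h := gate_listProd_apply ρ v _ h1 h2 s t
  rw [List.map_map, if_pos] at h
  · rw [layer]
    refine h.trans ?_
    rw [List.map_map, ← List.ofFn_eq_map, List.prod_ofFn]
    rfl
  · constructor
    · intro i hi; simp at hi
    · intro j hj
      refine absurd ?_ hj
      simp only [List.map_map, List.mem_map, List.mem_finRange, true_and, Function.comp_apply]
      exact ⟨j - k, by simp⟩

/-- Translation of the `ρ`-sites by `k` cells and of the `v`-sites by `-k` cells. -/
def shift (L : ℕ) [NeZero L] (ι κ : Type*) (k : Fin L) :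
    RingConfig L ι κ ≃ RingConfig L ι κ where
  toFun s := (fun x => s.1 (x + k), fun x => s.2 (x - k))
  invFun s := (fun x => s.1 (x - k), fun x => s.2 (x + k))
  left_inv s := by simp
  right_inv s := by simp

omit [Fintype ι] [DecidableEq ι] [Fintype κ] [DecidableEq κ] in
lemma shift_shift (j k : Fin L) (s : RingConfig L ι κ) :
    shift L ι κ j (shift L ι κ k s) = shift L ι κ (j + k) s := by
  simp only [shift, Equiv.coe_fn_mk, add_assoc, sub_sub]

omit [Fintype ι] [DecidableEq ι] [Fintype κ] [DecidableEq κ] in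
lemma shift_zero (s : RingConfig L ι κ) : shift L ι κ 0 s = s := by
  simp [shift]

/-- Moving ρ-sites and v-sites by j cells in opposite directions changes their relative distance by
2j. -/
lemma layer_submatrix_shift (j k : Fin L) :
    (layer ρ v (k + (j + j))).submatrix (shift L ι κ j) (shift L ι κ j) = layer ρ v k := by
  ext s t
  rw [Matrix.submatrix_apply, layer_apply, layer_apply]
  rw [← Equiv.prod_comp (Equiv.addRight j)
    (fun i => ρ (v (s.2 (i + k)) (t.2 (i + k))) (s.1 i) (t.1 i))]
  refine Finset.prod_congr rfl fun i _ => ?_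
  have h : i + (k + (j + j)) - j = i + j + k := by abel
  simp only [shift, Equiv.coe_fn_mk, Equiv.coe_addRight, h]

lemma ofNat_add (a b : ℕ) : Fin.ofNat L (a + b) = Fin.ofNat L a + Fin.ofNat L b := by
  ext; simp [Fin.val_add]

lemma layers_add_mul (n k : ℕ) :
    layers L ρ v (n + k * L) = layers L ρ v n * layers L ρ v L ^ k := by
  have h1 : ∀ n, layers L ρ v (n + L) = layers L ρ v n * layers L ρ v L := by
    intro n
    induction n with
    | zero => rw [zero_add, layers, one_mul]
    | succ n ih =>
      have : Fin.ofNat L (n + L) = Fin.ofNat L n := by ext; simp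
      rw [show n + 1 + L = (n + L) + 1 by ring, layers, ih, layers, this, mul_assoc]
  induction k with
  | zero => simp
  | succ k ih =>
    rw [show n + (k + 1) * L = (n + k * L) + L by ring, h1, ih, pow_succ, mul_assoc]

lemma layers_comm_shift (n t : ℕ) :
    (layer ρ v (Fin.ofNat L (n + 2 * t))).submatrix (shift L ι κ (Fin.ofNat L t))
      (shift L ι κ (Fin.ofNat L t)) = layer ρ v (Fin.ofNat L n) := by
  rw [two_mul, ofNat_add, ofNat_add, layer_submatrix_shift]

end Layer

section Floquet

variable {A : Type*} [Ring A] [StarRing A] [HopfAlgebra ℂ A] [StarModule ℂ A] {L : ℕ} [NeZero L]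
  {ι κ : Type*} [Fintype ι] [DecidableEq ι] [Fintype κ] [DecidableEq κ]
  (ρ : A →⋆ₐ[ℂ] Matrix ι ι ℂ) (v : κ → κ → A)

omit [StarModule ℂ A] in
lemma oddLayer_eq : oddLayer L ρ v =
    (layer ρ.toAlgHom (Matrix.of v) 0).submatrix (Equiv.prodComm _ _) (Equiv.refl _) := by
  ext out inp
  rw [Matrix.submatrix_apply, layer_apply]
  simp only [add_zero]
  rfl

omit [StarModule ℂ A] in
lemma evenLayer_eq : evenLayer L ρ v =
    (layer ρ.toAlgHom (Matrix.of v) (Fin.ofNat L 1)).submatrix (shift L ι κ (Fin.ofNat L 1))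
      (Equiv.prodComm _ _) := by
  have h1 : (Fin.ofNat L 1 : Fin L) = 1 := rfl
  ext out inp
  rw [Matrix.submatrix_apply, layer_apply, h1]
  simp only [shift, Equiv.coe_fn_mk, add_sub_cancel_right]
  rfl

/-- One period is two layers followed by a relative shift. Collecting the shifts at the end raises
the layer index by 2 per period, which yields consecutive layers. -/
lemma floquet_pow (t : ℕ) : floquet L ρ v ^ t =
    (layers L ρ.toAlgHom (Matrix.of v) (2 * t)).submatrix (shift L ι κ (Fin.ofNat L t))
      (Equiv.refl _) := by
  have h0 : floquet L ρ v = (layer ρ.toAlgHom (Matrix.of v) (Fin.ofNat L 1) *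
      layer ρ.toAlgHom (Matrix.of v) (Fin.ofNat L 0)).submatrix (shift L ι κ (Fin.ofNat L 1))
        (Equiv.refl _) := by
    rw [floquet, oddLayer_eq, evenLayer_eq, Matrix.submatrix_mul_equiv]
    rfl
  induction t with
  | zero =>
    rw [pow_zero, mul_zero, layers]
    ext s t
    have : (Fin.ofNat L 0 : Fin L) = 0 := by ext; simp
    rw [this, Matrix.submatrix_apply, shift_zero]
    rfl
  | succ t ih =>
    rw [pow_succ', ih, h0, ← layers_comm_shift _ _ 1 t, ← layers_comm_shift _ _ 0 t,
      Matrix.submatrix_mul_equiv, Matrix.submatrix_submatrix]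
    have h2 : (⇑(shift L ι κ (Fin.ofNat L t)) ∘ ⇑(Equiv.refl (RingConfig L ι κ))) =
      ⇑(shift L ι κ (Fin.ofNat L t)) := rfl
    have h3 : (⇑(shift L ι κ (Fin.ofNat L t)) ∘ ⇑(shift L ι κ (Fin.ofNat L 1))) =
      ⇑(shift L ι κ (Fin.ofNat L (t + 1))) := by
      funext s
      rw [Function.comp_apply, shift_shift, ofNat_add]
    rw [h2, h3, Matrix.submatrix_mul_equiv, show 2 * (t + 1) = (2 * t + 1) + 1 by ring, layers,
      layers, mul_assoc, zero_add, show 1 + 2 * t = 2 * t + 1 by ring]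

lemma oddLayer_mul_floquet_pow (t : ℕ) : oddLayer L ρ v * floquet L ρ v ^ t =
    (layers L ρ.toAlgHom (Matrix.of v) (2 * t + 1)).submatrix
      (fun out => shift L ι κ (Fin.ofNat L t) out.swap) (Equiv.refl _) := by
  have h0 : (Fin.ofNat L 0 : Fin L) = 0 := by ext; simp
  rw [floquet_pow, oddLayer_eq, ← h0, ← layers_comm_shift _ _ 0 t, Matrix.submatrix_submatrix]
  have h2 : (⇑(shift L ι κ (Fin.ofNat L t)) ∘ ⇑(Equiv.refl (RingConfig L ι κ))) =
    ⇑(shift L ι κ (Fin.ofNat L t)) := rfl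
  rw [h2, Matrix.submatrix_mul_equiv, layers, zero_add]
  rfl

end Floquet

/-! ### Periodicity -/

section Period

variable {A : Type*} [Ring A] [HopfAlgebra ℂ A] [FiniteDimensional ℂ A] {L : ℕ} [NeZero L]
  {ι κ : Type*} [Fintype ι] [DecidableEq ι] [Fintype κ] [DecidableEq κ]
  (ρ : A →ₐ[ℂ] Matrix ι ι ℂ) {v : Matrix κ κ A}

/-- The pairs of the first `n` layers. -/
def layerPairs (L : ℕ) [NeZero L] (n : ℕ) : List (Fin L × Fin L) :=
  (List.range n).reverse.flatMap fun k => (List.finRange L).map fun i => (i, i + Fin.ofNat L k)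

omit [FiniteDimensional ℂ A] in
lemma layers_eq_listProd (v : Matrix κ κ A) (n : ℕ) :
    layers L ρ v n = ((layerPairs L n).map (gate ρ v)).prod := by
  induction n with
  | zero => rfl
  | succ n ih =>
    rw [layers, ih, layerPairs, layerPairs, List.range_succ, List.reverse_append,
      List.reverse_singleton, List.singleton_append, List.flatMap_cons, List.map_append,
      List.prod_append, List.map_map]
    rfl

/-- The relation `x` belongs to a later layer than `y`, for overlapping pairs. -/
def layerOrder (x y : Fin L × Fin L) : Prop :=
  x.1 = y.1 ∨ x.2 = y.2 → y.2 - y.1 < x.2 - x.1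

lemma layerPairs_pairwise : (layerPairs L L).Pairwise layerOrder := by
  rw [layerPairs, List.pairwise_flatMap]
  constructor
  · intro k _
    rw [List.pairwise_map]
    refine (List.pairwise_lt_finRange L).imp fun {i j} h h' => ?_
    simp only [add_left_inj, or_self] at h'
    exact absurd h' h.ne
  · rw [List.pairwise_reverse]
    refine List.Pairwise.imp_of_mem ?_ (List.pairwise_lt_range (n := L))
    intro a b ha hb hab x hx y hy _
    obtain ⟨i, _, rfl⟩ := List.mem_map.1 hx
    obtain ⟨j, _, rfl⟩ := List.mem_map.1 hy
    rw [List.mem_range] at ha hb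
    simpa [Fin.lt_def, Nat.mod_eq_of_lt ha, Nat.mod_eq_of_lt hb] using hab

lemma mem_layerPairs (x : Fin L × Fin L) : x ∈ layerPairs L L := by
  simp only [layerPairs, List.mem_flatMap, List.mem_reverse, List.mem_range, List.mem_map,
    List.mem_finRange, true_and]
  exact ⟨(x.2 - x.1 : Fin L), (x.2 - x.1).isLt, x.1, by simp⟩

omit [FiniteDimensional ℂ A] in
-- Each pair (i, j) occurs once, in layer j − i modulo L. Pairs with j < i wrap around and come
-- after every pair with i ≤ j sharing a site with them; within each class the layer order agrees
-- with `gateOrder`.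
lemma layers_eq_gateProd (v : Matrix κ κ A) : layers L ρ v L =
    gateProd (gate ρ v) (fun x : Fin L × Fin L => x.2 < x.1) *
      gateProd (gate ρ v) (fun x => x.1 ≤ x.2) := by
  classical
  rw [layers_eq_listProd, gateProd_eq, gateProd_eq, ← List.prod_append, ← List.map_append]
  have hne : ∀ {x y : Fin L × Fin L}, layerOrder x y → x ≠ y := by
    rintro x _ h rfl
    exact lt_irrefl _ (h (Or.inl rfl))
  have hpw : ((allPairs L).filter (fun x => x.2 < x.1) ++
      (allPairs L).filter (fun x => x.1 ≤ x.2)).Pairwise layerOrder := by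
    rw [List.pairwise_append]
    refine ⟨(allPairs_pairwise.filter _).imp_of_mem ?_,
      (allPairs_pairwise.filter _).imp_of_mem ?_, ?_⟩
    · intro x y hx hy h h'
      simp only [List.mem_filter, decide_eq_true_eq] at hx hy
      obtain ⟨h1, h2⟩ := h
      simp only [Fin.lt_def, Fin.ext_iff, Fin.coe_sub_iff_lt.2 hx.2, Fin.coe_sub_iff_lt.2 hy.2] at *
      omega
    · intro x y hx hy h h'
      simp only [List.mem_filter, decide_eq_true_eq] at hx hy
      obtain ⟨h1, h2⟩ := h
      simp only [Fin.lt_def, Fin.le_def, Fin.ext_iff, Fin.coe_sub_iff_le.2 hx.2,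
        Fin.coe_sub_iff_le.2 hy.2] at *
      omega
    · intro x hx y hy h'
      simp only [List.mem_filter, decide_eq_true_eq] at hx hy
      simp only [Fin.lt_def, Fin.le_def, Fin.ext_iff, Fin.coe_sub_iff_lt.2 hx.2,
        Fin.coe_sub_iff_le.2 hy.2] at *
      omega
  refine listProd_eq_of_perm (gate ρ v) (r := layerOrder) ?_ layerPairs_pairwise hpw ?_
  · refine (List.perm_ext_iff_of_nodup (layerPairs_pairwise.imp hne) (hpw.imp hne)).2 fun x => ?_
    simp [mem_layerPairs, mem_allPairs, lt_or_ge]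
  · intro x y hxy hyx
    exact gate_commute ρ v (fun h => lt_asymm (hxy (Or.inl h)) (hyx (Or.inl h.symm)))
      (fun h => lt_asymm (hxy (Or.inr h)) (hyx (Or.inr h.symm)))

omit [NeZero L] in
-- In `gateOrder` the two classes stand the other way round than in the circuit, and their union is
-- a full rectangle of pairs.
lemma gateProd_all (hv : IsCorep v) : gateProd (gate ρ v) (fun x : Fin L × Fin L => x.1 ≤ x.2) *
    gateProd (gate ρ v) (fun x => x.2 < x.1) =
      fuse (listRep ρ (List.finRange L)).ofConv (listCorep v (List.finRange L).reverse) := by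
  classical
  have h1 := gateProd_rect ρ hv (fun _ : Fin L => True) (fun _ : Fin L => True)
  have h2 := gateProd_split (c := gate ρ v) (fun x y h h' => gate_commute ρ v h h')
    (fun _ : Fin L × Fin L => True ∧ True) (fun x => x.1 ≤ x.2) (by
      intro x y _ hx _ hy
      constructor
      · intro h; rw [h] at hx; exact (not_le.1 hy).trans_le hx
      · intro h; rw [h] at hx; exact hx.trans_lt (not_le.1 hy))
  rw [h1] at h2
  simp only [true_and, not_le, decide_true, List.filter_true] at h2
  exact h2.symm

/-- The gates on the pairs with `x.2 < x.1` turn the layers into a power of the fused operator. -/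
lemma layers_pow (hv : IsCorep v) (k : ℕ) :
    layers L ρ v L ^ k * gateProd (gate ρ v) (fun x : Fin L × Fin L => x.2 < x.1) =
      gateProd (gate ρ v) (fun x : Fin L × Fin L => x.2 < x.1) *
      fuse ((listRep ρ (List.finRange L)).ofConv ∘ₗ sweedlerPower A k)
        (listCorep v (List.finRange L).reverse) := by
  obtain ⟨Φ, hΦ, -⟩ := exists_algHom_listRep ρ (List.finRange L) (List.nodup_finRange L)
  have hΦ' : (listRep ρ (List.finRange L)).ofConv = Φ.toLinearMap := by rw [← hΦ]
  have hV := listCorep_isCorep hv (List.finRange L).reverse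
    (List.nodup_reverse.2 (List.nodup_finRange L))
  rw [hΦ', ← fuse_pow Φ hV, ← hΦ', ← gateProd_all ρ hv, layers_eq_gateProd]
  set D := gateProd (gate ρ v) (fun x : Fin L × Fin L => x.2 < x.1)
  set U := gateProd (gate ρ v) (fun x : Fin L × Fin L => x.1 ≤ x.2)
  -- The identity (DU)^k D = D (UD)^k.
  exact (SemiconjBy.pow_right (show SemiconjBy D (U * D) (D * U) from (mul_assoc _ _ _).symm) k).symm

/-- Inverse gates in the opposite order. -/
def gateInv (ρ : A →ₐ[ℂ] Matrix ι ι ℂ) (v : Matrix κ κ A) (x : Fin L × Fin L) :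
    Matrix (RingConfig L ι κ) (RingConfig L ι κ) ℂ :=
  fuse ((siteRep ρ x.1).toLinearMap ∘ₗ HopfAlgebra.antipode ℂ) (siteMat x.2 v)

omit [NeZero L] in
lemma gate_mul_gateInv (hv : IsCorep v) (x : Fin L × Fin L) : gate ρ v x * gateInv ρ v x = 1 :=
  fuse_mul_fuse_antipode _ (hv.siteMat x.2)

lemma isUnit_gate (hv : IsCorep v) (x : Fin L × Fin L) : IsUnit (gate ρ v x) :=
  IsUnit.of_mul_eq_one _ (gate_mul_gateInv ρ hv x)

lemma isUnit_gateProd (hv : IsCorep v) (p : Fin L × Fin L → Prop) :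
    IsUnit (gateProd (gate ρ v) p) := by
  refine List.prod_induction IsUnit (fun _ _ => IsUnit.mul) isUnit_one fun T hT => ?_
  obtain ⟨x, _, rfl⟩ := List.mem_map.1 hT
  exact isUnit_gate ρ hv x

lemma layers_pow_exponent (hv : IsCorep v) {η : ℕ}
    (hη : (toConv (LinearMap.id : A →ₗ[ℂ] A)) ^ η = 1) : layers L ρ v L ^ η = 1 := by
  have h := layers_pow (L := L) ρ hv η
  have h2 : fuse ((listRep ρ (List.finRange L)).ofConv ∘ₗ sweedlerPower A η)
      (listCorep v (List.finRange L).reverse) = 1 := by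
    obtain ⟨Φ, hΦ, -⟩ := exists_algHom_listRep ρ (List.finRange L) (List.nodup_finRange L)
    have hΦ' : (listRep ρ (List.finRange L)).ofConv = Φ.toLinearMap := by rw [← hΦ]
    have hV := listCorep_isCorep hv (List.finRange L).reverse
      (List.nodup_reverse.2 (List.nodup_finRange L))
    have hP : sweedlerPower A η = sweedlerPower A 0 := by
      rw [sweedlerPower_eq, sweedlerPower_eq, hη, pow_zero]
    rw [hΦ', hP, ← fuse_pow Φ hV, pow_zero]
  rw [h2, mul_one] at h
  exact (isUnit_gateProd ρ hv _).mul_right_cancel (h.trans (one_mul _).symm)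

end Period

/-! ### Revivals of the circuit -/

section Revival

variable {A : Type*} [Ring A] [StarRing A] [HopfAlgebra ℂ A] [StarModule ℂ A]
  [FiniteDimensional ℂ A] {L : ℕ} [NeZero L]
  {ι κ : Type*} [Fintype ι] [DecidableEq ι] [Fintype κ] [DecidableEq κ]
  (ρ : A →⋆ₐ[ℂ] Matrix ι ι ℂ)

/-- mL periods are 2m groups of L layers, and the accompanying shift by mL cells is trivial on the
ring. This is where an even exponent gains a factor of two. -/
lemma floquet_pow_eq_one {v : κ → κ → A} (hv : IsUnitaryCorep v) {η m : ℕ}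
    (hη : (toConv (LinearMap.id : A →ₗ[ℂ] A)) ^ η = 1) (hm : η ∣ 2 * m) :
    floquet L ρ v ^ (m * L) = 1 := by
  have h0 : (Fin.ofNat L (m * L) : Fin L) = 0 := by ext; simp
  have h1 : layers L ρ.toAlgHom (Matrix.of v) (2 * (m * L)) = 1 := by
    have := layers_add_mul (L := L) ρ.toAlgHom (Matrix.of v) 0 (2 * m)
    rw [zero_add, mul_assoc] at this
    obtain ⟨c, hc⟩ := hm
    rw [this, hc, pow_mul, layers_pow_exponent ρ.toAlgHom hv.isCorep hη, one_pow]
    exact one_mul _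
  rw [floquet_pow, h1, h0]
  ext s t
  rw [Matrix.submatrix_apply, shift_zero]
  rfl

lemma exists_revival {v : κ → κ → A} (hv : IsUnitaryCorep v) {η : ℕ} (h0 : 0 < η)
    (hη : (toConv (LinearMap.id : A →ₗ[ℂ] A)) ^ η = 1) :
    floquet L ρ v ^ (η * L) = 1 ∧
      ∃ τ : ℕ, IsLeast {t : ℕ | 0 < t ∧ floquet L ρ v ^ t = 1} τ ∧
        τ ∣ η * L ∧ ∀ m, η = 2 * m → τ ∣ m * L := by
  have h := floquet_pow_eq_one (L := L) ρ hv hη (Dvd.intro_left 2 rfl)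
  have hpos : 0 < η * L := Nat.mul_pos h0 (NeZero.pos L)
  refine ⟨h, orderOf (floquet L ρ v), ⟨⟨?_, pow_orderOf_eq_one _⟩, fun t ht => ?_⟩, ?_, ?_⟩
  · exact orderOf_pos_iff.2 (isOfFinOrder_iff_pow_eq_one.2 ⟨_, hpos, h⟩)
  · exact orderOf_le_of_pow_eq_one ht.1 ht.2
  · exact orderOf_dvd_of_pow_eq_one h
  · intro m hm
    exact orderOf_dvd_of_pow_eq_one (floquet_pow_eq_one ρ hv hη (by rw [hm]))

/-- Translation by one site. -/
def siteShift (L : ℕ) [NeZero L] (ι : Type*) : RingConfig L ι ι ≃ RingConfig L ι ι where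
  toFun s := (s.2, fun x => s.1 (x + 1))
  invFun s := (fun x => s.2 (x - 1), s.1)
  left_inv s := by simp
  right_inv s := by simp

variable (v : ι → ι → A)

omit [StarModule ℂ A] in
omit [FiniteDimensional ℂ A] in
lemma oddLayer_siteShift :
    (oddLayer L ρ v).submatrix (siteShift L ι) (siteShift L ι) = evenLayer L ρ v := rfl

omit [StarModule ℂ A] in
omit [FiniteDimensional ℂ A] in
lemma evenLayer_siteShift :
    (evenLayer L ρ v).submatrix (siteShift L ι) (siteShift L ι) = oddLayer L ρ v := by
  ext s t
  exact Equiv.prod_comp (Equiv.addRight (1 : Fin L))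
    (fun x => circuitGate ρ v (s.1 x, s.2 x) (t.1 x, t.2 x))

omit [FiniteDimensional ℂ A] in
-- After an odd number of layers the next one is of the second kind; translation by one site
-- exchanges the two kinds.
lemma halfStepEvolution_add (a n : ℕ) : halfStepEvolution L ρ v (a + n) =
    (if Even a then halfStepEvolution L ρ v n else
      (halfStepEvolution L ρ v n).submatrix (siteShift L ι) (siteShift L ι)) *
        halfStepEvolution L ρ v a := by
  induction n with
  | zero =>
    rw [add_zero, halfStepEvolution, Matrix.submatrix_one_equiv, ite_self, one_mul]
  | succ n ih =>
    rw [← add_assoc, halfStepEvolution, ih, ← mul_assoc]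
    congr 1
    rw [halfStepEvolution, ← Matrix.submatrix_mul_equiv _ _ _ (siteShift L ι)]
    by_cases ha : Even a <;> by_cases hn : Even n <;>
      simp [ha, hn, Nat.even_add, oddLayer_siteShift, evenLayer_siteShift]

omit [FiniteDimensional ℂ A] in
lemma halfStepEvolution_two_mul (t : ℕ) :
    halfStepEvolution L ρ v (2 * t) = floquet L ρ v ^ t := by
  have h2 : halfStepEvolution L ρ v 2 = floquet L ρ v := by
    simp [halfStepEvolution, floquet]
  induction t with
  | zero => rfl
  | succ t ih =>
    rw [mul_add, mul_one, halfStepEvolution_add, if_pos (even_two_mul t), h2, ih, pow_succ']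

variable {v}

lemma isUnit_halfStepEvolution (hv : IsUnitaryCorep v) {η : ℕ} (h0 : 0 < η)
    (hη : (toConv (LinearMap.id : A →ₗ[ℂ] A)) ^ η = 1) (n : ℕ) :
    IsUnit (halfStepEvolution L ρ v n) := by
  have hF : IsUnit (floquet L ρ v) := IsUnit.of_pow_eq_one
    (exists_revival (L := L) ρ hv h0 hη).1 (Nat.mul_pos h0 (NeZero.pos L)).ne'
  have hdet : (evenLayer L ρ v * oddLayer L ρ v).det ≠ 0 :=
    ((Matrix.isUnit_iff_isUnit_det _).1 hF).ne_zero
  rw [Matrix.det_mul] at hdet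
  have hE : IsUnit (evenLayer L ρ v) :=
    (Matrix.isUnit_iff_isUnit_det _).2 (left_ne_zero_of_mul hdet).isUnit
  have hO : IsUnit (oddLayer L ρ v) :=
    (Matrix.isUnit_iff_isUnit_det _).2 (right_ne_zero_of_mul hdet).isUnit
  induction n with
  | zero => exact isUnit_one
  | succ n ih =>
    rw [halfStepEvolution]
    split_ifs
    · exact hO.mul ih
    · exact hE.mul ih

lemma halfStepEvolution_add_eq_iff (hv : IsUnitaryCorep v) {η : ℕ} (h0 : 0 < η)
    (hη : (toConv (LinearMap.id : A →ₗ[ℂ] A)) ^ η = 1) (a n : ℕ) :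
    halfStepEvolution L ρ v (a + n) = halfStepEvolution L ρ v a ↔
      halfStepEvolution L ρ v n = 1 := by
  have hu := isUnit_halfStepEvolution (L := L) ρ hv h0 hη a
  rw [halfStepEvolution_add, hu.mul_eq_right]
  split_ifs
  · rfl
  · have := (Matrix.reindex (siteShift L ι).symm (siteShift L ι).symm).injective.eq_iff
      (a := halfStepEvolution L ρ v n) (b := 1)
    simpa [Matrix.submatrix_one_equiv] using this

lemma exists_halfStep_revival (hv : IsUnitaryCorep v) {η : ℕ} (h0 : 0 < η)
    (hη : (toConv (LinearMap.id : A →ₗ[ℂ] A)) ^ η = 1) :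
    (∀ n, halfStepEvolution L ρ v (n + 2 * (η * L)) = halfStepEvolution L ρ v n) ∧
      ∃ τ : ℕ,
        IsLeast {n : ℕ | 0 < n ∧ halfStepEvolution L ρ v n = 1} τ ∧
        IsLeast {n : ℕ | 0 < n ∧ ∃ n₀, 0 < n₀ ∧
          halfStepEvolution L ρ v (n₀ + n) = halfStepEvolution L ρ v n₀} τ ∧
        τ ∣ 2 * (η * L) ∧ ∀ m, η = 2 * m → τ ∣ 2 * (m * L) := by
  classical
  have hiff := halfStepEvolution_add_eq_iff (L := L) ρ hv h0 hη
  have h1 : halfStepEvolution L ρ v (2 * (η * L)) = 1 := by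
    rw [halfStepEvolution_two_mul, (exists_revival ρ hv h0 hη).1]
  have hex : ∃ n, 0 < n ∧ halfStepEvolution L ρ v n = 1 :=
    ⟨_, Nat.mul_pos two_pos (Nat.mul_pos h0 (NeZero.pos L)), h1⟩
  have hdvd : ∀ n, halfStepEvolution L ρ v n = 1 → Nat.find hex ∣ n := by
    intro n
    induction n using Nat.strong_induction_on with
    | _ n ih =>
      intro hn
      rcases Nat.eq_zero_or_pos n with rfl | hpos
      · exact dvd_zero _
      · obtain ⟨c, rfl⟩ := Nat.exists_eq_add_of_le (Nat.find_min' hex ⟨hpos, hn⟩)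
        refine dvd_add (dvd_refl _) (ih c ?_ ?_)
        · exact Nat.lt_add_of_pos_left (Nat.find_spec hex).1
        · exact (hiff _ c).1 (hn.trans (Nat.find_spec hex).2.symm)
  refine ⟨fun n => (hiff n _).2 h1, Nat.find hex, ⟨Nat.find_spec hex, fun n hn =>
    Nat.find_min' hex hn⟩, ⟨⟨(Nat.find_spec hex).1, 1, one_pos, ?_⟩, ?_⟩, hdvd _ h1, ?_⟩
  · exact (hiff 1 _).2 (Nat.find_spec hex).2
  · rintro n ⟨hn, n₀, -, h⟩
    exact Nat.find_min' hex ⟨hn, (hiff n₀ n).1 h⟩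
  · intro m hm
    refine hdvd _ ?_
    rw [halfStepEvolution_two_mul, floquet_pow_eq_one ρ hv hη (by rw [hm])]

end Revival

/-! ### Schmidt ranks -/

section Schmidt

variable {L : ℕ} {α β : Type*}

/-- The configurations `s` and `s'` agree on the left sites in `P` and the right sites in `Q`. -/
def AgreeOn (P Q : Set (Fin L)) (s s' : RingConfig L α β) : Prop :=
  (∀ x ∈ P, s.1 x = s'.1 x) ∧ ∀ x ∈ Q, s.2 x = s'.2 x

/-- Across the cut between `(P, Q)` and its complement, `ψ` has Schmidt rank at most `n`. -/
def SchmidtLE (P Q : Set (Fin L)) (n : ℕ) (ψ : RingConfig L α β → ℂ) : Prop :=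
  ∃ f g : Fin n → RingConfig L α β → ℂ,
    (∀ k s s', AgreeOn P Q s s' → f k s = f k s') ∧
    (∀ k s s', AgreeOn Pᶜ Qᶜ s s' → g k s = g k s') ∧ ∀ s, ψ s = ∑ k, f k s * g k s

variable {P Q : Set (Fin L)} {n : ℕ} {ψ : RingConfig L α β → ℂ}

lemma SchmidtLE.of_fintype {T : Type*} [Fintype T] (hn : Fintype.card T = n)
    (f g : T → RingConfig L α β → ℂ) (hf : ∀ k s s', AgreeOn P Q s s' → f k s = f k s')
    (hg : ∀ k s s', AgreeOn Pᶜ Qᶜ s s' → g k s = g k s') (h : ∀ s, ψ s = ∑ k, f k s * g k s) :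
    SchmidtLE P Q n ψ := by
  let e : Fin n ≃ T := (finCongr hn.symm).trans (Fintype.equivFin T).symm
  exact ⟨f ∘ e, g ∘ e, fun k => hf _, fun k => hg _, fun s =>
    (h s).trans (Equiv.sum_comp e fun k => f k s * g k s).symm⟩

lemma SchmidtLE.mono {m : ℕ} (h : SchmidtLE P Q n ψ) (hnm : n ≤ m) : SchmidtLE P Q m ψ := by
  obtain ⟨f, g, hf, hg, h⟩ := h
  obtain ⟨c, rfl⟩ := Nat.exists_eq_add_of_le hnm
  refine ⟨Fin.addCases f fun _ _ => 0, Fin.addCases g fun _ _ => 0, fun k => ?_, fun k => ?_,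
    fun s => ?_⟩
  · refine Fin.addCases (fun k => ?_) (fun k => ?_) k
    · simpa using hf k
    · simp
  · refine Fin.addCases (fun k => ?_) (fun k => ?_) k
    · simpa using hg k
    · simp
  · rw [Fin.sum_univ_add, h s]
    simp

lemma SchmidtLE.compl (h : SchmidtLE P Q n ψ) : SchmidtLE Pᶜ Qᶜ n ψ := by
  obtain ⟨f, g, hf, hg, h⟩ := h
  exact ⟨g, f, hg, by simpa using hf, fun s => by simp_rw [h s, mul_comm]⟩

lemma schmidtLE_compl : SchmidtLE Pᶜ Qᶜ n ψ ↔ SchmidtLE P Q n ψ :=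
  ⟨fun h => by simpa using h.compl, SchmidtLE.compl⟩

lemma SchmidtLE.comp {α' β' : Type*} {P' Q' : Set (Fin L)} (h : SchmidtLE P Q n ψ)
    (e : RingConfig L α' β' → RingConfig L α β)
    (h1 : ∀ s s', AgreeOn P' Q' s s' → AgreeOn P Q (e s) (e s'))
    (h2 : ∀ s s', AgreeOn P'ᶜ Q'ᶜ s s' → AgreeOn Pᶜ Qᶜ (e s) (e s')) :
    SchmidtLE P' Q' n (ψ ∘ e) := by
  obtain ⟨f, g, hf, hg, h⟩ := h
  exact ⟨fun k => f k ∘ e, fun k => g k ∘ e, fun k s s' hs => hf k _ _ (h1 _ _ hs),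
    fun k s s' hs => hg k _ _ (h2 _ _ hs), fun s => h _⟩

/-- Each term is split according to the value at the new site x. The `max 1` covers the case where
nothing is added. -/
lemma SchmidtLE.insert_left [Fintype α] {x : Fin L} {P' : Set (Fin L)} (h : SchmidtLE P Q n ψ)
    (hP : P ⊆ P') (hx : ∀ y ∈ P', y ∉ P → y = x) :
    SchmidtLE P' Q (max 1 (Fintype.card α) * n) ψ := by
  classical
  by_cases hxP : x ∈ P'
  · suffices SchmidtLE P' Q (Fintype.card α * n) ψ from
      this.mono (Nat.mul_le_mul_right _ (le_max_right _ _))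
    obtain ⟨f, g, hf, hg, h⟩ := h
    refine SchmidtLE.of_fintype (T := α × Fin n) (by simp)
      (fun k s => if s.1 x = k.1 then f k.2 s else 0)
      (fun k s => g k.2 (Function.update s.1 x k.1, s.2)) ?_ ?_ ?_
    · intro k s s' hs
      rw [hs.1 x hxP, hf k.2 s s' ⟨fun y hy => hs.1 y (hP hy), hs.2⟩]
    · intro k s s' hs
      refine hg k.2 _ _ ⟨fun y hy => ?_, hs.2⟩
      by_cases hyx : y = x
      · subst hyx; simp
      · simp only [Function.update_of_ne hyx]
        exact hs.1 y fun hy' => hyx (hx y hy' hy)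
    · intro s
      rw [h s, Fintype.sum_prod_type, Finset.sum_eq_single (s.1 x)]
      · simp
      · intro a _ ha
        simp [ha.symm]
      · simp
  · have : P' = P := by
      refine Set.Subset.antisymm (fun y hy => ?_) hP
      by_contra hyP
      exact hxP (hx y hy hyP ▸ hy)
    rw [this]
    exact h.mono (Nat.le_mul_of_pos_left _ (lt_max_of_lt_left one_pos))

lemma AgreeOn.swap {s s' : RingConfig L α β} (h : AgreeOn P Q s s') :
    AgreeOn Q P s.swap s'.swap := ⟨h.2, h.1⟩

lemma SchmidtLE.swap (h : SchmidtLE P Q n ψ) :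
    SchmidtLE Q P n (fun s : RingConfig L β α => ψ s.swap) :=
  h.comp Prod.swap (fun _ _ hs => hs.swap) (fun _ _ hs => hs.swap)

lemma SchmidtLE.insert_right [Fintype β] {x : Fin L} {Q' : Set (Fin L)} (h : SchmidtLE P Q n ψ)
    (hQ : Q ⊆ Q') (hx : ∀ y ∈ Q', y ∉ Q → y = x) :
    SchmidtLE P Q' (max 1 (Fintype.card β) * n) ψ :=
  (h.swap.insert_left hQ hx).swap

variable [Fintype α] [Fintype β]

/-- Both functions are defined on full configurations, though each depends on one side of the cut.
Exchanging the outer parts of two configurations identifies the double sum of F(t)G(t') with the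
diagonal sum times the number of configurations. -/
lemma sum_mul_of_agreeOn {F G : RingConfig L α β → ℂ}
    (hF : ∀ s s', AgreeOn P Q s s' → F s = F s') (hG : ∀ s s', AgreeOn Pᶜ Qᶜ s s' → G s = G s') :
    ∑ t, F t * G t = (Fintype.card (RingConfig L α β) : ℂ)⁻¹ * ((∑ t, F t) * ∑ t, G t) := by
  classical
  let mix : RingConfig L α β → RingConfig L α β → RingConfig L α β := fun t t' =>
    (fun x => if x ∈ P then t.1 x else t'.1 x, fun x => if x ∈ Q then t.2 x else t'.2 x)
  have hmix : ∀ t t', mix (mix t t') (mix t' t) = t := by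
    intro t t'
    refine Prod.ext (funext fun x => ?_) (funext fun x => ?_)
    · by_cases h : x ∈ P <;> simp [mix, h]
    · by_cases h : x ∈ Q <;> simp [mix, h]
  let e : RingConfig L α β × RingConfig L α β ≃ RingConfig L α β × RingConfig L α β :=
    ⟨fun p => (mix p.1 p.2, mix p.2 p.1), fun p => (mix p.1 p.2, mix p.2 p.1),
      fun p => by simp [hmix], fun p => by simp [hmix]⟩
  have h1 : (∑ t, F t) * ∑ t, G t =
      (Fintype.card (RingConfig L α β) : ℂ) * ∑ t, F t * G t := by
    rw [Finset.sum_mul_sum, ← Fintype.sum_prod_type', ← Equiv.sum_comp e]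
    have h2 : ∀ p : RingConfig L α β × RingConfig L α β,
        F (e p).1 * G (e p).2 = F p.1 * G p.1 := by
      intro p
      congr 1
      · exact hF _ _ ⟨fun x hx => by simp [e, mix, hx], fun x hx => by simp [e, mix, hx]⟩
      · refine hG _ _ ⟨fun x hx => ?_, fun x hx => ?_⟩
        · simp [e, mix, show x ∉ P from hx]
        · simp [e, mix, show x ∉ Q from hx]
    simp only [h2]
    rw [Fintype.sum_prod_type_right]
    simp
  rcases Nat.eq_zero_or_pos (Fintype.card (RingConfig L α β)) with h0 | h0
  · have := Fintype.card_eq_zero_iff.1 h0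
    simp
  · rw [h1, inv_mul_cancel_left₀ (Nat.cast_ne_zero.2 h0.ne')]

/-- Applying `X` multiplies Schmidt ranks across the cut by at most `r`. -/
def OperatorSchmidtLE (P Q : Set (Fin L)) (r : ℕ)
    (X : Matrix (RingConfig L α β) (RingConfig L α β) ℂ) : Prop :=
  ∀ n ψ, SchmidtLE P Q n ψ → SchmidtLE P Q (r * n) (X.mulVec ψ)

lemma OperatorSchmidtLE.of_kernel {T : Type*} [Fintype T] {r : ℕ} (hr : Fintype.card T = r)
    {X : Matrix (RingConfig L α β) (RingConfig L α β) ℂ}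
    (a b : T → RingConfig L α β → RingConfig L α β → ℂ)
    (ha : ∀ k s s' t t', AgreeOn P Q s s' → AgreeOn P Q t t' → a k s t = a k s' t')
    (hb : ∀ k s s' t t', AgreeOn Pᶜ Qᶜ s s' → AgreeOn Pᶜ Qᶜ t t' → b k s t = b k s' t')
    (hX : ∀ s t, X s t = ∑ k, a k s t * b k s t) : OperatorSchmidtLE P Q r X := by
  rintro n ψ ⟨f, g, hf, hg, h⟩
  have refl1 : ∀ P Q : Set (Fin L), ∀ s : RingConfig L α β, AgreeOn P Q s s :=
    fun _ _ _ => ⟨fun _ _ => rfl, fun _ _ => rfl⟩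
  refine SchmidtLE.of_fintype (T := T × Fin n) (by simp [hr])
    (fun k s => (Fintype.card (RingConfig L α β) : ℂ)⁻¹ * ∑ t, a k.1 s t * f k.2 t)
    (fun k s => ∑ t, b k.1 s t * g k.2 t) ?_ ?_ ?_
  · intro k s s' hs
    simp_rw [ha k.1 s s' _ _ hs (refl1 _ _ _)]
  · intro k s s' hs
    simp_rw [hb k.1 s s' _ _ hs (refl1 _ _ _)]
  · intro s
    have h1 : ∀ k : T × Fin n, (Fintype.card (RingConfig L α β) : ℂ)⁻¹ *
        (∑ t, a k.1 s t * f k.2 t) * (∑ t, b k.1 s t * g k.2 t) =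
        ∑ t, (a k.1 s t * f k.2 t) * (b k.1 s t * g k.2 t) := by
      intro k
      rw [mul_assoc, ← sum_mul_of_agreeOn (P := P) (Q := Q)]
      · intro t t' ht
        rw [ha k.1 s s t t' (refl1 _ _ _) ht, hf k.2 t t' ht]
      · intro t t' ht
        rw [hb k.1 s s t t' (refl1 _ _ _) ht, hg k.2 t t' ht]
    simp_rw [h1]
    rw [Finset.sum_comm, Matrix.mulVec, dotProduct]
    refine Finset.sum_congr rfl fun t _ => ?_
    rw [hX, h t, Finset.sum_mul_sum, Fintype.sum_prod_type]
    refine Finset.sum_congr rfl fun k _ => Finset.sum_congr rfl fun l _ => ?_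
    ring

variable {r r' : ℕ} {X Y : Matrix (RingConfig L α β) (RingConfig L α β) ℂ}

lemma OperatorSchmidtLE.mul (hX : OperatorSchmidtLE P Q r X) (hY : OperatorSchmidtLE P Q r' Y) :
    OperatorSchmidtLE P Q (r * r') (X * Y) := by
  intro n ψ h
  rw [← Matrix.mulVec_mulVec, mul_assoc]
  exact hX _ _ (hY _ _ h)

lemma OperatorSchmidtLE.compl (hX : OperatorSchmidtLE P Q r X) :
    OperatorSchmidtLE Pᶜ Qᶜ r X := fun n ψ h =>
  (hX n ψ (schmidtLE_compl.1 h)).compl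

lemma operatorSchmidtLE_compl : OperatorSchmidtLE Pᶜ Qᶜ r X ↔ OperatorSchmidtLE P Q r X :=
  ⟨fun h => by simpa using h.compl, OperatorSchmidtLE.compl⟩

variable [DecidableEq α] [DecidableEq β]

lemma operatorSchmidtLE_one :
    OperatorSchmidtLE P Q 1 (1 : Matrix (RingConfig L α β) (RingConfig L α β) ℂ) := by
  intro n ψ h
  rwa [one_mul, Matrix.one_mulVec]

/-- Both `X` and its inverse multiply Schmidt ranks by at most `r`. -/
def InvertibleSchmidtLE (P Q : Set (Fin L)) (r : ℕ)
    (X : Matrix (RingConfig L α β) (RingConfig L α β) ℂ) : Prop :=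
  OperatorSchmidtLE P Q r X ∧ ∃ Z, X * Z = 1 ∧ OperatorSchmidtLE P Q r Z

lemma InvertibleSchmidtLE.mul (hX : InvertibleSchmidtLE P Q r X)
    (hY : InvertibleSchmidtLE P Q r' Y) : InvertibleSchmidtLE P Q (r * r') (X * Y) := by
  obtain ⟨hX, Z, hXZ, hZ⟩ := hX
  obtain ⟨hY, W, hYW, hW⟩ := hY
  refine ⟨hX.mul hY, W * Z, ?_, mul_comm r' r ▸ hW.mul hZ⟩
  rw [mul_assoc, ← mul_assoc Y, hYW, one_mul, hXZ]

lemma InvertibleSchmidtLE.listProd {l : List (Matrix (RingConfig L α β) (RingConfig L α β) ℂ)}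
    (h : ∀ X ∈ l, InvertibleSchmidtLE P Q 1 X) : InvertibleSchmidtLE P Q 1 l.prod := by
  induction l with
  | nil => exact ⟨operatorSchmidtLE_one, 1, one_mul 1, operatorSchmidtLE_one⟩
  | cons X l ih =>
    rw [List.prod_cons]
    exact (h X List.mem_cons_self).mul (ih fun Y hY => h Y (List.mem_cons_of_mem _ hY))

end Schmidt

/-! ### Schmidt ranks of the circuit -/

section Kernel

variable {A : Type*} [Ring A] [HopfAlgebra ℂ A] [FiniteDimensional ℂ A] {L : ℕ}
  {ι κ : Type*} [Fintype ι] [DecidableEq ι] [Fintype κ] [DecidableEq κ]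
  (ρ : A →ₐ[ℂ] Matrix ι ι ℂ) (v : Matrix κ κ A) (P Q : Set (Fin L))

/-- The indicator function of `s = t` on the sites of `(P, Q)` that are not listed. -/
def offDelta (lI lJ : List (Fin L)) (s t : RingConfig L ι κ) : ℂ := by
  classical exact if (∀ i ∈ P, i ∉ lI → s.1 i = t.1 i) ∧ (∀ j ∈ Q, j ∉ lJ → s.2 j = t.2 j)
    then 1 else 0

/-- The matrix elements of the representations at the sites in `l`, multiplied in `A*`. -/
def repEntry (l : List (Fin L)) (s t : RingConfig L ι κ) : HopfDual A :=
  (l.map fun x => repMat ρ.toLinearMap (s.1 x) (t.1 x)).prod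

/-- The matrix elements of the corepresentations at the sites in `l`, multiplied in `A`. -/
def corepEntry (l : List (Fin L)) (s t : RingConfig L ι κ) : A :=
  (l.map fun x => v (s.2 x) (t.2 x)).prod

variable {P Q}

omit [Fintype ι] [Fintype κ] in
lemma offDelta_congr (lI lJ : List (Fin L)) {s s' t t' : RingConfig L ι κ}
    (hs : AgreeOn P Q s s') (ht : AgreeOn P Q t t') :
    offDelta P Q lI lJ s t = offDelta P Q lI lJ s' t' := by
  classical
  have h : ((∀ i ∈ P, i ∉ lI → s.1 i = t.1 i) ∧ (∀ j ∈ Q, j ∉ lJ → s.2 j = t.2 j)) ↔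
      ((∀ i ∈ P, i ∉ lI → s'.1 i = t'.1 i) ∧ (∀ j ∈ Q, j ∉ lJ → s'.2 j = t'.2 j)) :=
    and_congr (forall₂_congr fun i hi => by rw [hs.1 i hi, ht.1 i hi])
      (forall₂_congr fun i hi => by rw [hs.2 i hi, ht.2 i hi])
  simp only [offDelta, h]

omit [FiniteDimensional ℂ A] [Fintype κ] [DecidableEq κ] in
lemma repEntry_congr {l : List (Fin L)} (hl : ∀ x ∈ l, x ∈ P) {s s' t t' : RingConfig L ι κ}
    (hs : AgreeOn P Q s s') (ht : AgreeOn P Q t t') : repEntry ρ l s t = repEntry ρ l s' t' := by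
  rw [repEntry, repEntry]
  exact congrArg _ (List.map_congr_left fun x hx => by rw [hs.1 x (hl x hx), ht.1 x (hl x hx)])

omit [HopfAlgebra ℂ A] [FiniteDimensional ℂ A] [Fintype ι] [DecidableEq ι] [Fintype κ] [DecidableEq κ] in
lemma corepEntry_congr {l : List (Fin L)} (hl : ∀ x ∈ l, x ∈ Q) {s s' t t' : RingConfig L ι κ}
    (hs : AgreeOn P Q s s') (ht : AgreeOn P Q t t') :
    corepEntry v l s t = corepEntry v l s' t' := by
  rw [corepEntry, corepEntry]
  exact congrArg _ (List.map_congr_left fun x hx => by rw [hs.2 x (hl x hx), ht.2 x (hl x hx)])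

variable (P Q)

/-- The ρ-sites and the v-sites meet only in a pairing of one element of A* with one element of A;
this is why ranks are bounded in terms of dim A, whatever the number of sites. -/
lemma fuse_list_apply (g : A →ₗ[ℂ] A) {lI lJ : List (Fin L)} (hI : lI.Nodup) (hJ : lJ.Nodup)
    (s t : RingConfig L ι κ) : fuse ((listRep ρ lI).ofConv ∘ₗ g) (listCorep v lJ) s t =
      offDelta P Q lI lJ s t * offDelta Pᶜ Qᶜ lI lJ s t *
        repEntry ρ lI s t (g (corepEntry v lJ s t)) := by
  classical
  rw [fuse_apply, listCorep_apply v lJ hJ, LinearMap.comp_apply]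
  have h1 := listRep_apply ρ lI hI (g (corepEntry v lJ s t)) s.1 t.1
  have hD : offDelta P Q lI lJ s t * offDelta Pᶜ Qᶜ lI lJ s t =
      if (∀ i, i ∉ lI → s.1 i = t.1 i) ∧ (∀ j, j ∉ lJ → s.2 j = t.2 j) then 1 else 0 := by
    have hite : ∀ (p q r : Prop) {_ : Decidable p} {_ : Decidable q} {_ : Decidable r}, (p ∧ q ↔ r) →
        (if p then (1 : ℂ) else 0) * (if q then 1 else 0) = if r then 1 else 0 := by
      intro p q r _ _ _ h
      by_cases hp : p <;> by_cases hq : q <;> simp [← h, hp, hq]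
    refine hite _ _ _ ⟨fun h => ⟨fun i hi => ?_, fun j hj => ?_⟩, fun h => ?_⟩
    · by_cases hP : i ∈ P
      exacts [h.1.1 i hP hi, h.2.1 i hP hi]
    · by_cases hQ : j ∈ Q
      exacts [h.1.2 j hQ hj, h.2.2 j hQ hj]
    · exact ⟨⟨fun i _ => h.1 i, fun j _ => h.2 j⟩, fun i _ => h.1 i, fun j _ => h.2 j⟩
  rw [hD]
  by_cases h2 : ∀ j, j ∉ lJ → s.2 j = t.2 j
  · rw [if_pos h2]
    refine h1.trans ?_
    by_cases h3 : ∀ i, i ∉ lI → s.1 i = t.1 i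
    · rw [if_pos h3, if_pos ⟨h3, h2⟩, one_mul]
      rfl
    · rw [if_neg h3, if_neg fun h => h3 h.1, zero_mul]
  · rw [if_neg h2, if_neg fun h => h2 h.2, zero_mul, map_zero, map_zero]
    rfl

variable {P Q}

lemma fuse_local (g : A →ₗ[ℂ] A) {lI lJ : List (Fin L)} (hI : lI.Nodup) (hJ : lJ.Nodup)
    (hP : ∀ x ∈ lI, x ∈ P) (hQ : ∀ x ∈ lJ, x ∈ Q) :
    OperatorSchmidtLE P Q 1 (fuse ((listRep ρ lI).ofConv ∘ₗ g) (listCorep v lJ)) := by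
  refine OperatorSchmidtLE.of_kernel (T := Unit) rfl
    (fun _ s t => offDelta P Q lI lJ s t * repEntry ρ lI s t (g (corepEntry v lJ s t)))
    (fun _ s t => offDelta Pᶜ Qᶜ lI lJ s t) ?_ ?_ ?_
  · intro _ s s' t t' hs ht
    simp only [offDelta_congr lI lJ hs ht, repEntry_congr ρ hP hs ht, corepEntry_congr v hQ hs ht]
  · intro _ s s' t t' hs ht
    exact offDelta_congr lI lJ hs ht
  · intro s t
    rw [fuse_list_apply ρ v P Q g hI hJ, Fintype.sum_unique]
    ring

omit [FiniteDimensional ℂ A] in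
lemma functional_eq_sum (f : HopfDual A) {B : Type*} [Fintype B] (b : Module.Basis B ℂ A) :
    f = ∑ p, f (b p) • (toConv (b.coord p) : HopfDual A) := by
  classical
  refine WithConv.ext (b.ext fun q => ?_)
  rw [WithConv.ofConv_sum, LinearMap.sum_apply]
  simp [Finsupp.single_apply]

/-- Inserting a basis of A into the pairing separates the two sides into dim A products. -/
lemma fuse_cross (g : A →ₗ[ℂ] A) {lI lJ : List (Fin L)} (hI : lI.Nodup) (hJ : lJ.Nodup)
    (hP : ∀ x ∈ lI, x ∈ P) (hQ : ∀ x ∈ lJ, x ∈ Qᶜ) :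
    OperatorSchmidtLE P Q (Module.finrank ℂ A)
      (fuse ((listRep ρ lI).ofConv ∘ₗ g) (listCorep v lJ)) := by
  set b := Module.finBasis ℂ A
  refine OperatorSchmidtLE.of_kernel (T := Fin (Module.finrank ℂ A)) (by simp)
    (fun p s t => offDelta P Q lI lJ s t * repEntry ρ lI s t (b p))
    (fun p s t => offDelta Pᶜ Qᶜ lI lJ s t * b.coord p (g (corepEntry v lJ s t))) ?_ ?_ ?_
  · intro _ s s' t t' hs ht
    simp only [offDelta_congr lI lJ hs ht, repEntry_congr ρ hP hs ht]
  · intro _ s s' t t' hs ht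
    simp only [offDelta_congr lI lJ hs ht, corepEntry_congr v hQ hs ht]
  · intro s t
    rw [fuse_list_apply ρ v P Q g hI hJ]
    have h : repEntry ρ lI s t (g (corepEntry v lJ s t)) =
        ∑ p, repEntry ρ lI s t (b p) * b.coord p (g (corepEntry v lJ s t)) := by
      conv_lhs => rw [← b.sum_repr (g (corepEntry v lJ s t))]
      simp only [map_sum, map_smul, smul_eq_mul, Module.Basis.coord_apply]
      exact Finset.sum_congr rfl fun p _ => mul_comm _ _
    rw [h, Finset.mul_sum]
    exact Finset.sum_congr rfl fun p _ => by ring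

/-- The block is the middle one of three intervals. Expanding its factor in A* and its factor in A
in bases leaves d² products; g sits entirely in the outer factor, so it does not affect the count.
-/
lemma fuse_three_blocks (g : A →ₗ[ℂ] A) {l₁ l₂ l₃ m₁ m₂ m₃ : List (Fin L)}
    (hI : (l₁ ++ l₂ ++ l₃).Nodup) (hJ : (m₃ ++ m₂ ++ m₁).Nodup)
    (hP₁ : ∀ x ∈ l₁, x ∈ Pᶜ) (hP₂ : ∀ x ∈ l₂, x ∈ P) (hP₃ : ∀ x ∈ l₃, x ∈ Pᶜ)
    (hQ₁ : ∀ x ∈ m₁, x ∈ Qᶜ) (hQ₂ : ∀ x ∈ m₂, x ∈ Q) (hQ₃ : ∀ x ∈ m₃, x ∈ Qᶜ) :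
    OperatorSchmidtLE P Q (Module.finrank ℂ A ^ 2)
      (fuse ((listRep ρ (l₁ ++ l₂ ++ l₃)).ofConv ∘ₗ g) (listCorep v (m₃ ++ m₂ ++ m₁))) := by
  set b := Module.finBasis ℂ A
  refine OperatorSchmidtLE.of_kernel
    (T := Fin (Module.finrank ℂ A) × Fin (Module.finrank ℂ A)) (by simp [sq])
    (fun p s t => offDelta P Q (l₁ ++ l₂ ++ l₃) (m₃ ++ m₂ ++ m₁) s t *
      (repEntry ρ l₂ s t (b p.1) * b.coord p.2 (corepEntry v m₂ s t)))
    (fun p s t => offDelta Pᶜ Qᶜ (l₁ ++ l₂ ++ l₃) (m₃ ++ m₂ ++ m₁) s t *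
      (repEntry ρ l₁ s t * (toConv (b.coord p.1) : HopfDual A) * repEntry ρ l₃ s t)
        (g (corepEntry v m₃ s t * b p.2 * corepEntry v m₁ s t))) ?_ ?_ ?_
  · intro _ s s' t t' hs ht
    simp only [offDelta_congr _ _ hs ht, repEntry_congr ρ hP₂ hs ht, corepEntry_congr v hQ₂ hs ht]
  · intro _ s s' t t' hs ht
    simp only [offDelta_congr _ _ hs ht, repEntry_congr ρ hP₁ hs ht, repEntry_congr ρ hP₃ hs ht,
      corepEntry_congr v hQ₁ hs ht, corepEntry_congr v hQ₃ hs ht]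
  · intro s t
    rw [fuse_list_apply ρ v P Q g hI hJ]
    have h1 : repEntry ρ (l₁ ++ l₂ ++ l₃) s t = ∑ p, repEntry ρ l₂ s t (b p) •
        (repEntry ρ l₁ s t * (toConv (b.coord p) : HopfDual A) * repEntry ρ l₃ s t) := by
      have : repEntry ρ (l₁ ++ l₂ ++ l₃) s t =
          repEntry ρ l₁ s t * repEntry ρ l₂ s t * repEntry ρ l₃ s t := by
        simp [repEntry, mul_assoc]
      rw [this]
      conv_lhs => rw [functional_eq_sum (repEntry ρ l₂ s t) b]
      simp only [Finset.mul_sum, Finset.sum_mul, mul_smul_comm, smul_mul_assoc]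
    have h2 : corepEntry v (m₃ ++ m₂ ++ m₁) s t = ∑ q, b.coord q (corepEntry v m₂ s t) •
        (corepEntry v m₃ s t * b q * corepEntry v m₁ s t) := by
      have : corepEntry v (m₃ ++ m₂ ++ m₁) s t =
          corepEntry v m₃ s t * corepEntry v m₂ s t * corepEntry v m₁ s t := by
        simp [corepEntry, mul_assoc]
      rw [this]
      conv_lhs => rw [← b.sum_repr (corepEntry v m₂ s t)]
      simp only [Finset.mul_sum, Finset.sum_mul, mul_smul_comm, smul_mul_assoc,
        Module.Basis.coord_apply]
    have h3 : repEntry ρ (l₁ ++ l₂ ++ l₃) s t (g (corepEntry v (m₃ ++ m₂ ++ m₁) s t)) =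
        ∑ p, ∑ q, repEntry ρ l₂ s t (b p) * b.coord q (corepEntry v m₂ s t) *
          (repEntry ρ l₁ s t * (toConv (b.coord p) : HopfDual A) * repEntry ρ l₃ s t)
            (g (corepEntry v m₃ s t * b q * corepEntry v m₁ s t)) := by
      rw [h1, withConv_sum_apply]
      refine Finset.sum_congr rfl fun p _ => ?_
      rw [h2]
      have h4 : ∀ (F : HopfDual A) (c : Fin (Module.finrank ℂ A) → ℂ)
          (x : Fin (Module.finrank ℂ A) → A), F (g (∑ q, c q • x q)) = ∑ q, c q * F (g (x q)) := by
        intro F c x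
        simp only [map_sum, map_smul, smul_eq_mul]
      refine (congrArg (repEntry ρ l₂ s t (b p) * ·) (h4 _ _ _)).trans ?_
      rw [Finset.mul_sum]
      exact Finset.sum_congr rfl fun q _ => (mul_assoc _ _ _).symm
    rw [h3, Fintype.sum_prod_type]
    simp only [Finset.mul_sum]
    refine Finset.sum_congr rfl fun p _ => Finset.sum_congr rfl fun q _ => ?_
    ring

end Kernel

/-! ### Operator Schmidt rank after multiples of L layers -/

section Revival

variable {A : Type*} [Ring A] [HopfAlgebra ℂ A] [FiniteDimensional ℂ A] {L : ℕ} [NeZero L]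
  {ι κ : Type*} [Fintype ι] [DecidableEq ι] [Fintype κ] [DecidableEq κ]
  (ρ : A →ₐ[ℂ] Matrix ι ι ℂ) {v : Matrix κ κ A} {P Q : Set (Fin L)}

omit [FiniteDimensional ℂ A] [NeZero L] in
lemma gate_eq_fuse_list (v : Matrix κ κ A) (x : Fin L × Fin L) :
    gate ρ v x = fuse ((listRep ρ [x.1]).ofConv ∘ₗ LinearMap.id) (listCorep v [x.2]) := by
  simp [gate, listRep, listCorep]

lemma gate_invertibleSchmidtLE (hv : IsCorep v) (x : Fin L × Fin L) (h : x.1 ∈ P ↔ x.2 ∈ Q) :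
    InvertibleSchmidtLE P Q 1 (gate ρ v x) := by
  have h1 : ∀ g : A →ₗ[ℂ] A, OperatorSchmidtLE P Q 1
      (fuse ((listRep ρ [x.1]).ofConv ∘ₗ g) (listCorep v [x.2])) := by
    intro g
    by_cases hx : x.1 ∈ P
    · exact fuse_local ρ v g (List.nodup_singleton _) (List.nodup_singleton _)
        (by simpa using hx) (by simpa using h.1 hx)
    · rw [← operatorSchmidtLE_compl]
      exact fuse_local ρ v g (List.nodup_singleton _) (List.nodup_singleton _)
        (by simpa using hx) (by simpa using fun h' => hx (h.2 h'))
  refine ⟨gate_eq_fuse_list ρ v x ▸ h1 LinearMap.id, gateInv ρ v x, gate_mul_gateInv ρ hv x, ?_⟩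
  have : gateInv ρ v x =
      fuse ((listRep ρ [x.1]).ofConv ∘ₗ HopfAlgebra.antipode ℂ) (listCorep v [x.2]) := by
    simp [gateInv, listRep, listCorep]
  exact this ▸ h1 _

lemma gateProd_local (hv : IsCorep v) (p : Fin L × Fin L → Prop)
    (h : ∀ x, p x → (x.1 ∈ P ↔ x.2 ∈ Q)) : InvertibleSchmidtLE P Q 1 (gateProd (gate ρ v) p) := by
  classical
  rw [gateProd_eq]
  refine InvertibleSchmidtLE.listProd fun T hT => ?_
  obtain ⟨x, hx, rfl⟩ := List.mem_map.1 hT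
  simp only [List.mem_filter, decide_eq_true_eq] at hx
  exact gate_invertibleSchmidtLE ρ hv x (h x hx.2)

omit [NeZero L] in
lemma gateProd_cross (hv : IsCorep v) (p q : Fin L → Prop)
    (h : (∀ x, p x → x ∈ P) ∧ (∀ x, q x → x ∈ Qᶜ) ∨ (∀ x, p x → x ∈ Pᶜ) ∧ (∀ x, q x → x ∈ Q)) :
    InvertibleSchmidtLE P Q (Module.finrank ℂ A)
      (gateProd (gate ρ v) (fun x => p x.1 ∧ q x.2)) := by
  classical
  set lI := (List.finRange L).filter (p ·) with hlI
  set lJ := (List.finRange L).reverse.filter (q ·) with hlJ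
  have hI : lI.Nodup := (List.nodup_finRange L).filter _
  have hJ : lJ.Nodup := (List.nodup_reverse.2 (List.nodup_finRange L)).filter _
  have hmI : ∀ x ∈ lI, p x := fun x hx => by simpa [hlI] using hx
  have hmJ : ∀ x ∈ lJ, q x := fun x hx => by simpa [hlJ] using hx
  have h1 : ∀ g : A →ₗ[ℂ] A, OperatorSchmidtLE P Q (Module.finrank ℂ A)
      (fuse ((listRep ρ lI).ofConv ∘ₗ g) (listCorep v lJ)) := by
    intro g
    rcases h with h | h
    · exact fuse_cross ρ v g hI hJ (fun x hx => h.1 x (hmI x hx)) (fun x hx => h.2 x (hmJ x hx))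
    · rw [← operatorSchmidtLE_compl]
      exact fuse_cross ρ v g hI hJ (fun x hx => h.1 x (hmI x hx))
        (fun x hx => by simpa using h.2 x (hmJ x hx))
  obtain ⟨Φ, hΦ, -⟩ := exists_algHom_listRep ρ lI hI
  have hΦ' : (listRep ρ lI).ofConv = Φ.toLinearMap := by rw [← hΦ]
  rw [gateProd_rect ρ hv]
  refine ⟨h1 LinearMap.id, fuse ((listRep ρ lI).ofConv ∘ₗ HopfAlgebra.antipode ℂ) (listCorep v lJ),
    ?_, h1 _⟩
  rw [hΦ']
  exact fuse_mul_fuse_antipode Φ (listCorep_isCorep hv lJ hJ)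

/-- The part of an interval `[p, q)` of sites that lies in the left sublattice. -/
def leftSites (L p q : ℕ) : Set (Fin L) := {i | p ≤ 2 * (i : ℕ) ∧ 2 * (i : ℕ) < q}

/-- The part of an interval `[p, q)` of sites that lies in the right sublattice. -/
def rightSites (L p q : ℕ) : Set (Fin L) := {j | p ≤ 2 * (j : ℕ) + 1 ∧ 2 * (j : ℕ) + 1 < q}

/-- Pairs crossing neither end of [p, q) act on one side of the cut. The crossing pairs form three
rectangles: i beyond q with j inside, i inside with j before p, and i beyond q with j before p. The
first two cost d each; the last acts outside only. -/
lemma gateProd_lower (hv : IsCorep v) {p q : ℕ} (hpq : p ≤ q) :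
    InvertibleSchmidtLE (leftSites L p q) (rightSites L p q) (Module.finrank ℂ A ^ 2)
      (gateProd (gate ρ v) (fun x : Fin L × Fin L => x.2 < x.1)) := by
  have hc : ∀ x y : Fin L × Fin L, x.1 ≠ y.1 → x.2 ≠ y.2 → Commute (gate ρ v x) (gate ρ v y) :=
    fun x y h h' => gate_commute ρ v h h'
  have e₁ := gateProd_split hc (fun x => x.2 < x.1) (fun x => ¬((2 * (x.2 : ℕ) + 1 < p ∧ p ≤ 2 * (x.1 : ℕ)) ∨
      (2 * (x.2 : ℕ) + 1 < q ∧ q ≤ 2 * (x.1 : ℕ))))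
    (by
      intro x y hx hx' hy hy'
      constructor <;> intro h <;> simp only [Fin.lt_def, Fin.ext_iff] at * <;> omega)
  have e₂ := gateProd_split hc (fun x => x.2 < x.1 ∧ ¬¬((2 * (x.2 : ℕ) + 1 < p ∧ p ≤ 2 * (x.1 : ℕ)) ∨
      (2 * (x.2 : ℕ) + 1 < q ∧ q ≤ 2 * (x.1 : ℕ))))
    (fun x => ((p ≤ 2 * (x.2 : ℕ) + 1 ∧ 2 * (x.2 : ℕ) + 1 < q) ∧ q ≤ 2 * (x.1 : ℕ)))
    (by
      intro x y hx hx' hy hy'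
      constructor <;> intro h <;> simp only [Fin.lt_def, Fin.ext_iff] at * <;> omega)
  have e₃ := gateProd_split hc (fun x => (x.2 < x.1 ∧ ¬¬((2 * (x.2 : ℕ) + 1 < p ∧ p ≤ 2 * (x.1 : ℕ)) ∨
      (2 * (x.2 : ℕ) + 1 < q ∧ q ≤ 2 * (x.1 : ℕ)))) ∧
      ¬((p ≤ 2 * (x.2 : ℕ) + 1 ∧ 2 * (x.2 : ℕ) + 1 < q) ∧ q ≤ 2 * (x.1 : ℕ))) (fun x => 2 * (x.1 : ℕ) < q)
    (by
      intro x y hx hx' hy hy'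
      constructor <;> intro h <;> simp only [Fin.lt_def, Fin.ext_iff] at * <;> omega)
  rw [e₁, e₂, e₃]
  have h1 : Module.finrank ℂ A ^ 2 =
      1 * (Module.finrank ℂ A * (Module.finrank ℂ A * 1)) := by ring
  rw [h1]
  refine InvertibleSchmidtLE.mul ?_ (InvertibleSchmidtLE.mul ?_ (InvertibleSchmidtLE.mul ?_ ?_))
  · refine gateProd_local ρ hv _ fun x hx => ?_
    simp only [leftSites, rightSites, Set.mem_ofPred_eq, Fin.lt_def] at *
    omega
  · convert gateProd_cross (P := leftSites L p q) (Q := rightSites L p q) ρ hv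
      (fun i => q ≤ 2 * (i : ℕ)) (fun j => p ≤ 2 * (j : ℕ) + 1 ∧ 2 * (j : ℕ) + 1 < q) ?_ using 3 with x
    · simp only [Fin.lt_def]
      omega
    · refine Or.inr ⟨fun x hx => ?_, fun x hx => hx⟩
      simp only [leftSites, Set.mem_compl_iff, Set.mem_ofPred_eq]
      omega
  · convert gateProd_cross (P := leftSites L p q) (Q := rightSites L p q) ρ hv
      (fun i => p ≤ 2 * (i : ℕ) ∧ 2 * (i : ℕ) < q) (fun j => 2 * (j : ℕ) + 1 < p) ?_ using 3 with x
    · simp only [Fin.lt_def]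
      omega
    · refine Or.inl ⟨fun x hx => hx, fun x hx => ?_⟩
      simp only [rightSites, Set.mem_compl_iff, Set.mem_ofPred_eq]
      omega
  · refine gateProd_local ρ hv _ fun x hx => ?_
    simp only [leftSites, rightSites, Set.mem_ofPred_eq, Fin.lt_def] at *
    omega

lemma exists_split {X : Type*} (pos : X → ℕ) (p : ℕ) (l : List X)
    (hl : l.Pairwise fun x y => pos x < pos y) :
    ∃ l₁ l₂, l = l₁ ++ l₂ ∧ (∀ x ∈ l₁, pos x < p) ∧ ∀ x ∈ l₂, p ≤ pos x := by
  induction l with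
  | nil => exact ⟨[], [], rfl, by simp, by simp⟩
  | cons x l ih =>
    rw [List.pairwise_cons] at hl
    by_cases h : pos x < p
    · obtain ⟨l₁, l₂, rfl, h1, h2⟩ := ih hl.2
      refine ⟨x :: l₁, l₂, rfl, fun y hy => ?_, h2⟩
      rcases List.mem_cons.1 hy with rfl | hy
      exacts [h, h1 y hy]
    · refine ⟨[], x :: l, rfl, by simp, fun y hy => ?_⟩
      rcases List.mem_cons.1 hy with rfl | hy
      exacts [not_lt.1 h, (not_lt.1 h).trans (hl.1 y hy).le]

lemma exists_split_three {X : Type*} (pos : X → ℕ) (p q : ℕ) (l : List X)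
    (hl : l.Pairwise fun x y => pos x < pos y) :
    ∃ l₁ l₂ l₃, l = l₁ ++ l₂ ++ l₃ ∧ (∀ x ∈ l₁, pos x < p) ∧
      (∀ x ∈ l₂, p ≤ pos x ∧ pos x < q) ∧ ∀ x ∈ l₃, q ≤ pos x := by
  obtain ⟨l', l₃, rfl, h1, h2⟩ := exists_split pos q l hl
  obtain ⟨l₁, l₂, rfl, h3, h4⟩ := exists_split pos p l' (List.pairwise_append.1 hl).1
  exact ⟨l₁, l₂, l₃, rfl, h3, fun x hx => ⟨h4 x hx, h1 x (List.mem_append_right _ hx)⟩, h2⟩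

/-- After any number of periods `L / 2` the circuit has bounded operator Schmidt rank. -/
theorem layers_pow_schmidtLE (hv : IsCorep v) {p q : ℕ} (hpq : p ≤ q) (k : ℕ) :
    OperatorSchmidtLE (leftSites L p q) (rightSites L p q) (Module.finrank ℂ A ^ 6)
      (layers L ρ v L ^ k) := by
  obtain ⟨hD, Z, hZ, hDZ⟩ := gateProd_lower (L := L) ρ hv hpq
  have h1 := layers_pow (L := L) ρ hv k
  set D := gateProd (gate ρ v) (fun x : Fin L × Fin L => x.2 < x.1)
  -- The k-th power is D (UD)^k D⁻¹. The power k enters only through a Sweedler power inside the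
  -- middle factor, so its rank bound does not grow with k.
  have h2 : layers L ρ v L ^ k = D *
      fuse ((listRep ρ (List.finRange L)).ofConv ∘ₗ sweedlerPower A k)
        (listCorep v (List.finRange L).reverse) * Z := by
    rw [← h1, mul_assoc, hZ, mul_one]
  obtain ⟨l₁, l₂, l₃, hl, hl₁, hl₂, hl₃⟩ := exists_split_three (fun i : Fin L => 2 * (i : ℕ)) p q
    (List.finRange L) ((List.pairwise_lt_finRange L).imp fun h => by
      simp only [Fin.lt_def] at h; omega)
  obtain ⟨m₁, m₂, m₃, hm, hm₁, hm₂, hm₃⟩ := exists_split_three (fun j : Fin L => 2 * (j : ℕ) + 1)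
    p q (List.finRange L) ((List.pairwise_lt_finRange L).imp fun h => by
      simp only [Fin.lt_def] at h; omega)
  have hm' : (List.finRange L).reverse = m₃.reverse ++ m₂.reverse ++ m₁.reverse := by
    rw [hm]; simp
  have hnd := List.nodup_finRange L
  have h3 : OperatorSchmidtLE (leftSites L p q) (rightSites L p q) (Module.finrank ℂ A ^ 2)
      (fuse ((listRep ρ (List.finRange L)).ofConv ∘ₗ sweedlerPower A k)
        (listCorep v (List.finRange L).reverse)) := by
    rw [hm']
    have hI : (l₁ ++ l₂ ++ l₃).Nodup := hl ▸ hnd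
    have hJ : (m₃.reverse ++ m₂.reverse ++ m₁.reverse).Nodup :=
      hm' ▸ List.nodup_reverse.2 hnd
    rw [show listRep ρ (List.finRange L) = listRep ρ (l₁ ++ l₂ ++ l₃) by rw [← hl]]
    refine fuse_three_blocks ρ v _ hI hJ (fun x hx => ?_) (fun x hx => hl₂ x hx) (fun x hx => ?_)
      (fun x hx => ?_) (fun x hx => hm₂ x (List.mem_reverse.1 hx)) (fun x hx => ?_)
    · have := hl₁ x hx
      simp only [leftSites, Set.mem_compl_iff, Set.mem_ofPred_eq]; omega
    · have := hl₃ x hx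
      simp only [leftSites, Set.mem_compl_iff, Set.mem_ofPred_eq]; omega
    · have := hm₁ x (List.mem_reverse.1 hx)
      simp only [rightSites, Set.mem_compl_iff, Set.mem_ofPred_eq]; omega
    · have := hm₃ x (List.mem_reverse.1 hx)
      simp only [rightSites, Set.mem_compl_iff, Set.mem_ofPred_eq]; omega
  rw [h2]
  have h4 := (hD.mul h3).mul hDZ
  rwa [show Module.finrank ℂ A ^ 2 * Module.finrank ℂ A ^ 2 * Module.finrank ℂ A ^ 2 =
    Module.finrank ℂ A ^ 6 by ring] at h4

end Revival

/-! ### Matrix product states -/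

section MPS

variable {L : ℕ} {α β : Type*}

/-- An interval cuts two bonds of the ring; cyclicity of the trace joins the two outer stretches
into one matrix. -/
lemma IsMPS_schmidtLE {χ : ℕ} {ψ : RingConfig L α β → ℂ} (h : IsMPS χ ψ) (p q : ℕ) :
    SchmidtLE (leftSites L p q) (rightSites L p q) (χ ^ 2) ψ := by
  obtain ⟨M, N, h⟩ := h
  let T : RingConfig L α β → Fin L ⊕ Fin L → Matrix (Fin χ) (Fin χ) ℂ := fun σ =>
    Sum.elim (fun x => M x (σ.1 x)) (fun x => N x (σ.2 x))
  let pos : Fin L ⊕ Fin L → ℕ := Sum.elim (fun x => 2 * (x : ℕ)) (fun x => 2 * (x : ℕ) + 1)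
  let l : List (Fin L ⊕ Fin L) := (List.finRange L).flatMap fun x => [Sum.inl x, Sum.inr x]
  have hprod : ∀ σ, (List.ofFn fun x => M x (σ.1 x) * N x (σ.2 x)).prod = (l.map (T σ)).prod := by
    intro σ
    rw [List.ofFn_eq_map]
    simp only [l]
    induction List.finRange L with
    | nil => rfl
    | cons x m ih =>
      rw [List.map_cons, List.prod_cons, ih, List.flatMap_cons, List.map_append, List.prod_append]
      simp [T]
  have hpw : l.Pairwise fun x y => pos x < pos y := by
    rw [List.pairwise_flatMap]
    refine ⟨fun x _ => by simp [pos], (List.pairwise_lt_finRange L).imp ?_⟩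
    intro x y hxy a ha b hb
    simp only [Fin.lt_def] at hxy
    simp only [List.mem_cons, List.not_mem_nil, or_false] at ha hb
    rcases ha with rfl | rfl <;> rcases hb with rfl | rfl <;> simp [pos] <;> omega
  obtain ⟨l₁, l₂, l₃, hl, hl₁, hl₂, hl₃⟩ := exists_split_three pos p q l hpw
  have hin : ∀ (σ σ' : RingConfig L α β), AgreeOn (leftSites L p q) (rightSites L p q) σ σ' →
      (l₂.map (T σ)) = l₂.map (T σ') := by
    intro σ σ' hσ
    refine List.map_congr_left fun x hx => ?_
    have := hl₂ x hx
    rcases x with x | x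
    · exact congrArg (M x) (hσ.1 x this)
    · exact congrArg (N x) (hσ.2 x this)
  have hout : ∀ (m : List (Fin L ⊕ Fin L)), (∀ x ∈ m, pos x < p ∨ q ≤ pos x) →
      ∀ (σ σ' : RingConfig L α β), AgreeOn (leftSites L p q)ᶜ (rightSites L p q)ᶜ σ σ' →
      (m.map (T σ)) = m.map (T σ') := by
    intro m hm σ σ' hσ
    refine List.map_congr_left fun x hx => ?_
    have := hm x hx
    rcases x with x | x
    · refine congrArg (M x) (hσ.1 x ?_)
      simp only [leftSites, Set.mem_compl_iff, Set.mem_ofPred_eq]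
      simp only [pos, Sum.elim_inl] at this
      omega
    · refine congrArg (N x) (hσ.2 x ?_)
      simp only [rightSites, Set.mem_compl_iff, Set.mem_ofPred_eq]
      simp only [pos, Sum.elim_inr] at this
      omega
  refine SchmidtLE.of_fintype (T := Fin χ × Fin χ) (by simp [sq])
    (fun k σ => (l₂.map (T σ)).prod k.1 k.2)
    (fun k σ => ((l₃.map (T σ)).prod * (l₁.map (T σ)).prod) k.2 k.1) ?_ ?_ ?_
  · intro k σ σ' hσ
    simp only [hin σ σ' hσ]
  · intro k σ σ' hσ
    simp only [hout l₁ (fun x hx => Or.inl (hl₁ x hx)) σ σ' hσ,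
      hout l₃ (fun x hx => Or.inr (hl₃ x hx)) σ σ' hσ]
  · intro σ
    rw [h, hprod, hl, List.map_append, List.map_append, List.prod_append, List.prod_append,
      mul_assoc, Matrix.trace_mul_comm, mul_assoc, Matrix.trace, Fintype.sum_prod_type]
    rfl

end MPS

open scoped ComplexOrder

/-! ### Entropies of states of bounded rank -/

section Entropy

variable {n : Type*} [Fintype n] [DecidableEq n] {σ : Matrix n n ℂ}

lemma card_nonzero_eigenvalues_le (hσ : σ.PosSemidef) {C : ℕ} (hrank : σ.rank ≤ C) :
    (Finset.univ.filter fun i => hσ.1.eigenvalues i ≠ 0).card ≤ C := by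
  rw [hσ.1.rank_eq_card_non_zero_eigs, Fintype.card_subtype] at hrank
  exact hrank

lemma sum_eigenvalues_eq_one (hσ : σ.PosSemidef) (htr : σ.trace = 1) :
    ∑ i, hσ.1.eigenvalues i = 1 := by
  have h := hσ.1.trace_eq_sum_eigenvalues
  rw [htr] at h
  refine Complex.ofReal_injective ?_
  rw [Complex.ofReal_sum, Complex.ofReal_one]
  exact h.symm

lemma vonNeumannEntropy_le (hσ : σ.PosSemidef) (htr : σ.trace = 1) {C : ℕ} (hC : 0 < C)
    (hrank : σ.rank ≤ C) : vonNeumannEntropy σ ≤ Real.log C := by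
  have hC' : (0 : ℝ) < C := Nat.cast_pos.2 hC
  have hsum := sum_eigenvalues_eq_one hσ htr
  have hcard := card_nonzero_eigenvalues_le hσ hrank
  set lam := hσ.1.eigenvalues
  have h1 : vonNeumannEntropy σ = ∑ i, Real.negMulLog (lam i) := by
    rw [vonNeumannEntropy, hσ.1.roots_charpoly_eq_eigenvalues, Multiset.map_map]
    rfl
  -- This is ln x ≤ x − 1 at x = 1/(λC), multiplied by λ.
  have h2 : ∀ i, Real.negMulLog (lam i) ≤
      lam i * Real.log C + ((if lam i ≠ 0 then (C : ℝ)⁻¹ else 0) - lam i) := by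
    intro i
    by_cases hi : lam i = 0
    · simp [hi]
    · have hpos : 0 < lam i := lt_of_le_of_ne (hσ.eigenvalues_nonneg i) (Ne.symm hi)
      rw [if_pos hi]
      have h3 := Real.log_le_sub_one_of_pos (inv_pos.2 (mul_pos hpos hC'))
      rw [Real.log_inv, Real.log_mul hpos.ne' hC'.ne'] at h3
      have h4 := mul_le_mul_of_nonneg_left h3 hpos.le
      have h5 : lam i * ((lam i * C)⁻¹ - 1) = (C : ℝ)⁻¹ - lam i := by
        field_simp
      rw [Real.negMulLog]
      linarith
  calc vonNeumannEntropy σ ≤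
      ∑ i, (lam i * Real.log C + ((if lam i ≠ 0 then (C : ℝ)⁻¹ else 0) - lam i)) := by
        rw [h1]; exact Finset.sum_le_sum fun i _ => h2 i
    _ = Real.log C + ((Finset.univ.filter fun i => lam i ≠ 0).card * (C : ℝ)⁻¹ - 1) := by
        rw [Finset.sum_add_distrib, Finset.sum_sub_distrib, ← Finset.sum_mul, hsum, one_mul,
          ← Finset.sum_filter, Finset.sum_const, nsmul_eq_mul]
    _ ≤ Real.log C := by
        have : ((Finset.univ.filter fun i => lam i ≠ 0).card : ℝ) * (C : ℝ)⁻¹ ≤ 1 := by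
          rw [← div_eq_mul_inv, div_le_one hC']
          exact_mod_cast hcard
        linarith

lemma trace_pow_eq (hσ : σ.IsHermitian) (k : ℕ) :
    (σ ^ k).trace = ∑ i, ((hσ.eigenvalues i ^ k : ℝ) : ℂ) := by
  conv_lhs => rw [hσ.spectral_theorem]
  rw [← map_pow, Unitary.conjStarAlgAut_apply, Matrix.trace_mul_comm, ← mul_assoc,
    Matrix.diagonal_pow]
  simp [Matrix.trace_diagonal]

/-- The power mean inequality over the at most C nonzero eigenvalues, which sum to 1, gives Tr σ^k ≥
C^(1−k). -/
lemma renyiEntropy_le (hσ : σ.PosSemidef) (htr : σ.trace = 1) {C : ℕ} (hC : 0 < C)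
    (hrank : σ.rank ≤ C) {k : ℕ} (hk : 2 ≤ k) : renyiEntropy k σ ≤ Real.log C := by
  have hC' : (0 : ℝ) < C := Nat.cast_pos.2 hC
  have hsum := sum_eigenvalues_eq_one hσ htr
  have hcard := card_nonzero_eigenvalues_le hσ hrank
  have htr' := trace_pow_eq hσ.1 k
  set lam := hσ.1.eigenvalues
  obtain ⟨j, rfl⟩ := Nat.exists_eq_add_of_le' (le_trans one_le_two hk)
  set S := Finset.univ.filter fun i => lam i ≠ 0
  have h1 : ∑ i ∈ S, lam i = 1 := by rw [Finset.sum_filter_ne_zero, hsum]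
  have hS : 0 < S.card := by
    rw [Finset.card_pos]
    by_contra h
    rw [Finset.not_nonempty_iff_eq_empty.1 h, Finset.sum_empty] at h1
    exact zero_ne_one h1
  have h2 : (1 : ℝ) / S.card ^ j ≤ ∑ i ∈ S, lam i ^ (j + 1) := by
    have := pow_sum_div_card_le_sum_pow (s := S) (f := lam)
      (fun i _ => hσ.eigenvalues_nonneg i) j
    rwa [h1, one_pow] at this
  have h3 : (σ ^ (j + 1)).trace.re = ∑ i, lam i ^ (j + 1) := by
    rw [htr', ← Complex.ofReal_sum, Complex.ofReal_re]
  have h4 : ∑ i ∈ S, lam i ^ (j + 1) ≤ ∑ i, lam i ^ (j + 1) :=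
    Finset.sum_le_sum_of_subset_of_nonneg (Finset.filter_subset _ _)
      fun i _ _ => pow_nonneg (hσ.eigenvalues_nonneg i) _
  have h5 : ((C : ℝ) ^ j)⁻¹ ≤ (σ ^ (j + 1)).trace.re := by
    rw [h3]
    refine le_trans ?_ (h2.trans h4)
    rw [one_div]
    exact inv_anti₀ (pow_pos (Nat.cast_pos.2 hS) j)
      (pow_le_pow_left₀ (Nat.cast_nonneg _) (by exact_mod_cast hcard) j)
  have h6 : -(j * Real.log C) ≤ Real.log (σ ^ (j + 1)).trace.re := by
    rw [← Real.log_pow, ← Real.log_inv]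
    exact Real.log_le_log (inv_pos.2 (pow_pos hC' j)) h5
  have hj : (0 : ℝ) < j := by
    have : 1 ≤ j := by omega
    exact_mod_cast this
  rw [renyiEntropy, Nat.cast_add, Nat.cast_one, show (1 : ℝ) - (j + 1) = -j by ring,
    div_neg, ← neg_div, div_le_iff₀ hj]
  linarith

end Entropy

/-! ### Reduced density matrices -/

section Reduced

variable {L : ℕ} {α β : Type*} (R : Finset (Fin L) × Finset (Fin L))

/-- The configurations of the ring as pairs of configurations of a subsystem and its complement. -/
def glueEquiv (α β : Type*) : InnerConfig R α β × OuterConfig R α β ≃ RingConfig L α β where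
  toFun p := glueConfig R p.1 p.2
  invFun s := ((fun x => s.1 x, fun x => s.2 x), (fun x => s.1 x, fun x => s.2 x))
  left_inv p := by
    refine Prod.ext (Prod.ext (funext fun x => ?_) (funext fun x => ?_))
      (Prod.ext (funext fun x => ?_) (funext fun x => ?_)) <;> simp [glueConfig, x.2]
  right_inv s := by
    refine Prod.ext (funext fun x => ?_) (funext fun x => ?_)
    · simp [glueConfig]
    · simp [glueConfig]

variable [Fintype α] [Fintype β]

/-- The coefficients of a state, as a matrix. -/
def coeffMatrix (ψ : RingConfig L α β → ℂ) : Matrix (InnerConfig R α β) (OuterConfig R α β) ℂ :=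
  Matrix.of fun a c => ψ (glueConfig R a c)

lemma reducedDensity_eq (ψ : RingConfig L α β → ℂ) :
    reducedDensity R ψ = coeffMatrix R ψ * (coeffMatrix R ψ).conjTranspose := by
  ext a a'
  simp [reducedDensity, coeffMatrix, Matrix.mul_apply]

lemma reducedDensity_posSemidef (ψ : RingConfig L α β → ℂ) : (reducedDensity R ψ).PosSemidef := by
  rw [reducedDensity_eq]
  exact Matrix.posSemidef_self_mul_conjTranspose _

lemma trace_reducedDensity [DecidableEq α] [DecidableEq β] {ψ : RingConfig L α β → ℂ}
    (h : ∑ σ, ‖ψ σ‖ ^ 2 = 1) : (reducedDensity R ψ).trace = 1 := by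
  have h1 : ∑ σ, ψ σ * star (ψ σ) = 1 := by
    rw [← Complex.ofReal_one, ← h, Complex.ofReal_sum]
    refine Finset.sum_congr rfl fun σ _ => ?_
    rw [Complex.ofReal_pow]
    exact Complex.mul_conj' _
  rw [← h1, ← Equiv.sum_comp (glueEquiv R α β), Fintype.sum_prod_type]
  rfl

/-- A Schmidt decomposition factors the coefficient matrix through ℂ^C; each factor may be evaluated
with an arbitrary configuration on the other side. -/
lemma rank_reducedDensity_le {ψ : RingConfig L α β → ℂ} {C : ℕ}
    (h : SchmidtLE (R.1 : Set (Fin L)) (R.2 : Set (Fin L)) C ψ) : (reducedDensity R ψ).rank ≤ C := by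
  rw [reducedDensity_eq]
  refine (Matrix.rank_mul_le_left _ _).trans ?_
  rcases isEmpty_or_nonempty (OuterConfig R α β) with hE | ⟨⟨c₀⟩⟩
  · exact (Matrix.rank_le_card_width _).trans (by simp)
  rcases isEmpty_or_nonempty (InnerConfig R α β) with hE | ⟨⟨a₀⟩⟩
  · exact (Matrix.rank_le_card_height _).trans (by simp)
  obtain ⟨f, g, hf, hg, h⟩ := h
  have hfac : coeffMatrix R ψ = (Matrix.of fun a k => f k (glueConfig R a c₀) : Matrix _ (Fin C) ℂ) *
      (Matrix.of fun k c => g k (glueConfig R a₀ c) : Matrix (Fin C) _ ℂ) := by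
    ext a c
    simp only [coeffMatrix, Matrix.of_apply, Matrix.mul_apply, h]
    refine Finset.sum_congr rfl fun k _ => ?_
    congr 1
    · refine hf k _ _ ⟨fun x hx => ?_, fun x hx => ?_⟩ <;>
        simp [glueConfig, Finset.mem_coe.1 hx]
    · refine hg k _ _ ⟨fun x hx => ?_, fun x hx => ?_⟩
      · simp [glueConfig, show x ∉ R.1 from hx]
      · simp [glueConfig, show x ∉ R.2 from hx]
  rw [hfac]
  refine (Matrix.rank_mul_le_left _ _).trans ?_
  exact (Matrix.rank_le_card_width _).trans (by simp)

lemma entanglementBound_of_schmidtLE [DecidableEq α] [DecidableEq β] {ψ : RingConfig L α β → ℂ}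
    {C : ℕ} (hC : 0 < C) (hnorm : ∑ σ, ‖ψ σ‖ ^ 2 = 1)
    (h : ∀ s m, SchmidtLE ((siteBlock L s m).1 : Set (Fin L)) ((siteBlock L s m).2 : Set (Fin L))
      C ψ) : EntanglementBound C ψ := fun s m =>
  have hr := rank_reducedDensity_le _ (h s m)
  have hp := reducedDensity_posSemidef (siteBlock L s m) ψ
  have ht := trace_reducedDensity (siteBlock L s m) hnorm
  ⟨hr, vonNeumannEntropy_le hp ht hC hr, fun _ hk => renyiEntropy_le hp ht hC hr hk⟩

end Reduced

/-! ### Unitarity -/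

section Unitary

variable {A : Type*} [Ring A] [StarRing A] [HopfAlgebra ℂ A]
  [FiniteDimensional ℂ A] {L : ℕ} [NeZero L]
  {ι κ : Type*} [Fintype ι] [DecidableEq ι] [Fintype κ] [DecidableEq κ]
  (ρ : A →⋆ₐ[ℂ] Matrix ι ι ℂ) {v : κ → κ → A}

lemma update_eq_comm {X ι : Type*} [DecidableEq X] (i : X) (σ τ : X → ι) :
    Function.update σ i (τ i) = τ ↔ Function.update τ i (σ i) = σ := by
  simp only [funext_iff]
  refine forall_congr' fun k => ?_
  by_cases hk : k = i
  · subst hk; simp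
  · simp [hk, eq_comm]

omit [NeZero L] [FiniteDimensional ℂ A] in
-- The relation S(v i j) = (v j i)* makes the inverse given by the antipode the adjoint. Gates are
-- thus unitary and the evolved state stays normalized, which the entropy bounds need.
lemma gateInv_eq_conjTranspose (hv : IsUnitaryCorep v) (x : Fin L × Fin L) :
    gateInv ρ.toAlgHom (Matrix.of v) x =
      (gate ρ.toAlgHom (Matrix.of v) x).conjTranspose := by
  ext s t
  have h₁ := update_eq_comm x.1 s.1 t.1
  have h₂ := update_eq_comm x.2 s.2 t.2
  rw [Matrix.conjTranspose_apply, gate_apply, gateInv, fuse_apply, LinearMap.comp_apply,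
    siteMat_apply]
  by_cases h : Function.update s.2 x.2 (t.2 x.2) = t.2
  · rw [if_pos h, Matrix.of_apply, hv.antipode_apply, AlgHom.toLinearMap_apply, siteRep_apply,
      siteMat_apply]
    by_cases h' : Function.update s.1 x.1 (t.1 x.1) = t.1
    · rw [if_pos h', if_pos ⟨h₁.1 h', h₂.1 h⟩]
      exact congrFun (congrFun (map_star ρ (v (t.2 x.2) (s.2 x.2))) (s.1 x.1)) (t.1 x.1)
    · rw [if_neg h', if_neg fun hc => h' (h₁.2 hc.1), star_zero]
  · rw [if_neg h, if_neg fun hc => h (h₂.2 hc.2), map_zero, map_zero, star_zero]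
    rfl

lemma layers_mem_unitary (hv : IsUnitaryCorep v) (n : ℕ) :
    layers L ρ.toAlgHom (Matrix.of v) n ∈ Matrix.unitaryGroup (RingConfig L ι κ) ℂ := by
  have hgate : ∀ x : Fin L × Fin L,
      gate ρ.toAlgHom (Matrix.of v) x ∈ Matrix.unitaryGroup (RingConfig L ι κ) ℂ := by
    intro x
    rw [Matrix.mem_unitaryGroup_iff, Matrix.star_eq_conjTranspose,
      ← gateInv_eq_conjTranspose ρ hv, gate_mul_gateInv _ hv.isCorep]
  induction n with
  | zero => exact one_mem _
  | succ n ih =>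
    refine mul_mem (list_prod_mem fun T hT => ?_) ih
    obtain ⟨i, _, rfl⟩ := List.mem_map.1 hT
    exact hgate _

lemma sum_norm_sq_mulVec {n : Type*} [Fintype n] [DecidableEq n] {U : Matrix n n ℂ}
    (hU : U ∈ Matrix.unitaryGroup n ℂ) (ψ : n → ℂ) :
    ∑ s, ‖U.mulVec ψ s‖ ^ 2 = ∑ s, ‖ψ s‖ ^ 2 := by
  have h : ∀ φ : n → ℂ, star φ ⬝ᵥ φ = ((∑ s, ‖φ s‖ ^ 2 : ℝ) : ℂ) := by
    intro φ
    rw [dotProduct, Complex.ofReal_sum]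
    refine Finset.sum_congr rfl fun s _ => ?_
    rw [Complex.ofReal_pow]
    exact Complex.conj_mul' _
  have h1 : star (U.mulVec ψ) ⬝ᵥ U.mulVec ψ = star ψ ⬝ᵥ ψ := by
    rw [Matrix.star_mulVec, Matrix.dotProduct_mulVec, Matrix.vecMul_vecMul,
      ← Matrix.star_eq_conjTranspose, Matrix.mem_unitaryGroup_iff'.1 hU, Matrix.vecMul_one]
  rw [h, h] at h1
  exact_mod_cast h1

end Unitary

/-! ### Contiguous blocks -/

section Block

/-- `y` is congruent modulo `N` to one of `s, s + 1, …, s + m - 1`. -/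
def InBlock (N s m y : ℕ) : Prop := ∃ r < m, s + r ≡ y [MOD N]

variable {N s m y : ℕ}

lemma inBlock_congr {y' : ℕ} (h : y ≡ y' [MOD N]) : InBlock N s m y ↔ InBlock N s m y' :=
  exists_congr fun _ => and_congr_right fun _ => ⟨fun h' => h'.trans h, fun h' => h'.trans h.symm⟩

lemma inBlock_add_add (c : ℕ) : InBlock N (s + c) m (y + c) ↔ InBlock N s m y := by
  refine exists_congr fun r => and_congr_right fun _ => ?_
  rw [add_right_comm]
  exact ⟨fun h => h.add_right_cancel' c, fun h => h.add_right c⟩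

/-- A block of consecutive residues is an interval or the complement of an interval. -/
lemma exists_interval_of_inBlock (hN : 0 < N) (s m : ℕ) : ∃ p q, p ≤ q ∧
    ((∀ y < N, InBlock N s m y ↔ p ≤ y ∧ y < q) ∨
      ∀ y < N, InBlock N s m y ↔ ¬(p ≤ y ∧ y < q)) := by
  have ha := Nat.mod_lt s hN
  have hmod : ∀ y < N, InBlock N s m y ↔ ∃ r < m, (s % N + r) % N = y := by
    intro y hy
    refine exists_congr fun r => and_congr_right fun _ => ?_
    rw [Nat.ModEq, Nat.mod_eq_of_lt hy, Nat.mod_add_mod]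
  set a := s % N
  by_cases h : a + m ≤ N
  · refine ⟨a, a + m, Nat.le_add_right _ _, Or.inl fun y hy => ?_⟩
    rw [hmod y hy]
    constructor
    · rintro ⟨r, hr, rfl⟩
      rw [Nat.mod_eq_of_lt (by omega)]
      omega
    · rintro ⟨h1, h2⟩
      exact ⟨y - a, by omega, by rw [Nat.add_sub_cancel' h1, Nat.mod_eq_of_lt hy]⟩
  -- A block that wraps around misses exactly [a + m − N, a); the minimum makes this empty when the
  -- block covers the whole ring.
  · refine ⟨min (a + m - N) a, a, min_le_right _ _, Or.inr fun y hy => ?_⟩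
    rw [hmod y hy]
    constructor
    · rintro ⟨r, hr, hry⟩
      rcases lt_or_ge (a + r) N with h1 | h1
      · rw [Nat.mod_eq_of_lt h1] at hry
        omega
      · have h2 : (a + r) % N ≤ a + r - N := by
          rw [Nat.mod_eq_sub_mod h1]
          exact Nat.mod_le _ _
        omega
    · intro h1
      rcases lt_or_ge y a with h2 | h2
      · refine ⟨y + N - a, by omega, ?_⟩
        rw [show a + (y + N - a) = y + N by omega, Nat.add_mod_right, Nat.mod_eq_of_lt hy]
      · exact ⟨y - a, by omega, by rw [Nat.add_sub_cancel' h2, Nat.mod_eq_of_lt hy]⟩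

variable {L : ℕ}

lemma mem_siteBlock_left (x : Fin L) :
    x ∈ ((siteBlock L s m).1 : Set (Fin L)) ↔ InBlock (2 * L) s m (2 * x) := by
  have hx : 2 * (x : ℕ) < 2 * L := by omega
  simp [siteBlock, InBlock, Nat.ModEq, Nat.mod_eq_of_lt hx]

lemma mem_siteBlock_right (x : Fin L) :
    x ∈ ((siteBlock L s m).2 : Set (Fin L)) ↔ InBlock (2 * L) s m (2 * x + 1) := by
  have hx : 2 * (x : ℕ) + 1 < 2 * L := by omega
  simp [siteBlock, InBlock, Nat.ModEq, Nat.mod_eq_of_lt hx]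

lemma two_mul_add_ofNat [NeZero L] (x : Fin L) (k : ℕ) :
    2 * ((x + Fin.ofNat L k : Fin L) : ℕ) ≡ 2 * x + 2 * k [MOD 2 * L] := by
  rw [← mul_add]
  refine Nat.ModEq.mul_left' 2 ?_
  simp [Fin.val_add, Nat.ModEq]

end Block

/-! ### Entanglement revivals -/

section EntanglementRevival

variable {L : ℕ} [NeZero L] {α β : Type*} {P Q P' Q' : Set (Fin L)} {C n : ℕ}
  {ψ : RingConfig L α β → ℂ}

lemma SchmidtLE.comp_shift (h : SchmidtLE P Q C ψ) (k : Fin L) (hP : ∀ x, x ∈ P ↔ x + k ∈ P')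
    (hQ : ∀ x, x ∈ Q ↔ x - k ∈ Q') : SchmidtLE P' Q' C (ψ ∘ shift L α β k) :=
  h.comp _
    (fun _ _ hs => ⟨fun x hx => hs.1 _ ((hP x).1 hx), fun x hx => hs.2 _ ((hQ x).1 hx)⟩)
    (fun _ _ hs => ⟨fun x hx => hs.1 _ fun h' => hx ((hP x).2 h'),
      fun x hx => hs.2 _ fun h' => hx ((hQ x).2 h')⟩)

/-- The moving frame displaces the ρ-part and the v-part of a block in opposite directions. -/
lemma SchmidtLE.comp_shift_block {s m : ℕ} (t : ℕ)
    (h : SchmidtLE {i : Fin L | InBlock (2 * L) s m (2 * i + 2 * t)}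
      {j : Fin L | InBlock (2 * L) (s + 2 * t) m (2 * j + 1)} C ψ) :
    SchmidtLE ((siteBlock L s m).1 : Set (Fin L)) ((siteBlock L s m).2 : Set (Fin L)) C
      (ψ ∘ shift L α β (Fin.ofNat L t)) := by
  refine h.comp_shift _ (fun x => ?_) (fun x => ?_)
  · rw [mem_siteBlock_left, inBlock_congr (two_mul_add_ofNat x t)]
    rfl
  · obtain ⟨y, rfl⟩ : ∃ y, x = y + Fin.ofNat L t := ⟨x - Fin.ofNat L t, by simp⟩
    rw [add_sub_cancel_right, mem_siteBlock_right, Set.mem_ofPred_eq,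
      inBlock_congr ((two_mul_add_ofNat y t).add_right 1), add_right_comm, inBlock_add_add]

lemma SchmidtLE.comp_shift_swap_block {s m : ℕ} (t : ℕ)
    (h : SchmidtLE {i : Fin L | InBlock (2 * L) s m (2 * i + (2 * t + 1))}
      {j : Fin L | InBlock (2 * L) (s + (2 * t + 1)) m (2 * j + 1)} C ψ) :
    SchmidtLE ((siteBlock L s m).1 : Set (Fin L)) ((siteBlock L s m).2 : Set (Fin L)) C
      (fun out => ψ (shift L α β (Fin.ofNat L t) out.swap)) := by
  refine SchmidtLE.swap (ψ := ψ ∘ shift L α β (Fin.ofNat L t))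
    (h.comp_shift _ (fun x => ?_) (fun x => ?_))
  · rw [mem_siteBlock_right, inBlock_congr ((two_mul_add_ofNat x t).add_right 1)]
    rfl
  · obtain ⟨y, rfl⟩ : ∃ y, x = y + Fin.ofNat L t := ⟨x - Fin.ofNat L t, by simp⟩
    rw [add_sub_cancel_right, mem_siteBlock_left, Set.mem_ofPred_eq,
      inBlock_congr ((two_mul_add_ofNat y t).add_right 1), add_assoc, inBlock_add_add]

lemma SchmidtLE.insert_both [Fintype α] [Fintype β] (h : SchmidtLE P Q C ψ) (hP : P ⊆ P')
    (hQ : Q ⊆ Q') (a b : ℕ) (ha : ∀ y ∈ P', y ∉ P → (y : ℕ) = a)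
    (hb : ∀ y ∈ Q', y ∉ Q → (y : ℕ) = b) :
    SchmidtLE P' Q' (max 1 (Fintype.card α) * (max 1 (Fintype.card β) * C)) ψ := by
  have hval : ∀ (y : Fin L) (a : ℕ), (y : ℕ) = a → y = Fin.ofNat L a := by
    rintro y _ rfl
    exact Fin.ext (Nat.mod_eq_of_lt y.2).symm
  exact (h.insert_right hQ fun y hy hy' => hval y b (hb y hy hy')).insert_left hP
    fun y hy hy' => hval y a (ha y hy hy')

variable {A : Type*} [Ring A] [HopfAlgebra ℂ A] [FiniteDimensional ℂ A]
  {ι κ : Type*} [Fintype ι] [DecidableEq ι] [Fintype κ] [DecidableEq κ]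
  (ρ : A →ₐ[ℂ] Matrix ι ι ℂ) {v : Matrix κ κ A} {χ : ℕ}

lemma layers_mulVec_schmidtLE (hv : IsCorep v) {ψ : RingConfig L ι κ → ℂ} (hψ : IsMPS χ ψ)
    {p q : ℕ} (hpq : p ≤ q) (k : ℕ) :
    SchmidtLE (leftSites L p q) (rightSites L p q) (Module.finrank ℂ A ^ 6 * χ ^ 2)
      ((layers L ρ v (k * L)).mulVec ψ) := by
  have h := layers_pow_schmidtLE (L := L) ρ hv hpq k _ _ (IsMPS_schmidtLE hψ p q)
  rwa [show layers L ρ v (k * L) = layers L ρ v L ^ k by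
    rw [← zero_add (k * L), layers_add_mul, layers, one_mul]]

/-- The Schmidt rank across any contiguous block after `k` periods `L / 2`. -/
lemma layers_mulVec_schmidtLE_block (hv : IsCorep v) {ψ : RingConfig L ι κ → ℂ} (hψ : IsMPS χ ψ)
    (k s m : ℕ) : SchmidtLE {i : Fin L | InBlock (2 * L) s m (2 * i)}
      {j : Fin L | InBlock (2 * L) s m (2 * j + 1)} (Module.finrank ℂ A ^ 6 * χ ^ 2)
      ((layers L ρ v (k * L)).mulVec ψ) := by
  obtain ⟨p, q, hpq, h⟩ := exists_interval_of_inBlock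
    (Nat.mul_pos two_pos (Nat.pos_of_neZero L)) s m
  have h' := layers_mulVec_schmidtLE ρ hv hψ hpq k
  rcases h with h | h
  · convert h' using 1 <;> ext x
    · exact h _ (by omega)
    · exact h _ (by omega)
  · convert h'.compl using 1 <;> ext x
    · exact h _ (by omega)
    · exact h _ (by omega)

/-- The extra layer has index kL, that is 0 modulo L, and couples the two sites of each cell. No
gate crosses the ends of a block of whole cells. -/
lemma layers_succ_mulVec_schmidtLE (hv : IsCorep v) {ψ : RingConfig L ι κ → ℂ} (hψ : IsMPS χ ψ)
    {a b : ℕ} (hab : a ≤ b) (k : ℕ) :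
    SchmidtLE (leftSites L (2 * a) (2 * b)) (rightSites L (2 * a) (2 * b))
      (Module.finrank ℂ A ^ 6 * χ ^ 2) ((layers L ρ v (k * L + 1)).mulVec ψ) := by
  have h := layers_mulVec_schmidtLE (L := L) ρ hv hψ (Nat.mul_le_mul_left 2 hab) k
  have h0 : Fin.ofNat L (k * L) = 0 := Fin.ext (by simp)
  rw [layers, ← Matrix.mulVec_mulVec, h0, ← one_mul (Module.finrank ℂ A ^ 6 * χ ^ 2)]
  refine (InvertibleSchmidtLE.listProd fun T hT => ?_).1 _ _ h
  obtain ⟨i, _, rfl⟩ := List.mem_map.1 hT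
  refine gate_invertibleSchmidtLE ρ hv _ ?_
  simp only [add_zero, leftSites, rightSites, Set.mem_ofPred_eq]
  omega

/-- The Schmidt rank across any contiguous block one layer after `k` periods `L / 2`. -/
lemma layers_succ_mulVec_schmidtLE_block (hv : IsCorep v) {ψ : RingConfig L ι κ → ℂ}
    (hψ : IsMPS χ ψ) (k s m : ℕ) : SchmidtLE {i : Fin L | InBlock (2 * L) s m (2 * i + 1)}
      {j : Fin L | InBlock (2 * L) s m (2 * j)}
      (max 1 (Fintype.card ι) * (max 1 (Fintype.card κ) * (Module.finrank ℂ A ^ 6 * χ ^ 2)))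
      ((layers L ρ v (k * L + 1)).mulVec ψ) := by
  obtain ⟨p, q, hpq, h⟩ := exists_interval_of_inBlock
    (Nat.mul_pos two_pos (Nat.pos_of_neZero L)) s m
  rcases h with h | h
  · have hP : ∀ x : Fin L, InBlock (2 * L) s m (2 * x + 1) ↔ p ≤ 2 * (x : ℕ) + 1 ∧ 2 * (x : ℕ) + 1 < q :=
      fun x => h _ (by omega)
    have hQ : ∀ x : Fin L, InBlock (2 * L) s m (2 * x) ↔ p ≤ 2 * (x : ℕ) ∧ 2 * (x : ℕ) < q :=
      fun x => h _ (by omega)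
    -- The ends are rounded inwards to whole cells, with the maximum keeping the interval well
    -- formed. What is missing is at most the left site of cell p / 2 and the right site of cell q /
    -- 2.
    refine SchmidtLE.insert_both (layers_succ_mulVec_schmidtLE ρ hv hψ
      (le_max_left ((p + 1) / 2) (q / 2)) k) ?_ ?_ (p / 2) (q / 2) ?_ ?_ <;>
      intro x <;>
      simp only [hP, hQ, leftSites, rightSites, Set.mem_ofPred_eq] <;> omega
  · have hP : ∀ x : Fin L, InBlock (2 * L) s m (2 * x + 1) ↔
        ¬(p ≤ 2 * (x : ℕ) + 1 ∧ 2 * (x : ℕ) + 1 < q) :=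
      fun x => h _ (by omega)
    have hQ : ∀ x : Fin L, InBlock (2 * L) s m (2 * x) ↔ ¬(p ≤ 2 * (x : ℕ) ∧ 2 * (x : ℕ) < q) :=
      fun x => h _ (by omega)
    -- For a complement the ends are rounded outwards, so that the complement of the whole cells
    -- lies inside the block. An empty gap p = q must remain empty.
    obtain ⟨a, b, hab, h1⟩ : ∃ a b, a ≤ b ∧ (p < q → a = p / 2 ∧ b = (q + 1) / 2) ∧
        (p = q → a = b) := by
      rcases hpq.lt_or_eq with h | h
      · exact ⟨p / 2, (q + 1) / 2, by omega, fun _ => ⟨rfl, rfl⟩, fun _ => by omega⟩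
      · exact ⟨0, 0, le_rfl, fun _ => by omega, fun _ => rfl⟩
    refine SchmidtLE.insert_both (layers_succ_mulVec_schmidtLE ρ hv hψ hab k).compl
      ?_ ?_ (q / 2) (p / 2) ?_ ?_ <;>
      intro x <;>
      simp only [hP, hQ, leftSites, rightSites, Set.mem_ofPred_eq, Set.mem_compl_iff] <;> omega

/-- After kL layers the two displacements differ by 2kL, which is 0 modulo the 2L sites of the ring,
so both kinds of sites see the same block; hence the period L/2. One more layer exchanges even and
odd positions. -/
lemma layers_mulVec_schmidtLE_moving_block (hv : IsCorep v) {ψ : RingConfig L ι κ → ℂ}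
    (hψ : IsMPS χ ψ) {k n : ℕ} (hn : n = k * L ∨ n = k * L + 1) (s m : ℕ) :
    SchmidtLE {i : Fin L | InBlock (2 * L) s m (2 * i + n)}
      {j : Fin L | InBlock (2 * L) (s + n) m (2 * j + 1)}
      (max 1 (Fintype.card ι) * (max 1 (Fintype.card κ) * (Module.finrank ℂ A ^ 6 * χ ^ 2)))
      ((layers L ρ v n).mulVec ψ) := by
  have hP : ∀ y, InBlock (2 * L) s m (y + k * L) ↔ InBlock (2 * L) (s + k * L) m y := by
    intro y
    rw [← inBlock_add_add (k * L)]
    refine inBlock_congr ?_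
    rw [show y + k * L + k * L = y + 2 * L * k by ring]
    exact Nat.add_modEq_left_iff.2 (dvd_mul_right _ _)
  rcases hn with rfl | rfl
  · simp only [hP]
    refine (layers_mulVec_schmidtLE_block ρ hv hψ k _ m).mono ?_
    rw [← mul_assoc]
    exact Nat.le_mul_of_pos_left _ (Nat.mul_pos (by simp) (by simp))
  · have hQ : ∀ y, InBlock (2 * L) (s + (k * L + 1)) m (y + 1) ↔
        InBlock (2 * L) (s + k * L) m y := fun y => by rw [← add_assoc, inBlock_add_add]
    have hP' : ∀ y, InBlock (2 * L) s m (y + (k * L + 1)) ↔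
        InBlock (2 * L) (s + k * L) m (y + 1) := fun y => by
      rw [← add_assoc, add_right_comm, hP]
    simp only [hP', hQ]
    exact layers_succ_mulVec_schmidtLE_block ρ hv hψ k _ m

end EntanglementRevival

/-! ### Entropy bounds for the evolved states -/

section Bound

variable {A : Type*} [Ring A] [StarRing A] [HopfAlgebra ℂ A] [StarModule ℂ A]
  [FiniteDimensional ℂ A] {L : ℕ} [NeZero L]
  {ι κ : Type*} [Fintype ι] [DecidableEq ι] [Fintype κ] [DecidableEq κ]
  (ρ : A →⋆ₐ[ℂ] Matrix ι ι ℂ) {v : κ → κ → A} {χ : ℕ} {ψ : RingConfig L ι κ → ℂ}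

omit [DecidableEq ι] [DecidableEq κ] in
lemma card_pos_of_isMPS (hψ : IsMPS χ ψ) (hnorm : ∑ σ, ‖ψ σ‖ ^ 2 = 1) :
    0 < Fintype.card ι ∧ 0 < Fintype.card κ ∧ 0 < χ := by
  obtain ⟨σ, hσ⟩ : ∃ σ, ψ σ ≠ 0 := by
    by_contra! h
    simp [h] at hnorm
  refine ⟨Fintype.card_pos_iff.2 ⟨σ.1 0⟩, Fintype.card_pos_iff.2 ⟨σ.2 0⟩, ?_⟩
  obtain ⟨M, N, h⟩ := hψ
  rw [Nat.pos_iff_ne_zero]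
  rintro rfl
  exact hσ ((h σ).trans (by simp [Matrix.trace]))

/-- The argument yields d⁶χ²; the stated constant allows d⁸χ². Positive dimensions remove the `max
1`. -/
lemma schmidt_bound_le {a b d χ : ℕ} (ha : 0 < a) (hb : 0 < b) (hd : 0 < d) :
    max 1 a * (max 1 b * (d ^ 6 * χ ^ 2)) ≤ a * b * (d ^ 4 * χ) ^ 2 := by
  rw [max_eq_right ha, max_eq_right hb, ← mul_assoc, mul_pow, ← pow_mul]
  exact Nat.mul_le_mul_left _ (Nat.mul_le_mul_right _ (Nat.pow_le_pow_right hd (by norm_num)))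

lemma entanglementBound_floquet (hv : IsUnitaryCorep v) (hψ : IsMPS χ ψ)
    (hnorm : ∑ σ, ‖ψ σ‖ ^ 2 = 1) {k t : ℕ} (ht : 2 * t = k * L ∨ 2 * t = k * L + 1) :
    EntanglementBound (Fintype.card ι * Fintype.card κ * (Module.finrank ℂ A ^ 4 * χ) ^ 2)
      ((floquet L ρ v ^ t).mulVec ψ) := by
  obtain ⟨hι, hκ, hχ⟩ := card_pos_of_isMPS hψ hnorm
  have hd : 0 < Module.finrank ℂ A := 
    Nat.pos_of_ne_zero (Nat.cast_ne_zero.1 (finrank_ne_zero (A := A)))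
  have hstate : (floquet L ρ v ^ t).mulVec ψ =
      (layers L ρ.toAlgHom (Matrix.of v) (2 * t)).mulVec ψ ∘ shift L ι κ (Fin.ofNat L t) := by
    rw [floquet_pow]
    rfl
  refine entanglementBound_of_schmidtLE (by positivity) ?_ fun s m => ?_
  · rw [hstate, ← hnorm, ← sum_norm_sq_mulVec (layers_mem_unitary ρ hv (2 * t)) ψ]
    exact Equiv.sum_comp _ fun σ => ‖(layers L ρ.toAlgHom (Matrix.of v) (2 * t)).mulVec ψ σ‖ ^ 2
  · rw [hstate]
    exact ((layers_mulVec_schmidtLE_moving_block _ hv.isCorep hψ ht s m).mono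
      (schmidt_bound_le hι hκ hd)).comp_shift_block t

lemma entanglementBound_oddLayer_floquet (hv : IsUnitaryCorep v) (hψ : IsMPS χ ψ)
    (hnorm : ∑ σ, ‖ψ σ‖ ^ 2 = 1) {k t : ℕ} (ht : 2 * t + 1 = k * L ∨ 2 * t + 1 = k * L + 1) :
    EntanglementBound (Fintype.card ι * Fintype.card κ * (Module.finrank ℂ A ^ 4 * χ) ^ 2)
      ((oddLayer L ρ v).mulVec ((floquet L ρ v ^ t).mulVec ψ)) := by
  obtain ⟨hι, hκ, hχ⟩ := card_pos_of_isMPS hψ hnorm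
  have hd : 0 < Module.finrank ℂ A := 
    Nat.pos_of_ne_zero (Nat.cast_ne_zero.1 (finrank_ne_zero (A := A)))
  have hstate : (oddLayer L ρ v).mulVec ((floquet L ρ v ^ t).mulVec ψ) = fun out =>
      (layers L ρ.toAlgHom (Matrix.of v) (2 * t + 1)).mulVec ψ
        (shift L ι κ (Fin.ofNat L t) out.swap) := by
    rw [Matrix.mulVec_mulVec, oddLayer_mul_floquet_pow]
    rfl
  refine entanglementBound_of_schmidtLE (by positivity) ?_ fun s m => ?_
  · rw [hstate, ← hnorm, ← sum_norm_sq_mulVec (layers_mem_unitary ρ hv (2 * t + 1)) ψ]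
    exact Equiv.sum_comp ((Equiv.prodComm _ _).trans (shift L ι κ (Fin.ofNat L t)))
      fun σ => ‖(layers L ρ.toAlgHom (Matrix.of v) (2 * t + 1)).mulVec ψ σ‖ ^ 2
  · rw [hstate]
    exact ((layers_mulVec_schmidtLE_moving_block _ hv.isCorep hψ ht s m).mono
      (schmidt_bound_le hι hκ hd)).comp_shift_swap_block t

end Bound

end CStarHopf

end

theorem mainTheorem8 {A : Type*} [Ring A] [StarRing A] [HopfAlgebra ℂ A] [StarModule ℂ A]
    [FiniteDimensional ℂ A] [IsCStarHopfAlgebra A] :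
    ∃ η : ℕ,
      -- `η` is the exponent of `A`: the (finite) order of the canonical element, for any basis
      (∀ b : Module.Basis (Fin (Module.finrank ℂ A)) ℂ A,
        IsLeast {n : ℕ | 0 < n ∧
          canonicalElement b ^ n = (1 : A) ⊗ₜ[ℂ] counitDual A} η) ∧
      -- equivalently, the least `n` with `∑ z₍₁₎ ⋯ z₍ₙ₎ = ε(z) 1` for all `z`
      IsLeast {n : ℕ | 0 < n ∧ ∀ z : A,
        sweedlerPower A n z = Coalgebra.counit (R := ℂ) z • (1 : A)} η ∧
      -- periodicity of the circuit; the revival time exists and divides `η L` (and `η L / 2` if `η`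
      -- is even)
      (∀ (dρ dv L : ℕ) [NeZero L] (ρ : A →⋆ₐ[ℂ] Matrix (Fin dρ) (Fin dρ) ℂ)
        (v : Fin dv → Fin dv → A), IsUnitaryCorep v →
        floquet L ρ v ^ (η * L) = 1 ∧
        ∃ τ : ℕ, IsLeast {t : ℕ | 0 < t ∧ floquet L ρ v ^ t = 1} τ ∧
          τ ∣ η * L ∧ ∀ m, η = 2 * m → τ ∣ m * L) ∧
      -- the same with half-integer times `n / 2` when `H_ρ = H_v`
      (∀ (d L : ℕ) [NeZero L] (ρ : A →⋆ₐ[ℂ] Matrix (Fin d) (Fin d) ℂ)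
        (v : Fin d → Fin d → A), IsUnitaryCorep v →
        (∀ n, halfStepEvolution L ρ v (n + 2 * (η * L)) = halfStepEvolution L ρ v n) ∧
        ∃ τ : ℕ,
          IsLeast {n : ℕ | 0 < n ∧ halfStepEvolution L ρ v n = 1} τ ∧
          IsLeast {n : ℕ | 0 < n ∧ ∃ n₀, 0 < n₀ ∧
            halfStepEvolution L ρ v (n₀ + n) = halfStepEvolution L ρ v n₀} τ ∧
          τ ∣ 2 * (η * L) ∧ ∀ m, η = 2 * m → τ ∣ 2 * (m * L)) ∧
      -- entanglement revivals: at the times `k L / 2` and `(k L + 1) / 2` the entanglement of a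
      -- state that started as a matrix product state is bounded independently of `L` and `k`
      (∀ (dρ dv L χ : ℕ) [NeZero L] (ρ : A →⋆ₐ[ℂ] Matrix (Fin dρ) (Fin dρ) ℂ)
        (v : Fin dv → Fin dv → A), IsUnitaryCorep v →
        ∀ ψ : RingConfig L (Fin dρ) (Fin dv) → ℂ,
          IsMPS χ ψ → ∑ σ, ‖ψ σ‖ ^ 2 = 1 →
        ∀ k m : ℕ,
          ((2 * m = k * L ∨ 2 * m = k * L + 1) →
            EntanglementBound (dρ * dv * (Module.finrank ℂ A ^ 4 * χ) ^ 2)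
              ((floquet L ρ v ^ m).mulVec ψ)) ∧
          ((2 * m + 1 = k * L ∨ 2 * m + 1 = k * L + 1) →
            EntanglementBound (dρ * dv * (Module.finrank ℂ A ^ 4 * χ) ^ 2)
              ((oddLayer L ρ v).mulVec ((floquet L ρ v ^ m).mulVec ψ)))) := by
  obtain ⟨η, hη⟩ := CStarHopf.exists_exponent A
  refine ⟨η, fun b => ?_, ?_, fun dρ dv L _ ρ v hv => ?_, fun d L _ ρ v hv => ?_, ?_⟩
  · simpa only [CStarHopf.canonicalElement_pow_eq_iff] using hη
  · simpa only [CStarHopf.sweedlerPower_eq_counit_iff] using hη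
  · exact CStarHopf.exists_revival ρ hv hη.1.1 hη.1.2
  · exact CStarHopf.exists_halfStep_revival ρ hv hη.1.1 hη.1.2
  · intro dρ dv L χ _ ρ v hv ψ hψ hnorm k m
    have h1 := fun h => CStarHopf.entanglementBound_floquet ρ hv hψ hnorm (k := k) (t := m) h
    have h2 := fun h =>
      CStarHopf.entanglementBound_oddLayer_floquet ρ hv hψ hnorm (k := k) (t := m) h
    rw [Fintype.card_fin, Fintype.card_fin] at h1 h2
    exact ⟨h1, h2⟩
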